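/- Let $n\ge 2$, $f\in C^1(\mathbb{R})$ and $u\in W^{3,1}_{loc}(\mathbb{R}^n)$. Suppose that $u$ is a stable solution on $\mathbb{R}^n$ of the mean curvature equation $$\operatorname{div}\left(\frac{\nabla u}{\sqrt{1+|\nabla u|^2}}\right)=-f(u),$$ that is, $f(u)$ and $f'(u)$ belong to $L^1_{loc}(\mathbb{R}^n)$, $$\int_{\mathbb{R}^n}\frac{\nabla u\cdot\nabla\varphi}{\sqrt{1+|\nabla u|^2}}\,dx=\int_{\mathbb{R}^n} f(u)\,\varphi\,dx\qquad\text{for all }\varphi\in C_c^\infty(\mathbb{R}^n),$$ and $$\int_{\mathbb{R}^n} f'(u)\,\xi^2\,dx\le\int_{\mathbb{R}^n}\left(\frac{|\nabla\xi|^2}{\sqrt{1+|\nabla u|^2}}-\frac{(\nabla u\cdot\nabla\xi)^2}{(1+|\nabla u|^2)^{3/2}}\right)dx\qquad\text{for all }\xi\in C_c^\infty(\mathbb{R}^n),$$ where $\nabla u$ is the weak gradient. Set $$q_n=-1\ \text{ if } 2\le n\le 10,\qquad q_n=-\frac n2+\sqrt{n-1}+1\ \text{ if } n\ge 11.$$ 1.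 If $u$ is not (almost everywhere equal to) a constant, then there exist $c>0$ and $R_0>2$ such that $$\frac{1}{|B_{2R}\setminus B_R|}\int_{B_{2R}\setminus B_R}|\nabla u|^2\,dx\ \ge\ c\,R^{2q_n}\qquad\text{for all } R\ge R_0,$$ where $B_r$ is the ball of radius $r$ centred at the origin and the integral may be $+\infty$. 2. In particular, if $|\nabla u(x)|=o(|x|^{q_n})$ as $|x|\to\infty$ (for almost every $x$), then $u$ is (almost everywhere equal to) a constant. -/

import Mathlib

open MeasureTheory Filter Metric
open scoped ContDiff Gradient InnerProductSpace

/-- The class `C_c^∞(ℝⁿ)` of smooth compactly supported real functions. -/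
def IsTestFunction {n : ℕ} (φ : EuclideanSpace ℝ (Fin n) → ℝ) : Prop :=
  ContDiff ℝ ∞ φ ∧ HasCompactSupport φ

/-- `g ∈ L^1_loc(ℝⁿ)` is the weak `i`-th partial derivative of `u ∈ L^1_loc(ℝⁿ)`. -/
def HasWeakPartialDeriv {n : ℕ} (i : Fin n) (u g : EuclideanSpace ℝ (Fin n) → ℝ) : Prop :=
  LocallyIntegrable u volume ∧ LocallyIntegrable g volume ∧
    ∀ φ : EuclideanSpace ℝ (Fin n) → ℝ, IsTestFunction φ →
      ∫ x, u x * fderiv ℝ φ x (EuclideanSpace.single i 1) = -∫ x, g x * φ x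

/-- The local Sobolev space `W^{k,1}_loc(ℝⁿ)`: all weak partial derivatives up to order `k`
exist as functions in `L^1_loc(ℝⁿ)`. -/
def MemSobolevLoc {n : ℕ} : ℕ → (EuclideanSpace ℝ (Fin n) → ℝ) → Prop
  | 0, u => LocallyIntegrable u volume
  | k + 1, u => LocallyIntegrable u volume ∧
      ∀ i : Fin n, ∃ g : EuclideanSpace ℝ (Fin n) → ℝ,
        HasWeakPartialDeriv i u g ∧ MemSobolevLoc k g

/-- `G` is (a representative of) the weak gradient of `u ∈ W^{1,1}_loc(ℝⁿ)`. It is determined by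
`u` up to a null set. -/
def HasWeakGradient {n : ℕ} (u : EuclideanSpace ℝ (Fin n) → ℝ)
    (G : EuclideanSpace ℝ (Fin n) → EuclideanSpace ℝ (Fin n)) : Prop :=
  ∀ i : Fin n, HasWeakPartialDeriv i u (fun x => G x i)

/-- `u ∈ W^{1,1}_loc(ℝⁿ)` is a weak solution of `div (∇u / √(1 + |∇u|²)) = -f(u)` in `ℝⁿ`,
and it is stable. -/
def IsStableSolution {n : ℕ} (f : ℝ → ℝ) (u : EuclideanSpace ℝ (Fin n) → ℝ) : Prop :=
  LocallyIntegrable u volume ∧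
  LocallyIntegrable (fun x => f (u x)) volume ∧
  LocallyIntegrable (fun x => deriv f (u x)) volume ∧
  ∃ G : EuclideanSpace ℝ (Fin n) → EuclideanSpace ℝ (Fin n),
    HasWeakGradient u G ∧
    (∀ φ : EuclideanSpace ℝ (Fin n) → ℝ, IsTestFunction φ →
      ∫ x, ⟪G x, ∇ φ x⟫_ℝ / √(1 + ‖G x‖ ^ 2) = ∫ x, f (u x) * φ x) ∧
    (∀ ξ : EuclideanSpace ℝ (Fin n) → ℝ, IsTestFunction ξ →
      ∫ x, deriv f (u x) * ξ x ^ 2 ≤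
        ∫ x, (‖∇ ξ x‖ ^ 2 / √(1 + ‖G x‖ ^ 2) -
          ⟪G x, ∇ ξ x⟫_ℝ ^ 2 / (1 + ‖G x‖ ^ 2) ^ (3 / 2 : ℝ)))

/-- The exponent `q_n` (used for `n ≥ 2`). -/
noncomputable def liouvilleExponent (n : ℕ) : ℝ :=
  if n ≤ 10 then -1 else -(n : ℝ) / 2 + √((n : ℝ) - 1) + 1

/-!
The radial derivative `w = x · ∇u` generates the dilations of `u`, so it solves the linearized
equation up to a first-order term. Testing the stability inequality with `w η` and subtracting the
linearized equation tested with `w η²` removes the terms that are quadratic in `D²u`; the remaining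
term in `D²u` is the derivative along `x` of a function of `∇u`, and the Pohozaev identity removes
it. (Since `w` need not be bounded, it is first truncated to `w / √(1 + δ² w²)`, and then `δ → 0`.)
The result is an inequality `0 ≤ ∫ stabilityDensity` in `∇u` and `η` alone.

Now let `η = (1 + |x|²)^(-b/2)`, cut off between `B_R` and `B_{2R}`. An elementary inequality, for a
suitable `b = testDecay n`, makes the integrand nonpositive in `B_R`, and negative where `∇u ≠ 0`,
while on the annulus it is at most a constant times `R^(-2b) |∇u|²`. If `u` is not constant, then
`∫_{B_{2R} \ B_R} |∇u|² ≥ c R^(2b)`, and the exponent `q_n` satisfies `2 q_n = 2 b - n`.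
-/

open ContinuousLinearMap
open scoped Convolution Topology ENNReal

section Mollification

section Bump

variable (E : Type*) [NormedAddCommGroup E]

/-- The bump functions centred at the origin, with radii of order `1 / (k + 1)`, whose
normalizations serve as mollifiers. -/
noncomputable def mollifierBump (k : ℕ) : ContDiffBump (0 : E) where
  rIn := 1 / (2 * ((k : ℝ) + 1))
  rOut := 1 / ((k : ℝ) + 1)
  rIn_pos := by positivity
  rIn_lt_rOut := by
    apply one_div_lt_one_div_of_lt <;> nlinarith [(Nat.cast_nonneg k : (0 : ℝ) ≤ k)]

lemma mollifierBump_rOut_le_one (k : ℕ) : (mollifierBump E k).rOut ≤ 1 := by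
  change 1 / ((k : ℝ) + 1) ≤ 1
  rw [div_le_one (by positivity)]
  linarith [(Nat.cast_nonneg k : (0 : ℝ) ≤ k)]

lemma tendsto_mollifierBump_rOut : Tendsto (fun k => (mollifierBump E k).rOut) atTop (𝓝 0) :=
  tendsto_one_div_add_atTop_nhds_zero_nat

end Bump

variable {E : Type*} [NormedAddCommGroup E] [InnerProductSpace ℝ E] [FiniteDimensional ℝ E]
  [MeasurableSpace E] [BorelSpace E] {F : Type*} [NormedAddCommGroup F] [NormedSpace ℝ F]

/-- The mollification of `g` at scale `1 / (k + 1)`. -/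
noncomputable def mollify (k : ℕ) (g : E → F) : E → F :=
  (mollifierBump E k).normed volume ⋆[lsmul ℝ ℝ, volume] g

lemma mollify_apply (k : ℕ) (g : E → F) (x : E) :
    mollify k g x = ∫ t, (mollifierBump E k).normed volume t • g (x - t) := rfl

lemma mollify_apply_swap (k : ℕ) (g : E → F) (x : E) :
    mollify k g x = ∫ t, (mollifierBump E k).normed volume (x - t) • g t := by
  rw [mollify, convolution_eq_swap]
  rfl

lemma mollify_congr_ae (k : ℕ) {g h : E → F} (hgh : g =ᵐ[volume] h) :
    mollify k g = mollify k h :=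
  convolution_congr _ EventuallyEq.rfl hgh

lemma contDiff_mollify (k : ℕ) {g : E → F} (hg : LocallyIntegrable g volume) :
    ContDiff ℝ ∞ (mollify k g) :=
  (mollifierBump E k).hasCompactSupport_normed.contDiff_convolution_left (n := ⊤) _
    (mollifierBump E k).contDiff_normed hg

lemma mollify_sub (k : ℕ) {g h : E → F} (hg : LocallyIntegrable g volume)
    (hh : LocallyIntegrable h volume) :
    mollify k (g - h) = mollify k g - mollify k h := by
  have integrable {v : E → F} (hv : LocallyIntegrable v volume) (x : E) :
      Integrable (fun t => (mollifierBump E k).normed volume t • v (x - t)) :=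
    ((mollifierBump E k).hasCompactSupport_normed.convolutionExists_left (lsmul ℝ ℝ)
      (mollifierBump E k).continuous_normed hv x).integrable
  ext x
  simp only [mollify_apply, Pi.sub_apply, smul_sub]
  exact integral_sub (integrable hg x) (integrable hh x)

lemma mollify_eq_of_eqOn_ball (k : ℕ) {g h : E → F} {x : E} (hgh : Set.EqOn g h (ball x 1)) :
    mollify k g x = mollify k h x := by
  rw [mollify_apply, mollify_apply]
  refine integral_congr_ae (Eventually.of_forall fun t => ?_)
  by_cases ht : t ∈ Function.support ((mollifierBump E k).normed volume)
  · rw [ContDiffBump.support_normed_eq, mem_ball_zero_iff] at ht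
    have hmem : x - t ∈ ball x 1 := by
      rw [mem_ball, dist_eq_norm, sub_sub_cancel_left, norm_neg]
      exact ht.trans_le (mollifierBump_rOut_le_one E k)
    simp only [hgh hmem]
  · simp only [Function.notMem_support.1 ht, zero_smul]

lemma support_mollify_subset (k : ℕ) {g : E → F} :
    Function.support (mollify k g) ⊆ cthickening 1 (tsupport g) := by
  intro x hx
  contrapose! hx
  have hg : Set.EqOn g 0 (ball x 1) := fun y hy => by
    contrapose! hx
    exact mem_cthickening_of_dist_le x y 1 _ (subset_tsupport _ hx) (mem_ball'.1 hy).le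
  rw [Function.notMem_support, mollify_eq_of_eqOn_ball k hg, mollify_apply]
  simp only [Pi.zero_apply, smul_zero, integral_zero]

lemma hasCompactSupport_mollify (k : ℕ) {g : E → F} (hg : HasCompactSupport g) :
    HasCompactSupport (mollify k g) :=
  hg.isCompact.cthickening.of_isClosed_subset (isClosed_tsupport _)
    (closure_minimal (support_mollify_subset k) isClosed_cthickening)

lemma norm_mollify_le_of_norm_le (k : ℕ) {g : E → F} {C : ℝ} (hC : ∀ x, ‖g x‖ ≤ C) (x : E) :
    ‖mollify k g x‖ ≤ C := by
  rw [mollify_apply]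
  calc ‖∫ t, (mollifierBump E k).normed volume t • g (x - t)‖
      ≤ ∫ t, (mollifierBump E k).normed volume t * C := by
        refine norm_integral_le_of_norm_le ((mollifierBump E k).integrable_normed.mul_const C)
          (Eventually.of_forall fun t => ?_)
        rw [norm_smul, Real.norm_of_nonneg ((mollifierBump E k).nonneg_normed t)]
        exact mul_le_mul_of_nonneg_left (hC _) ((mollifierBump E k).nonneg_normed t)
    _ = C := by rw [integral_mul_const, ContDiffBump.integral_normed, one_mul]

lemma ae_tendsto_mollify [CompleteSpace F] {g : E → F} (hg : LocallyIntegrable g volume) :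
    ∀ᵐ x, Tendsto (fun k => mollify k g x) atTop (𝓝 (g x)) := by
  refine ContDiffBump.ae_convolution_tendsto_right_of_locallyIntegrable (K := 2)
    (tendsto_mollifierBump_rOut E) (Eventually.of_forall fun k => le_of_eq ?_) hg
  change 1 / ((k : ℝ) + 1) = 2 * (1 / (2 * ((k : ℝ) + 1)))
  field_simp

lemma tendstoUniformly_mollify [CompleteSpace F] {g : E → F} (hg : UniformContinuous g) :
    TendstoUniformly (fun k => mollify k g) g atTop := by
  rw [Metric.tendstoUniformly_iff]
  intro ε hε
  obtain ⟨δ, hδ, hgδ⟩ := Metric.uniformContinuous_iff.1 hg (ε / 2) (half_pos hε)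
  filter_upwards [(tendsto_mollifierBump_rOut E).eventually (gt_mem_nhds hδ)] with k hk x
  rw [dist_comm]
  refine (ContDiffBump.dist_normed_convolution_le hg.continuous.aestronglyMeasurable
    fun y hy => ?_).trans_lt (half_lt_self hε)
  exact (hgδ ((mem_ball.1 hy).trans hk)).le

/-- The probability measure with density the mollifier at scale `1 / (k + 1)`; mollification
averages translates with respect to it. -/
noncomputable def mollifierMeasure (E : Type*) [NormedAddCommGroup E] [InnerProductSpace ℝ E]
    [FiniteDimensional ℝ E] [MeasurableSpace E] [BorelSpace E] (k : ℕ) : Measure E :=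
  volume.withDensity fun t => ENNReal.ofReal ((mollifierBump E k).normed volume t)

instance isProbabilityMeasure_mollifierMeasure (k : ℕ) :
    IsProbabilityMeasure (mollifierMeasure E k) := by
  constructor
  rw [mollifierMeasure, withDensity_apply _ MeasurableSet.univ, setLIntegral_univ,
    ← ofReal_integral_eq_lintegral_ofReal (mollifierBump E k).integrable_normed
      (Eventually.of_forall fun x => (mollifierBump E k).nonneg_normed x),
    ContDiffBump.integral_normed, ENNReal.ofReal_one]

lemma enorm_mollify_le (k : ℕ) (g : E → F) (x : E) :
    ‖mollify k g x‖ₑ ≤ ∫⁻ t, ‖g (x - t)‖ₑ ∂(mollifierMeasure E k) := by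
  rw [mollify_apply, mollifierMeasure, lintegral_withDensity_eq_lintegral_mul_non_measurable]
  · refine (enorm_integral_le_lintegral_enorm _).trans (lintegral_mono fun t => ?_)
    rw [enorm_smul, Real.enorm_of_nonneg ((mollifierBump E k).nonneg_normed t)]
    rfl
  · exact (mollifierBump E k).continuous_normed.measurable.ennreal_ofReal
  · exact Eventually.of_forall fun t => ENNReal.ofReal_lt_top

lemma enorm_mollify_rpow_le (k : ℕ) {g : E → F} (hg : StronglyMeasurable g) {p : ℝ}
    (hp : 1 ≤ p) (x : E) :
    ‖mollify k g x‖ₑ ^ p ≤ ∫⁻ t, ‖g (x - t)‖ₑ ^ p ∂(mollifierMeasure E k) := by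
  have hp0 : 0 < p := one_pos.trans_le hp
  have hmeas : AEStronglyMeasurable (fun t => g (x - t)) (mollifierMeasure E k) :=
    (hg.comp_measurable (measurable_const.sub measurable_id)).aestronglyMeasurable
  have hle : ‖mollify k g x‖ₑ ≤ (∫⁻ t, ‖g (x - t)‖ₑ ^ p ∂(mollifierMeasure E k)) ^ (1 / p) := by
    have hmono : eLpNorm (fun t => g (x - t)) 1 (mollifierMeasure E k) ≤
        eLpNorm (fun t => g (x - t)) (ENNReal.ofReal p) (mollifierMeasure E k) :=
      eLpNorm_le_eLpNorm_of_exponent_le (ENNReal.one_le_ofReal.2 hp) hmeas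
    rw [eLpNorm_one_eq_lintegral_enorm, eLpNorm_eq_lintegral_rpow_enorm_toReal
      (ENNReal.ofReal_pos.2 hp0).ne' ENNReal.ofReal_ne_top, ENNReal.toReal_ofReal hp0.le] at hmono
    exact (enorm_mollify_le k g x).trans hmono
  calc ‖mollify k g x‖ₑ ^ p
      ≤ ((∫⁻ t, ‖g (x - t)‖ₑ ^ p ∂(mollifierMeasure E k)) ^ (1 / p)) ^ p :=
        ENNReal.rpow_le_rpow hle hp0.le
    _ = ∫⁻ t, ‖g (x - t)‖ₑ ^ p ∂(mollifierMeasure E k) := by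
        rw [← ENNReal.rpow_mul, one_div, inv_mul_cancel₀ hp0.ne', ENNReal.rpow_one]

lemma eLpNorm_mollify_le (k : ℕ) {g : E → F} (hg : AEStronglyMeasurable g volume) {p : ℝ≥0∞}
    (hp : 1 ≤ p) (hp' : p ≠ ⊤) :
    eLpNorm (mollify k g) p volume ≤ eLpNorm g p volume := by
  wlog hgm : StronglyMeasurable g generalizing g
  · rw [mollify_congr_ae k hg.ae_eq_mk, eLpNorm_congr_ae hg.ae_eq_mk]
    exact this hg.stronglyMeasurable_mk.aestronglyMeasurable hg.stronglyMeasurable_mk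
  have hp0 : p ≠ 0 := (zero_lt_one.trans_le hp).ne'
  have hpr : 1 ≤ p.toReal := by simpa using ENNReal.toReal_mono hp' hp
  have hm : StronglyMeasurable (fun z : E × E => g (z.1 - z.2)) :=
    hgm.comp_measurable (measurable_fst.sub measurable_snd)
  simp only [eLpNorm_eq_lintegral_rpow_enorm_toReal hp0 hp']
  refine ENNReal.rpow_le_rpow ?_ (by positivity)
  calc ∫⁻ x, ‖mollify k g x‖ₑ ^ p.toReal
      ≤ ∫⁻ x, ∫⁻ t, ‖g (x - t)‖ₑ ^ p.toReal ∂(mollifierMeasure E k) :=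
        lintegral_mono (enorm_mollify_rpow_le k hgm hpr)
    _ = ∫⁻ t, (∫⁻ x, ‖g (x - t)‖ₑ ^ p.toReal) ∂(mollifierMeasure E k) :=
        lintegral_lintegral_swap (hm.enorm.pow_const _).aemeasurable
    _ = ∫⁻ _, (∫⁻ x, ‖g x‖ₑ ^ p.toReal) ∂(mollifierMeasure E k) :=
        lintegral_congr (lintegral_sub_right_eq_self fun x => ‖g x‖ₑ ^ p.toReal)
    _ = ∫⁻ x, ‖g x‖ₑ ^ p.toReal := by rw [lintegral_const, measure_univ, mul_one]

lemma tendsto_eLpNorm_mollify_sub_of_continuous [CompleteSpace F] {g : E → F} (hg : Continuous g)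
    (hgs : HasCompactSupport g) (p : ℝ≥0∞) :
    Tendsto (fun k => eLpNorm (mollify k g - g) p volume) atTop (𝓝 0) := by
  set K := cthickening 1 (tsupport g)
  have hK : IsCompact K := hgs.isCompact.cthickening
  have hsupp : ∀ k, Function.support (mollify k g - g) ⊆ K := fun k =>
    (Function.support_sub _ _).trans (Set.union_subset (support_mollify_subset k)
      ((subset_tsupport g).trans (self_subset_cthickening _)))
  have hbound : ∀ δ : ℝ, 0 < δ → ∀ᶠ k in atTop,
      eLpNorm (mollify k g - g) p volume ≤ volume K ^ p.toReal⁻¹ * ENNReal.ofReal δ := by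
    intro δ hδ
    have huniform := tendstoUniformly_mollify (hgs.uniformContinuous_of_continuous hg)
    filter_upwards [Metric.tendstoUniformly_iff.1 huniform δ hδ] with k hk
    rw [← eLpNorm_restrict_eq_of_support_subset (hsupp k)]
    refine (eLpNorm_le_of_ae_bound (Eventually.of_forall fun x => ?_)).trans_eq
      (by rw [Measure.restrict_apply_univ])
    rw [Pi.sub_apply, ← dist_eq_norm, dist_comm]
    exact (hk x).le
  have hlim : Tendsto (fun δ : ℝ => volume K ^ p.toReal⁻¹ * ENNReal.ofReal δ) (𝓝[>] 0) (𝓝 0) := by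
    have hfin : volume K ^ p.toReal⁻¹ ≠ ⊤ :=
      ENNReal.rpow_ne_top_of_nonneg (by positivity) hK.measure_lt_top.ne
    simpa using (ENNReal.Tendsto.const_mul (ENNReal.tendsto_ofReal tendsto_id)
      (Or.inr hfin)).mono_left (nhdsWithin_le_nhds (a := (0 : ℝ)) (s := Set.Ioi 0))
  rw [ENNReal.tendsto_nhds_zero] at hlim ⊢
  intro ε hε
  obtain ⟨δ, hδε, hδ⟩ := ((hlim ε hε).and self_mem_nhdsWithin).exists
  exact (hbound δ hδ).mono fun k hk => hk.trans hδε

lemma tendsto_eLpNorm_mollify_sub [CompleteSpace F] {g : E → F} {p : ℝ≥0∞} (hp : 1 ≤ p)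
    (hp' : p ≠ ⊤) (hg : MemLp g p volume) :
    Tendsto (fun k => eLpNorm (mollify k g - g) p volume) atTop (𝓝 0) := by
  rw [ENNReal.tendsto_nhds_zero]
  intro ε hε
  have hε3 : ε / 3 ≠ 0 := (ENNReal.div_pos hε.ne' (by norm_num)).ne'
  obtain ⟨h, hhs, hgh, hhc, hhL⟩ := hg.exists_hasCompactSupport_eLpNorm_sub_le hp' hε3
  have hg_loc := hg.locallyIntegrable hp
  have hh_loc := hhL.locallyIntegrable hp
  filter_upwards [ENNReal.tendsto_nhds_zero.1 (tendsto_eLpNorm_mollify_sub_of_continuous hhc hhs p)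
    (ε / 3) (pos_iff_ne_zero.2 hε3)] with k hk
  have hsplit : mollify k g - g = mollify k (g - h) + ((mollify k h - h) + (h - g)) := by
    rw [mollify_sub k hg_loc hh_loc]; abel
  have hm₁ : AEStronglyMeasurable (mollify k (g - h)) volume :=
    (contDiff_mollify k (hg_loc.sub hh_loc)).continuous.aestronglyMeasurable
  have hm₂ : AEStronglyMeasurable (mollify k h - h) volume :=
    ((contDiff_mollify k hh_loc).continuous.sub hhc).aestronglyMeasurable
  have hm₃ : AEStronglyMeasurable (h - g) volume := hhL.1.sub hg.1
  calc eLpNorm (mollify k g - g) p volume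
      ≤ eLpNorm (mollify k (g - h)) p volume +
          (eLpNorm (mollify k h - h) p volume + eLpNorm (h - g) p volume) := by
        rw [hsplit]
        exact (eLpNorm_add_le hm₁ (hm₂.add hm₃) hp).trans
          (add_le_add le_rfl (eLpNorm_add_le hm₂ hm₃ hp))
    _ ≤ ε / 3 + (ε / 3 + ε / 3) := by
        refine add_le_add ((eLpNorm_mollify_le k (hg.1.sub hhL.1) hp hp').trans hgh)
          (add_le_add hk ?_)
        rw [eLpNorm_sub_comm]
        exact hgh
    _ = ε := by rw [← add_assoc]; exact ENNReal.add_thirds ε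

/-- Convergence of `U k` to `V` in `L¹_loc`, tested on the balls centred at the origin. -/
def TendstoL1Loc (U : ℕ → E → F) (V : E → F) : Prop :=
  ∀ r, Tendsto (fun k => ∫⁻ x in ball (0 : E) r, ‖U k x - V x‖ₑ) atTop (𝓝 0)

lemma tendstoL1Loc_mollify [CompleteSpace F] {g : E → F} (hg : LocallyIntegrable g volume) :
    TendstoL1Loc (fun k => mollify k g) g := by
  intro r
  set h : E → F := (closedBall (0 : E) (r + 1)).indicator g
  have hh : Integrable h volume :=
    (hg.integrableOn_isCompact (isCompact_closedBall _ _)).integrable_indicator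
      isClosed_closedBall.measurableSet
  have hgh : ∀ x ∈ ball (0 : E) r, Set.EqOn g h (ball x 1) := fun x hx y hy =>
    (Set.indicator_of_mem (ball_subset_closedBall (ball_subset_ball' (by
      linarith [mem_ball.1 hx]) hy)) _).symm
  refine tendsto_of_tendsto_of_tendsto_of_le_of_le tendsto_const_nhds
    (tendsto_eLpNorm_mollify_sub le_rfl ENNReal.one_ne_top (memLp_one_iff_integrable.2 hh))
    (fun _ => zero_le) fun k => ?_
  calc ∫⁻ x in ball (0 : E) r, ‖mollify k g x - g x‖ₑ
      = ∫⁻ x in ball (0 : E) r, ‖(mollify k h - h) x‖ₑ := by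
        refine setLIntegral_congr_fun measurableSet_ball fun x hx => ?_
        simp only [Pi.sub_apply, mollify_eq_of_eqOn_ball k (hgh x hx),
          hgh x hx (mem_ball_self one_pos)]
    _ ≤ ∫⁻ x, ‖(mollify k h - h) x‖ₑ := setLIntegral_le_lintegral _ _
    _ = eLpNorm (mollify k h - h) 1 volume := eLpNorm_one_eq_lintegral_enorm.symm

end Mollification

section LocalConvergence

variable {E : Type*} [NormedAddCommGroup E] [InnerProductSpace ℝ E] [FiniteDimensional ℝ E]
  [MeasurableSpace E] [BorelSpace E] {F : Type*} [NormedAddCommGroup F]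
  {U U' : ℕ → E → F} {V V' : E → F}

lemma locallyIntegrable_norm (hV : LocallyIntegrable V volume) :
    LocallyIntegrable (fun x => ‖V x‖) volume :=
  hV.mono hV.aestronglyMeasurable.norm (Eventually.of_forall fun _ => (norm_norm _).le)

lemma locallyIntegrable_of_tendsto_ae {b : E → ℝ} (hb : LocallyIntegrable b volume)
    (hU : ∀ k, AEStronglyMeasurable (U k) volume) (hbound : ∀ k, ∀ᵐ x, ‖U k x‖ ≤ b x)
    (hlim : ∀ᵐ x, Tendsto (fun k => U k x) atTop (𝓝 (V x))) : LocallyIntegrable V volume := by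
  refine hb.mono (aestronglyMeasurable_of_tendsto_ae atTop hU hlim) ?_
  filter_upwards [hlim, ae_all_iff.2 hbound] with x hx hbx
  exact (le_of_tendsto hx.norm (Eventually.of_forall hbx)).trans (le_abs_self _)

namespace TendstoL1Loc

lemma add (h : TendstoL1Loc U V) (h' : TendstoL1Loc U' V')
    (hm : ∀ k, AEStronglyMeasurable (fun x => U k x - V x) volume) :
    TendstoL1Loc (fun k x => U k x + U' k x) (fun x => V x + V' x) := by
  intro r
  have hsum := (h r).add (h' r)
  rw [add_zero] at hsum
  refine tendsto_of_tendsto_of_tendsto_of_le_of_le tendsto_const_nhds hsum (fun _ => zero_le)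
    fun k => ?_
  simp only
  rw [← lintegral_add_left' (hm k).enorm.restrict]
  exact lintegral_mono fun x => by rw [add_sub_add_comm]; exact enorm_add_le _ _

lemma of_norm_sub_le {F' : Type*} [NormedAddCommGroup F'] {Us : ℕ → E → F'} {W : E → F'}
    (h : TendstoL1Loc U V) {C : ℝ} (hle : ∀ k x, ‖Us k x - W x‖ ≤ C * ‖U k x - V x‖) :
    TendstoL1Loc Us W := by
  intro r
  have hC := ENNReal.Tendsto.const_mul (h r) (Or.inr (ENNReal.ofReal_ne_top (r := C)))
  rw [mul_zero] at hC
  refine tendsto_of_tendsto_of_tendsto_of_le_of_le tendsto_const_nhds hC (fun _ => zero_le)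
    fun k => ?_
  simp only
  rw [← lintegral_const_mul' _ _ ENNReal.ofReal_ne_top]
  refine lintegral_mono fun x => ?_
  rw [← ofReal_norm, ← ofReal_norm, ← ENNReal.ofReal_mul' (norm_nonneg _)]
  exact ENNReal.ofReal_le_ofReal (hle k x)

lemma of_dominated {b : E → ℝ} (hb : LocallyIntegrable b volume)
    (hU : ∀ k, AEStronglyMeasurable (U k) volume) (hbound : ∀ k, ∀ᵐ x, ‖U k x‖ ≤ b x)
    (hlim : ∀ᵐ x, Tendsto (fun k => U k x) atTop (𝓝 (V x))) : TendstoL1Loc U V := by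
  intro r
  have hbr : IntegrableOn b (ball 0 r) :=
    (hb.integrableOn_isCompact (isCompact_closedBall 0 r)).mono_set ball_subset_closedBall
  simp only [← ofReal_norm]
  exact tendsto_lintegral_norm_of_dominated_convergence (fun k => (hU k).restrict) hbr.2
    (fun k => ae_restrict_of_ae (hbound k)) (ae_restrict_of_ae hlim)

lemma tendsto_integral_smul [NormedSpace ℝ F] (h : TendstoL1Loc U V)
    (hU : ∀ k, LocallyIntegrable (U k) volume) (hV : LocallyIntegrable V volume) {φ : E → ℝ}
    (hφ : Continuous φ) (hs : HasCompactSupport φ) :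
    Tendsto (fun k => ∫ x, φ x • U k x) atTop (𝓝 (∫ x, φ x • V x)) := by
  obtain ⟨C, hC⟩ := hφ.bounded_above_of_compact_support hs
  obtain ⟨r, hr⟩ := hs.isCompact.isBounded.subset_ball (0 : E)
  have hsupp : ∀ k, Function.support (fun x => φ x • U k x - φ x • V x) ⊆ ball 0 r :=
    fun k x hx => hr (subset_tsupport _ fun h0 => hx (by simp only [h0, zero_smul, sub_zero]))
  have hlim : TendstoL1Loc (fun k x => φ x • U k x) (fun x => φ x • V x) :=
    h.of_norm_sub_le fun k x => by
      rw [← smul_sub, norm_smul]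
      exact mul_le_mul_of_nonneg_right (hC x) (norm_nonneg _)
  refine tendsto_integral_of_L1 _ (hφ.aestronglyMeasurable.smul hV.aestronglyMeasurable)
    (Eventually.of_forall fun k => (hU k).integrable_smul_left_of_hasCompactSupport hφ hs) ?_
  refine (hlim r).congr fun k => setLIntegral_eq_of_support_subset fun x hx => hsupp k fun h0 => ?_
  exact hx ((congrArg enorm h0).trans enorm_zero)

end TendstoL1Loc

end LocalConvergence

section TestFunctions

variable {E : Type*} [NormedAddCommGroup E] [NormedSpace ℝ E]
  {F : Type*} [NormedAddCommGroup F] [NormedSpace ℝ F]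

lemma contDiff_fderiv_apply {φ : E → F} (hφ : ContDiff ℝ ∞ φ) (e : E) :
    ContDiff ℝ ∞ fun x => fderiv ℝ φ x e :=
  (hφ.fderiv_right (m := ∞) (by simp)).clm_apply contDiff_const

lemma fderiv_fderiv_apply_comm {φ : E → F} (hφ : ContDiff ℝ ∞ φ) (e e' x : E) :
    fderiv ℝ (fun y => fderiv ℝ φ y e') x e = fderiv ℝ (fun y => fderiv ℝ φ y e) x e' := by
  have hd : DifferentiableAt ℝ (fderiv ℝ φ) x :=
    (hφ.fderiv_right (m := 1) (by norm_cast)).differentiable (by simp) x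
  rw [fderiv_clm_apply hd (differentiableAt_const _),
    fderiv_clm_apply hd (differentiableAt_const _)]
  simp only [fderiv_fun_const, Pi.zero_apply, ContinuousLinearMap.comp_zero, zero_add,
    ContinuousLinearMap.flip_apply]
  exact (hφ.contDiffAt.isSymmSndFDerivAt (by simp; norm_cast)) e e'

end TestFunctions

section WeakDerivative

variable {E : Type*} [NormedAddCommGroup E] [InnerProductSpace ℝ E] [FiniteDimensional ℝ E]
  [MeasurableSpace E] [BorelSpace E]
  {F : Type*} [NormedAddCommGroup F] [NormedSpace ℝ F]
  {F' : Type*} [NormedAddCommGroup F'] [NormedSpace ℝ F']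

/-- `W` is the weak derivative of `U` in the direction `e`; both are locally integrable. -/
structure HasWeakDerivAlong (e : E) (U W : E → F) : Prop where
  locallyIntegrable : LocallyIntegrable U volume
  locallyIntegrable_deriv : LocallyIntegrable W volume
  integral_fderiv_smul : ∀ φ : E → ℝ, ContDiff ℝ ∞ φ → HasCompactSupport φ →
    ∫ x, fderiv ℝ φ x e • U x = -∫ x, φ x • W x

namespace HasWeakDerivAlong

variable {e e' : E} {U U' W W' : E → F}

lemma congr (h : HasWeakDerivAlong e U W) (hU : U =ᵐ[volume] U') (hW : W =ᵐ[volume] W') :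
    HasWeakDerivAlong e U' W' := by
  refine ⟨h.locallyIntegrable.congr hU, h.locallyIntegrable_deriv.congr hW, fun φ hφ hs => ?_⟩
  have hU' : ∫ x, fderiv ℝ φ x e • U x = ∫ x, fderiv ℝ φ x e • U' x :=
    integral_congr_ae (hU.mono fun x hx => by simp only [hx])
  have hW' : ∫ x, φ x • W x = ∫ x, φ x • W' x :=
    integral_congr_ae (hW.mono fun x hx => by simp only [hx])
  rw [← hU', ← hW']
  exact h.integral_fderiv_smul φ hφ hs

lemma integrable_fderiv_smul (h : HasWeakDerivAlong e U W) {φ : E → ℝ} (hφ : ContDiff ℝ ∞ φ)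
    (hs : HasCompactSupport φ) (e' : E) : Integrable (fun x => fderiv ℝ φ x e' • U x) :=
  h.locallyIntegrable.integrable_smul_left_of_hasCompactSupport
    (contDiff_fderiv_apply hφ e').continuous (hs.fderiv_apply (𝕜 := ℝ) e')

lemma integrable_smul_deriv (h : HasWeakDerivAlong e U W) {φ : E → ℝ} (hφ : Continuous φ)
    (hs : HasCompactSupport φ) : Integrable (fun x => φ x • W x) :=
  h.locallyIntegrable_deriv.integrable_smul_left_of_hasCompactSupport hφ hs

lemma add (h : HasWeakDerivAlong e U W) (h' : HasWeakDerivAlong e U' W') :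
    HasWeakDerivAlong e (fun x => U x + U' x) (fun x => W x + W' x) := by
  refine ⟨h.locallyIntegrable.add h'.locallyIntegrable,
    h.locallyIntegrable_deriv.add h'.locallyIntegrable_deriv, fun φ hφ hs => ?_⟩
  simp only [smul_add]
  rw [integral_add (h.integrable_fderiv_smul hφ hs e) (h'.integrable_fderiv_smul hφ hs e),
    integral_add (h.integrable_smul_deriv hφ.continuous hs)
      (h'.integrable_smul_deriv hφ.continuous hs),
    h.integral_fderiv_smul φ hφ hs, h'.integral_fderiv_smul φ hφ hs, neg_add]

lemma clm [CompleteSpace F] [CompleteSpace F'] (h : HasWeakDerivAlong e U W) (L : F →L[ℝ] F') :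
    HasWeakDerivAlong e (fun x => L (U x)) (fun x => L (W x)) := by
  have comp {V : E → F} (hV : LocallyIntegrable V volume) :
      LocallyIntegrable (fun x => L (V x)) volume := fun x =>
    (hV x).imp fun _ hs => ⟨hs.1, L.integrable_comp hs.2⟩
  refine ⟨comp h.locallyIntegrable, comp h.locallyIntegrable_deriv, fun φ hφ hs => ?_⟩
  have hU := L.integral_comp_comm (h.integrable_fderiv_smul hφ hs e)
  have hW := L.integral_comp_comm (h.integrable_smul_deriv hφ.continuous hs)
  simp only [map_smul] at hU hW
  rw [hU, hW, h.integral_fderiv_smul φ hφ hs, map_neg]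

lemma neg [CompleteSpace F] (h : HasWeakDerivAlong e U W) :
    HasWeakDerivAlong e (fun x => -U x) (fun x => -W x) := by
  simpa using h.clm (-ContinuousLinearMap.id ℝ F)

lemma sub [CompleteSpace F] (h : HasWeakDerivAlong e U W) (h' : HasWeakDerivAlong e U' W') :
    HasWeakDerivAlong e (fun x => U x - U' x) (fun x => W x - W' x) := by
  simpa [sub_eq_add_neg] using h.add h'.neg

lemma zero : HasWeakDerivAlong e (fun _ : E => (0 : F)) (fun _ => 0) :=
  ⟨locallyIntegrable_zero, locallyIntegrable_zero, fun φ _ _ => by simp⟩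

lemma sum {ι : Type*} (s : Finset ι) {U W : ι → E → F}
    (h : ∀ i ∈ s, HasWeakDerivAlong e (U i) (W i)) :
    HasWeakDerivAlong e (fun x => ∑ i ∈ s, U i x) (fun x => ∑ i ∈ s, W i x) := by
  classical
  induction s using Finset.induction_on with
  | empty => simpa using zero
  | insert a s ha ih =>
    simp only [Finset.sum_insert ha]
    exact (h a (Finset.mem_insert_self a s)).add
      (ih fun i hi => h i (Finset.mem_insert_of_mem hi))

lemma prodMk [CompleteSpace F] [CompleteSpace F'] {V Z : E → F'} (h : HasWeakDerivAlong e U W)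
    (h' : HasWeakDerivAlong e V Z) :
    HasWeakDerivAlong e (fun x => (U x, V x)) (fun x => (W x, Z x)) := by
  simpa using (h.clm (ContinuousLinearMap.inl ℝ F F')).add
    (h'.clm (ContinuousLinearMap.inr ℝ F F'))

lemma smooth_smul (h : HasWeakDerivAlong e U W) {η : E → ℝ} (hη : ContDiff ℝ ∞ η) :
    HasWeakDerivAlong e (fun x => η x • U x) (fun x => fderiv ℝ η x e • U x + η x • W x) := by
  have hηU := h.locallyIntegrable.continuous_smul hη.continuous
  have hη'U := h.locallyIntegrable.continuous_smul (contDiff_fderiv_apply hη e).continuous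
  have hηW := h.locallyIntegrable_deriv.continuous_smul hη.continuous
  refine ⟨hηU, hη'U.add hηW, fun φ hφ hs => ?_⟩
  have hproduct : ∀ x, fderiv ℝ (fun x => φ x * η x) x e • U x =
      fderiv ℝ φ x e • η x • U x + φ x • fderiv ℝ η x e • U x := by
    intro x
    rw [fderiv_fun_mul (hφ.differentiable (by simp) x) (hη.differentiable (by simp) x)]
    simp only [add_apply, smul_apply, smul_eq_mul, add_smul, smul_smul]
    rw [add_comm, mul_comm (η x)]
  have hη'Uφ := hη'U.integrable_smul_left_of_hasCompactSupport hφ.continuous hs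
  have htest := h.integral_fderiv_smul (fun x => φ x * η x) (hφ.mul hη) hs.mul_right
  simp only [hproduct, mul_smul] at htest
  rw [integral_add (hηU.integrable_smul_left_of_hasCompactSupport
    (contDiff_fderiv_apply hφ e).continuous (hs.fderiv_apply (𝕜 := ℝ) e)) hη'Uφ] at htest
  simp only [smul_add]
  rw [integral_add hη'Uφ (hηW.integrable_smul_left_of_hasCompactSupport hφ.continuous hs),
    eq_sub_of_add_eq htest]
  abel

lemma ae_eq [CompleteSpace F] (h : HasWeakDerivAlong e U W) (h' : HasWeakDerivAlong e U W') :
    W =ᵐ[volume] W' :=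
  ae_eq_of_integral_contDiff_smul_eq h.locallyIntegrable_deriv h'.locallyIntegrable_deriv
    fun φ hφ hs => neg_injective <|
      (h.integral_fderiv_smul φ hφ hs).symm.trans (h'.integral_fderiv_smul φ hφ hs)

lemma comm [CompleteSpace F] {W₁ W₂ W₁₂ W₂₁ : E → F} (h₁ : HasWeakDerivAlong e U W₁)
    (h₂ : HasWeakDerivAlong e' U W₂) (h₁₂ : HasWeakDerivAlong e' W₁ W₁₂)
    (h₂₁ : HasWeakDerivAlong e W₂ W₂₁) : W₁₂ =ᵐ[volume] W₂₁ := by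
  refine ae_eq_of_integral_contDiff_smul_eq h₁₂.locallyIntegrable_deriv
    h₂₁.locallyIntegrable_deriv fun φ hφ hs => ?_
  have h_e := h₁.integral_fderiv_smul _ (contDiff_fderiv_apply hφ e')
    (hs.fderiv_apply (𝕜 := ℝ) e')
  have h_e' := h₂.integral_fderiv_smul _ (contDiff_fderiv_apply hφ e)
    (hs.fderiv_apply (𝕜 := ℝ) e)
  simp only [fderiv_fderiv_apply_comm hφ e e'] at h_e
  rw [h_e, neg_inj] at h_e'
  rw [← neg_inj, ← h₁₂.integral_fderiv_smul φ hφ hs, ← h₂₁.integral_fderiv_smul φ hφ hs, h_e']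

lemma of_tendstoL1Loc {Us Ws : ℕ → E → F} (h : ∀ k, HasWeakDerivAlong e (Us k) (Ws k))
    (hU : LocallyIntegrable U volume) (hW : LocallyIntegrable W volume)
    (hUs : TendstoL1Loc Us U) (hWs : TendstoL1Loc Ws W) : HasWeakDerivAlong e U W := by
  refine ⟨hU, hW, fun φ hφ hs => ?_⟩
  have hleft := hUs.tendsto_integral_smul (fun k => (h k).locallyIntegrable) hU
    (contDiff_fderiv_apply hφ e).continuous (hs.fderiv_apply (𝕜 := ℝ) e)
  have hright := hWs.tendsto_integral_smul (fun k => (h k).locallyIntegrable_deriv) hW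
    hφ.continuous hs
  exact tendsto_nhds_unique hleft
    (hright.neg.congr fun k => ((h k).integral_fderiv_smul φ hφ hs).symm)

lemma of_tendsto_ae {Us Ws : ℕ → E → F} {b c : E → ℝ}
    (h : ∀ k, HasWeakDerivAlong e (Us k) (Ws k))
    (hb : LocallyIntegrable b volume) (hc : LocallyIntegrable c volume)
    (hUb : ∀ k, ∀ᵐ x, ‖Us k x‖ ≤ b x) (hWc : ∀ k, ∀ᵐ x, ‖Ws k x‖ ≤ c x)
    (hU : ∀ᵐ x, Tendsto (fun k => Us k x) atTop (𝓝 (U x)))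
    (hW : ∀ᵐ x, Tendsto (fun k => Ws k x) atTop (𝓝 (W x))) :
    HasWeakDerivAlong e U W := by
  have hUm := fun k => (h k).locallyIntegrable.aestronglyMeasurable
  have hWm := fun k => (h k).locallyIntegrable_deriv.aestronglyMeasurable
  exact of_tendstoL1Loc h (locallyIntegrable_of_tendsto_ae hb hUm hUb hU)
    (locallyIntegrable_of_tendsto_ae hc hWm hWc hW) (.of_dominated hb hUm hUb hU)
    (.of_dominated hc hWm hWc hW)

lemma of_contDiff {V : E → F} (hV : ContDiff ℝ 1 V) (e : E) :
    HasWeakDerivAlong e V fun x => fderiv ℝ V x e := by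
  have hV' : LocallyIntegrable (fun x => fderiv ℝ V x e) volume :=
    ((hV.continuous_fderiv (by simp)).clm_apply continuous_const).locallyIntegrable
  have hVloc : LocallyIntegrable V volume := hV.continuous.locallyIntegrable
  refine ⟨hVloc, hV', fun φ hφ hs => neg_eq_iff_eq_neg.1 (Eq.symm ?_)⟩
  exact integral_smul_fderiv_eq_neg_fderiv_smul_of_integrable
    (hVloc.integrable_smul_left_of_hasCompactSupport (contDiff_fderiv_apply hφ e).continuous
      (hs.fderiv_apply (𝕜 := ℝ) e))
    (hV'.integrable_smul_left_of_hasCompactSupport hφ.continuous hs)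
    (hVloc.integrable_smul_left_of_hasCompactSupport hφ.continuous hs)
    (fun x _ => hφ.differentiable (by simp) x) (fun x _ => hV.differentiable (by simp) x)

lemma fderiv_mollify [CompleteSpace F] (h : HasWeakDerivAlong e U W) (k : ℕ) (x : E) :
    fderiv ℝ (mollify k U) x e = mollify k W x := by
  set ρ := (mollifierBump E k).normed volume
  have hρ : ContDiff ℝ ∞ ρ := (mollifierBump E k).contDiff_normed
  have hρs : HasCompactSupport ρ := (mollifierBump E k).hasCompactSupport_normed
  have hconv : fderiv ℝ (mollify k U) x = _ :=
    (hρs.hasFDerivAt_convolution_left (lsmul ℝ ℝ) (hρ.of_le (by simp)) h.locallyIntegrable x).fderiv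
  have hintegrable : Integrable (fun t => (precompL E (lsmul ℝ ℝ : ℝ →L[ℝ] F →L[ℝ] F))
      (fderiv ℝ ρ (x - t)) (U t)) volume :=
    ((hρs.fderiv (𝕜 := ℝ)).convolutionExists_left
      (precompL E (lsmul ℝ ℝ : ℝ →L[ℝ] F →L[ℝ] F)) (hρ.continuous_fderiv (by simp))
      h.locallyIntegrable x).integrable_swap
  have hreflect : ∀ t, fderiv ℝ (fun t => ρ (x - t)) t e = -fderiv ℝ ρ (x - t) e := by
    intro t
    have : HasFDerivAt (fun t => ρ (x - t))
        ((fderiv ℝ ρ (x - t)).comp (-ContinuousLinearMap.id ℝ E)) t :=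
      ((hρ.differentiable (by simp)) (x - t)).hasFDerivAt.comp t ((hasFDerivAt_id t).const_sub x)
    rw [this.fderiv]
    simp
  have htest := h.integral_fderiv_smul _ (hρ.comp (contDiff_const.sub contDiff_id))
    (hρs.comp_homeomorph (Homeomorph.subLeft x))
  simp only [Function.comp_def, id, hreflect, neg_smul, integral_neg,
    neg_inj] at htest
  rw [hconv, convolution_eq_swap, ContinuousLinearMap.integral_apply hintegrable,
    mollify_apply_swap, ← htest]
  rfl

end HasWeakDerivAlong

section ChainRule

variable {e : E} {U W : E → F} {Φ : F → F'} {C : ℝ}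

lemma norm_sub_le_of_norm_fderiv_le (hΦ : ContDiff ℝ 1 Φ) (hC : ∀ y, ‖fderiv ℝ Φ y‖ ≤ C)
    (y z : F) : ‖Φ y - Φ z‖ ≤ C * ‖y - z‖ :=
  convex_univ.norm_image_sub_le_of_norm_fderiv_le (fun y _ => hΦ.differentiable (by simp) y)
    (fun y _ => hC y) trivial trivial

lemma locallyIntegrable_comp_of_norm_fderiv_le (hU : LocallyIntegrable U volume)
    (hΦ : ContDiff ℝ 1 Φ) (hC : ∀ y, ‖fderiv ℝ Φ y‖ ≤ C) :
    LocallyIntegrable (fun x => Φ (U x)) volume := by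
  have hC0 : 0 ≤ C := (norm_nonneg _).trans (hC 0)
  have hbound : LocallyIntegrable (fun x => C * ‖U x‖ + ‖Φ 0‖) volume :=
    ((locallyIntegrable_norm hU).smul C).add (locallyIntegrable_const _)
  refine hbound.mono (hΦ.continuous.comp_aestronglyMeasurable hU.aestronglyMeasurable)
    (Eventually.of_forall fun x => ?_)
  rw [Real.norm_of_nonneg (by positivity)]
  have hlip := norm_sub_le_of_norm_fderiv_le hΦ hC (U x) 0
  rw [sub_zero] at hlip
  linarith [norm_le_norm_sub_add (Φ (U x)) (Φ 0)]

lemma aestronglyMeasurable_fderiv_comp_apply (hΦ : ContDiff ℝ 1 Φ)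
    (hU : AEStronglyMeasurable U volume) (hW : AEStronglyMeasurable W volume) :
    AEStronglyMeasurable (fun x => fderiv ℝ Φ (U x) (W x)) volume :=
  isBoundedBilinearMap_apply.continuous.comp_aestronglyMeasurable
    (((hΦ.continuous_fderiv (by simp)).comp_aestronglyMeasurable hU).prodMk hW)

lemma locallyIntegrable_fderiv_comp_apply (hU : AEStronglyMeasurable U volume)
    (hW : LocallyIntegrable W volume) (hΦ : ContDiff ℝ 1 Φ) (hC : ∀ y, ‖fderiv ℝ Φ y‖ ≤ C) :
    LocallyIntegrable (fun x => fderiv ℝ Φ (U x) (W x)) volume := by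
  have hC0 : 0 ≤ C := (norm_nonneg _).trans (hC 0)
  refine ((locallyIntegrable_norm hW).smul C).mono
    (aestronglyMeasurable_fderiv_comp_apply hΦ hU hW.aestronglyMeasurable)
    (Eventually.of_forall fun x => ?_)
  simp only [Pi.smul_apply, smul_eq_mul]
  rw [Real.norm_of_nonneg (by positivity)]
  exact le_of_opNorm_le _ (hC _) _

lemma tendstoL1Loc_fderiv_comp_mollify [CompleteSpace F] (hU : LocallyIntegrable U volume)
    (hW : LocallyIntegrable W volume) (hΦ : ContDiff ℝ 1 Φ) (hC : ∀ y, ‖fderiv ℝ Φ y‖ ≤ C) :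
    TendstoL1Loc (fun k x => fderiv ℝ Φ (mollify k U x) (mollify k W x))
      (fun x => fderiv ℝ Φ (U x) (W x)) := by
  have hUm := fun k => (contDiff_mollify k hU).continuous.aestronglyMeasurable (μ := volume)
  have hWm := fun k => (contDiff_mollify k hW).continuous.aestronglyMeasurable (μ := volume)
  have hmoving : TendstoL1Loc (fun k x => fderiv ℝ Φ (mollify k U x) (mollify k W x - W x))
      (fun _ => 0) :=
    (tendstoL1Loc_mollify hW).of_norm_sub_le fun k x => by
      rw [sub_zero]
      exact le_of_opNorm_le _ (hC _) _
  have hfrozen : TendstoL1Loc (fun k x => fderiv ℝ Φ (mollify k U x) (W x))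
      (fun x => fderiv ℝ Φ (U x) (W x)) := by
    refine .of_dominated ((locallyIntegrable_norm hW).smul C)
      (fun k => aestronglyMeasurable_fderiv_comp_apply hΦ (hUm k) hW.aestronglyMeasurable)
      (fun k => Eventually.of_forall fun x => le_of_opNorm_le _ (hC _) _) ?_
    filter_upwards [ae_tendsto_mollify hU] with x hx
    exact (((hΦ.continuous_fderiv (by simp)).clm_apply continuous_const).tendsto (U x)).comp hx
  have hsum := hmoving.add hfrozen fun k => by
    simpa using aestronglyMeasurable_fderiv_comp_apply hΦ (hUm k)
      ((hWm k).sub hW.aestronglyMeasurable)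
  simpa only [← map_add, sub_add_cancel, zero_add] using hsum

lemma HasWeakDerivAlong.comp_of_norm_fderiv_le [CompleteSpace F]
    (h : HasWeakDerivAlong e U W) (hΦ : ContDiff ℝ 1 Φ) (hC : ∀ y, ‖fderiv ℝ Φ y‖ ≤ C) :
    HasWeakDerivAlong e (fun x => Φ (U x)) (fun x => fderiv ℝ Φ (U x) (W x)) := by
  have hU := h.locallyIntegrable
  have hW := h.locallyIntegrable_deriv
  have hsmooth : ∀ k, HasWeakDerivAlong e (fun x => Φ (mollify k U x))
      (fun x => fderiv ℝ Φ (mollify k U x) (mollify k W x)) := fun k => by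
    have hUk := contDiff_mollify k hU
    refine (of_contDiff (hΦ.comp (hUk.of_le (by simp))) e).congr EventuallyEq.rfl
      (Eventually.of_forall fun x => ?_)
    simp only [fderiv_comp x (hΦ.differentiable (by simp) (mollify k U x))
      (hUk.differentiable (by simp) x), ContinuousLinearMap.comp_apply, h.fderiv_mollify]
  exact of_tendstoL1Loc hsmooth (locallyIntegrable_comp_of_norm_fderiv_le hU hΦ hC)
    (locallyIntegrable_fderiv_comp_apply hU.aestronglyMeasurable hW hΦ hC)
    ((tendstoL1Loc_mollify hU).of_norm_sub_le fun k x =>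
      norm_sub_le_of_norm_fderiv_le hΦ hC _ _)
    (tendstoL1Loc_fderiv_comp_mollify hU hW hΦ hC)

end ChainRule

lemma ae_const_of_hasWeakDerivAlong_zero [CompleteSpace F] {U : E → F}
    (h : ∀ e, HasWeakDerivAlong e U fun _ => 0) : ∃ b : F, U =ᵐ[volume] fun _ => b := by
  have hU := (h 0).locallyIntegrable
  have hconst : ∀ k x, mollify k U x = mollify k U 0 := by
    intro k x
    refine is_const_of_fderiv_eq_zero (𝕜 := ℝ) ((contDiff_mollify k hU).differentiable (by simp))
      (fun y => ?_) x 0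
    ext e
    rw [(h e).fderiv_mollify, mollify_apply]
    simp
  obtain ⟨x₀, hx₀⟩ := (ae_tendsto_mollify hU).exists
  refine ⟨U x₀, ?_⟩
  filter_upwards [ae_tendsto_mollify hU] with x hx
  refine tendsto_nhds_unique hx (hx₀.congr fun k => ?_)
  rw [hconst k x, hconst k x₀]

end WeakDerivative

section MeanCurvatureMap

variable {V : Type*} [NormedAddCommGroup V]

/-- The factor `1 / √(1 + |p|²)`. -/
noncomputable def mcFactor (p : V) : ℝ := (√(1 + ‖p‖ ^ 2))⁻¹

lemma mcFactor_pos (p : V) : 0 < mcFactor p := by unfold mcFactor; positivity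

lemma mcFactor_zero : mcFactor (0 : V) = 1 := by simp [mcFactor]

lemma mcFactor_sq (p : V) : mcFactor p ^ 2 * (1 + ‖p‖ ^ 2) = 1 := by
  unfold mcFactor
  rw [inv_pow, Real.sq_sqrt (by positivity)]
  exact inv_mul_cancel₀ (by positivity)

lemma mcFactor_le_one (p : V) : mcFactor p ≤ 1 := by
  nlinarith [mcFactor_sq p, mcFactor_pos p, mul_nonneg (sq_nonneg (mcFactor p)) (sq_nonneg ‖p‖)]

lemma mcFactor_sq_le_one (p : V) : mcFactor p ^ 2 ≤ 1 :=
  pow_le_one₀ (mcFactor_pos p).le (mcFactor_le_one p)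

lemma mcFactor_mul_norm_le_one (p : V) : mcFactor p * ‖p‖ ≤ 1 := by
  have h0 : 0 ≤ mcFactor p * ‖p‖ := mul_nonneg (mcFactor_pos p).le (norm_nonneg p)
  nlinarith [mcFactor_sq p, sq_nonneg (mcFactor p)]

/-- The Pohozaev density `|p|² / √(1 + |p|²)`. -/
noncomputable def pohozaev (p : V) : ℝ := mcFactor p * ‖p‖ ^ 2

/-- The factor `1 / s + 1 / s³` with `s = √(1 + |p|²)`, for which `fluxFactor p • p` is the
gradient of `pohozaev` at `p`. -/
noncomputable def fluxFactor (p : V) : ℝ := mcFactor p + mcFactor p ^ 3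

variable [InnerProductSpace ℝ V]

lemma mcFactor_mul_abs_inner_le (p q : V) : mcFactor p * |⟪p, q⟫_ℝ| ≤ ‖q‖ :=
  calc mcFactor p * |⟪p, q⟫_ℝ| ≤ mcFactor p * (‖p‖ * ‖q‖) :=
        mul_le_mul_of_nonneg_left (abs_real_inner_le_norm p q) (mcFactor_pos p).le
    _ = mcFactor p * ‖p‖ * ‖q‖ := (mul_assoc _ _ _).symm
    _ ≤ ‖q‖ := mul_le_of_le_one_left (norm_nonneg q) (mcFactor_mul_norm_le_one p)

/-- The mean curvature flux `p / √(1 + |p|²)`. -/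
noncomputable def mcMap (p : V) : V := mcFactor p • p

/-- The derivative of the mean curvature flux. -/
noncomputable def mcDeriv (p : V) : V →L[ℝ] V :=
  mcFactor p • ContinuousLinearMap.id ℝ V - mcFactor p ^ 3 • (innerSL ℝ p).smulRight p

lemma mcDeriv_apply (p q : V) :
    mcDeriv p q = mcFactor p • q - (mcFactor p ^ 3 * ⟪p, q⟫_ℝ) • p := by
  simp [mcDeriv, smul_smul]

lemma mcDeriv_zero : mcDeriv (0 : V) = ContinuousLinearMap.id ℝ V := by
  ext q
  simp [mcDeriv_apply, mcFactor_zero]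

lemma contDiff_mcFactor : ContDiff ℝ ∞ (mcFactor : V → ℝ) := by
  unfold mcFactor
  refine ContDiff.inv (ContDiff.sqrt (contDiff_const.add (contDiff_norm_sq ℝ)) fun p => ?_)
    fun p => ?_ <;> positivity

lemma contDiff_mcMap : ContDiff ℝ ∞ (mcMap : V → V) := contDiff_mcFactor.smul contDiff_id

lemma contDiff_mcDeriv : ContDiff ℝ ∞ (mcDeriv : V → V →L[ℝ] V) := by
  unfold mcDeriv
  refine (contDiff_mcFactor.smul contDiff_const).sub ((contDiff_mcFactor.pow 3).smul ?_)
  exact ((innerSL ℝ).contDiff).smulRight contDiff_id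

lemma aestronglyMeasurable_mcDeriv_apply {α : Type*} [MeasurableSpace α] {μ : Measure α}
    {P Q : α → V} (hP : AEStronglyMeasurable P μ) (hQ : AEStronglyMeasurable Q μ) :
    AEStronglyMeasurable (fun x => mcDeriv (P x) (Q x)) μ :=
  isBoundedBilinearMap_apply.continuous.comp_aestronglyMeasurable
    ((contDiff_mcDeriv.continuous.comp_aestronglyMeasurable hP).prodMk hQ)

lemma hasFDerivAt_mcFactor (p : V) :
    HasFDerivAt (mcFactor : V → ℝ) (-(mcFactor p ^ 3) • innerSL ℝ p) p := by
  have hpos : (0 : ℝ) < 1 + ‖p‖ ^ 2 := by positivity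
  have hsq : HasFDerivAt (fun p : V => 1 + ‖p‖ ^ 2) (2 • innerSL ℝ p) p :=
    (hasStrictFDerivAt_norm_sq p).hasFDerivAt.const_add 1
  have hinv := (hasDerivAt_inv (by positivity : √(1 + ‖p‖ ^ 2) ≠ 0)).comp_hasFDerivAt p
    (hsq.sqrt hpos.ne')
  refine hinv.congr_fderiv (ContinuousLinearMap.ext fun q => ?_)
  simp only [mcFactor, smul_apply, innerSL_apply_apply, smul_eq_mul, nsmul_eq_mul, Nat.cast_ofNat]
  have hs : √(1 + ‖p‖ ^ 2) ≠ 0 := by positivity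
  field_simp

lemma hasFDerivAt_mcMap (p : V) : HasFDerivAt (mcMap : V → V) (mcDeriv p) p := by
  have h := (hasFDerivAt_mcFactor p).smul (hasFDerivAt_id p)
  refine h.congr_fderiv ?_
  ext q
  simp [mcDeriv_apply, sub_eq_add_neg]

lemma fderiv_mcMap (p : V) : fderiv ℝ (mcMap : V → V) p = mcDeriv p := (hasFDerivAt_mcMap p).fderiv

lemma norm_mcMap_le_one (p : V) : ‖mcMap p‖ ≤ 1 := by
  rw [mcMap, norm_smul, Real.norm_of_nonneg (mcFactor_pos p).le]
  exact mcFactor_mul_norm_le_one p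

lemma norm_mcDeriv_apply_le (p q : V) : ‖mcDeriv p q‖ ≤ 2 * ‖q‖ := by
  have hpos := mcFactor_pos p
  have hidentity : ‖mcFactor p • q‖ ≤ ‖q‖ := by
    rw [norm_smul, Real.norm_of_nonneg hpos.le]
    exact mul_le_of_le_one_left (norm_nonneg q) (mcFactor_le_one p)
  have hrankOne : ‖(mcFactor p ^ 3 * ⟪p, q⟫_ℝ) • p‖ ≤ ‖q‖ := by
    rw [norm_smul, norm_mul, Real.norm_of_nonneg (by positivity), Real.norm_eq_abs]
    calc mcFactor p ^ 3 * |⟪p, q⟫_ℝ| * ‖p‖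
        = mcFactor p * (mcFactor p * |⟪p, q⟫_ℝ|) * (mcFactor p * ‖p‖) := by ring
      _ ≤ 1 * ‖q‖ * 1 := by
        gcongr
        exacts [mcFactor_le_one p, mcFactor_mul_abs_inner_le p q, mcFactor_mul_norm_le_one p]
      _ = ‖q‖ := by ring
  rw [mcDeriv_apply, two_mul]
  exact (norm_sub_le _ _).trans (add_le_add hidentity hrankOne)

lemma norm_mcDeriv_le (p : V) : ‖mcDeriv p‖ ≤ 2 :=
  opNorm_le_bound _ (by norm_num) (norm_mcDeriv_apply_le p)

lemma mcDeriv_self (p : V) : mcDeriv p p = mcFactor p ^ 3 • p := by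
  rw [mcDeriv_apply, ← sub_smul, real_inner_self_eq_norm_sq]
  congr 1
  linear_combination (- mcFactor p) * mcFactor_sq p

lemma inner_mcDeriv_apply (p q r : V) :
    ⟪mcDeriv p q, r⟫_ℝ = mcFactor p * ⟪q, r⟫_ℝ - mcFactor p ^ 3 * (⟪p, q⟫_ℝ * ⟪p, r⟫_ℝ) := by
  rw [mcDeriv_apply, inner_sub_left, real_inner_smul_left, real_inner_smul_left]
  ring

lemma inner_mcDeriv_comm (p q r : V) : ⟪mcDeriv p q, r⟫_ℝ = ⟪q, mcDeriv p r⟫_ℝ := by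
  rw [real_inner_comm (mcDeriv p r) q, inner_mcDeriv_apply, inner_mcDeriv_apply,
    real_inner_comm r q]
  ring

lemma inner_mcDeriv_self (p q : V) :
    ⟪mcDeriv p q, q⟫_ℝ = mcFactor p * ‖q‖ ^ 2 - mcFactor p ^ 3 * ⟪p, q⟫_ℝ ^ 2 := by
  rw [inner_mcDeriv_apply, real_inner_self_eq_norm_sq]
  ring

lemma inner_mcDeriv_self_nonneg (p q : V) : 0 ≤ ⟪mcDeriv p q, q⟫_ℝ := by
  have hpos := mcFactor_pos p
  have hle : (mcFactor p * ⟪p, q⟫_ℝ) ^ 2 ≤ ‖q‖ ^ 2 := by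
    rw [sq_le_sq, abs_mul, abs_of_pos hpos, abs_of_nonneg (norm_nonneg q)]
    exact mcFactor_mul_abs_inner_le p q
  calc 0 ≤ mcFactor p * (‖q‖ ^ 2 - (mcFactor p * ⟪p, q⟫_ℝ) ^ 2) :=
        mul_nonneg hpos.le (sub_nonneg.2 hle)
    _ = ⟪mcDeriv p q, q⟫_ℝ := by rw [inner_mcDeriv_self]; ring

lemma inner_mcDeriv_self_le (p q : V) : ⟪mcDeriv p q, q⟫_ℝ ≤ mcFactor p * ‖q‖ ^ 2 := by
  rw [inner_mcDeriv_self]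
  have : 0 ≤ mcFactor p ^ 3 * ⟪p, q⟫_ℝ ^ 2 :=
    mul_nonneg (pow_nonneg (mcFactor_pos p).le 3) (sq_nonneg _)
  linarith

lemma inner_mcDeriv_self_le_sq (p q : V) : ⟪mcDeriv p q, q⟫_ℝ ≤ ‖q‖ ^ 2 :=
  (inner_mcDeriv_self_le p q).trans
    (mul_le_of_le_one_left (sq_nonneg _) (mcFactor_le_one p))

lemma two_mul_abs_inner_mcDeriv_le (p q r : V) :
    2 * |⟪mcDeriv p q, r⟫_ℝ| ≤ ⟪mcDeriv p q, q⟫_ℝ + ⟪mcDeriv p r, r⟫_ℝ := by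
  have hadd := inner_mcDeriv_self_nonneg p (q + r)
  have hsub := inner_mcDeriv_self_nonneg p (q - r)
  have hsymm : ⟪mcDeriv p r, q⟫_ℝ = ⟪mcDeriv p q, r⟫_ℝ := by
    rw [inner_mcDeriv_comm, real_inner_comm]
  simp only [map_add, map_sub, inner_add_left, inner_add_right, inner_sub_left, inner_sub_right,
    hsymm] at hadd hsub
  cases abs_cases ⟪mcDeriv p q, r⟫_ℝ <;> linarith

lemma inner_mcDeriv_add_le (p q r : V) :
    ⟪mcDeriv p (q + r), q + r⟫_ℝ ≤ 2 * (⟪mcDeriv p q, q⟫_ℝ + ⟪mcDeriv p r, r⟫_ℝ) := by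
  have hsymm : ⟪mcDeriv p r, q⟫_ℝ = ⟪mcDeriv p q, r⟫_ℝ := by
    rw [inner_mcDeriv_comm, real_inner_comm]
  simp only [map_add, inner_add_left, inner_add_right, hsymm]
  linarith [le_abs_self ⟪mcDeriv p q, r⟫_ℝ, two_mul_abs_inner_mcDeriv_le p q r]

lemma fderiv_mcDeriv_apply (p e q : V) :
    fderiv ℝ (mcDeriv : V → V →L[ℝ] V) p e q =
      mcFactor p ^ 2 • ((3 * (mcFactor p * ⟪p, e⟫_ℝ) * (mcFactor p * ⟪p, q⟫_ℝ)) • mcMap p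
        - (mcFactor p * ⟪p, e⟫_ℝ) • q - (mcFactor p * ⟪p, q⟫_ℝ) • e - ⟪q, e⟫_ℝ • mcMap p) := by
  have hswap : fderiv ℝ (mcDeriv : V → V →L[ℝ] V) p e q =
      fderiv ℝ (fun p : V => mcDeriv p q) p e := by
    rw [fderiv_clm_apply (contDiff_mcDeriv.differentiable (by simp) p)
      (differentiableAt_const _)]
    simp
  have hexpand : (fun p : V => mcDeriv p q) = (fun y => mcFactor y • q) -
      ((fun x => mcFactor x ^ 3) * (innerSL ℝ q : V → ℝ)) • (_root_.id : V → V) := by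
    funext y
    simp [mcDeriv_apply, real_inner_comm]
  rw [hswap, hexpand, (((hasFDerivAt_mcFactor p).smul_const q).sub
    ((((hasFDerivAt_mcFactor p).pow 3).mul
      ((innerSL ℝ q).hasFDerivAt (x := p))).smul (hasFDerivAt_id p))).fderiv]
  simp only [sub_apply, smulRight_apply, smul_apply, add_apply, innerSL_apply_apply, Pi.mul_apply,
    smul_eq_mul, nsmul_eq_mul, _root_.id, ContinuousLinearMap.id_apply, real_inner_comm p q, mcMap]
  module

lemma norm_fderiv_mcDeriv_apply_le (p e q : V) :
    ‖fderiv ℝ (mcDeriv : V → V →L[ℝ] V) p e q‖ ≤ 6 * mcFactor p ^ 2 * (‖e‖ * ‖q‖) := by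
  have hpos := mcFactor_pos p
  have hinner (z : V) : ‖mcFactor p * ⟪p, z⟫_ℝ‖ ≤ ‖z‖ := by
    rw [norm_mul, Real.norm_of_nonneg hpos.le]
    exact mcFactor_mul_abs_inner_le p z
  have hmap := norm_mcMap_le_one p
  have hcubic : ‖(3 * (mcFactor p * ⟪p, e⟫_ℝ) * (mcFactor p * ⟪p, q⟫_ℝ)) • mcMap p‖ ≤
      3 * ‖e‖ * ‖q‖ * 1 := by
    rw [norm_smul, norm_mul, norm_mul, Real.norm_of_nonneg (by norm_num : (0 : ℝ) ≤ 3)]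
    gcongr <;> apply hinner
  have hq : ‖(mcFactor p * ⟪p, e⟫_ℝ) • q‖ ≤ ‖e‖ * ‖q‖ := by
    rw [norm_smul]
    gcongr
    exact hinner e
  have he : ‖(mcFactor p * ⟪p, q⟫_ℝ) • e‖ ≤ ‖q‖ * ‖e‖ := by
    rw [norm_smul]
    gcongr
    exact hinner q
  have hp : ‖⟪q, e⟫_ℝ • mcMap p‖ ≤ ‖q‖ * ‖e‖ * 1 := by
    rw [norm_smul]
    gcongr
    exact norm_inner_le_norm q e
  rw [fderiv_mcDeriv_apply, norm_smul, Real.norm_of_nonneg (by positivity)]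
  refine (mul_le_mul_of_nonneg_left (norm_sub_le_of_le (norm_sub_le_of_le
    (norm_sub_le_of_le hcubic hq) he) hp) (by positivity)).trans_eq ?_
  ring

lemma norm_fluxFactor_smul_le (p : V) : ‖fluxFactor p • p‖ ≤ 2 := by
  have hpos := mcFactor_pos p
  rw [fluxFactor, norm_smul, Real.norm_of_nonneg (by positivity)]
  calc (mcFactor p + mcFactor p ^ 3) * ‖p‖
      = (1 + mcFactor p ^ 2) * (mcFactor p * ‖p‖) := by ring
    _ ≤ (1 + 1) * 1 := by
      gcongr
      exacts [mcFactor_sq_le_one p, mcFactor_mul_norm_le_one p]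
    _ = 2 := by norm_num

lemma abs_fluxFactor_mul_inner_le (p q : V) : |fluxFactor p * ⟪p, q⟫_ℝ| ≤ 2 * ‖q‖ := by
  rw [← real_inner_smul_left]
  refine (abs_real_inner_le_norm _ _).trans ?_
  gcongr
  exact norm_fluxFactor_smul_le p

lemma fderiv_pohozaev (p q : V) : fderiv ℝ pohozaev p q = fluxFactor p * ⟪p, q⟫_ℝ := by
  have hderiv : HasFDerivAt (pohozaev (V := V)) _ p :=
    (hasFDerivAt_mcFactor p).mul (hasStrictFDerivAt_norm_sq p).hasFDerivAt
  rw [hderiv.fderiv]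
  simp only [add_apply, smul_apply, innerSL_apply_apply, smul_eq_mul, nsmul_eq_mul, fluxFactor]
  push_cast
  linear_combination (- mcFactor p * ⟪p, q⟫_ℝ) * mcFactor_sq p

lemma norm_fderiv_pohozaev_le (p : V) : ‖fderiv ℝ pohozaev p‖ ≤ 2 :=
  opNorm_le_bound _ (by norm_num) fun q => by
    rw [fderiv_pohozaev]
    exact abs_fluxFactor_mul_inner_le p q

/-- The truncation `q / √(1 + δ²|q|²)`. -/
noncomputable def trunc (δ : ℝ) (q : V) : V := mcFactor (δ • q) • q

lemma contDiff_trunc (δ : ℝ) : ContDiff ℝ ∞ (trunc δ : V → V) :=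
  (contDiff_mcFactor.comp (contDiff_const_smul δ)).smul contDiff_id

lemma hasFDerivAt_trunc {δ : ℝ} (hδ : δ ≠ 0) (q : V) :
    HasFDerivAt (trunc δ : V → V) (mcDeriv (δ • q)) q := by
  have htrunc : (trunc δ : V → V) = δ⁻¹ • (mcMap ∘ fun q => δ • q) := by
    funext q
    simp only [trunc, mcMap, Pi.smul_apply, Function.comp_apply, smul_comm _ δ q, smul_smul]
    rw [inv_mul_cancel_left₀ hδ]
  rw [htrunc]
  refine (((hasFDerivAt_mcMap (δ • q)).comp q
    ((hasFDerivAt_id q).const_smul δ)).const_smul δ⁻¹).congr_fderiv ?_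
  ext z
  simp [smul_smul, hδ]

lemma norm_trunc_le (δ : ℝ) (q : V) : ‖trunc δ q‖ ≤ ‖q‖ := by
  rw [trunc, norm_smul, Real.norm_of_nonneg (mcFactor_pos _).le]
  exact mul_le_of_le_one_left (norm_nonneg q) (mcFactor_le_one _)

lemma norm_trunc_le_inv {δ : ℝ} (hδ : 0 < δ) (q : V) : ‖trunc δ q‖ ≤ δ⁻¹ := by
  rw [trunc, norm_smul, Real.norm_of_nonneg (mcFactor_pos _).le, ← one_div,
    le_div_iff₀ hδ]
  have := mcFactor_mul_norm_le_one (δ • q)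
  rw [norm_smul, Real.norm_of_nonneg hδ.le] at this
  linarith

lemma tendsto_mcFactor_smul {δ : ℕ → ℝ} (hδ : Tendsto δ atTop (𝓝 0)) (q : V) :
    Tendsto (fun k => mcFactor (δ k • q)) atTop (𝓝 1) := by
  have hcont := (contDiff_mcFactor (V := V)).continuous.tendsto ((0 : ℝ) • q)
  simpa [mcFactor_zero, Function.comp_def] using hcont.comp (hδ.smul_const q)

lemma tendsto_trunc {δ : ℕ → ℝ} (hδ : Tendsto δ atTop (𝓝 0)) (q : V) :
    Tendsto (fun k => trunc (δ k) q) atTop (𝓝 q) := by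
  simpa [trunc] using (tendsto_mcFactor_smul hδ q).smul_const q

lemma tendsto_mcDeriv_smul {δ : ℕ → ℝ} (hδ : Tendsto δ atTop (𝓝 0)) (q z : V) :
    Tendsto (fun k => mcDeriv (δ k • q) z) atTop (𝓝 z) := by
  have hcont : Continuous fun p : V => mcDeriv p z :=
    contDiff_mcDeriv.continuous.clm_apply continuous_const
  simpa [mcDeriv_zero, Function.comp_def] using
    (hcont.tendsto ((0 : ℝ) • q)).comp (hδ.smul_const q)

end MeanCurvatureMap

section Product

variable {E : Type*} [NormedAddCommGroup E] [InnerProductSpace ℝ E] [FiniteDimensional ℝ E]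
  [MeasurableSpace E] [BorelSpace E]
  {F₂ F₃ : Type*} [NormedAddCommGroup F₂] [InnerProductSpace ℝ F₂]
  [NormedAddCommGroup F₃] [NormedSpace ℝ F₃]

lemma norm_clm_apply_mcDeriv_le {L : F₂ →L[ℝ] F₃} {C : ℝ} (hC : ‖L‖ ≤ C) (p q : F₂) :
    ‖L (mcDeriv p q)‖ ≤ C * 2 * ‖q‖ := by
  rw [mul_assoc]
  exact (le_of_opNorm_le _ hC _).trans
    (mul_le_mul_of_nonneg_left (norm_mcDeriv_apply_le p q) ((norm_nonneg _).trans hC))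

variable {F₁ : Type*} [NormedAddCommGroup F₁] [NormedSpace ℝ F₁]
  {e : E} {U W : E → F₁} {Q Z : E → F₂} {Φ : F₁ → F₂ →L[ℝ] F₃} {C D : ℝ}

lemma hasFDerivAt_clm_apply_trunc (hΦ : Differentiable ℝ Φ) {δ : ℝ} (hδ : δ ≠ 0) (z : F₁ × F₂) :
    HasFDerivAt (fun z : F₁ × F₂ => Φ z.1 (trunc δ z.2))
      ((Φ z.1).comp ((mcDeriv (δ • z.2)).comp (ContinuousLinearMap.snd ℝ F₁ F₂)) +
        ((fderiv ℝ Φ z.1).comp (ContinuousLinearMap.fst ℝ F₁ F₂)).flip (trunc δ z.2)) z :=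
  ((hΦ z.1).hasFDerivAt.comp z hasFDerivAt_fst).clm_apply
    ((hasFDerivAt_trunc hδ z.2).comp z hasFDerivAt_snd)

lemma fderiv_clm_apply_trunc_apply (hΦ : Differentiable ℝ Φ) {δ : ℝ} (hδ : δ ≠ 0)
    (z y : F₁ × F₂) :
    fderiv ℝ (fun z : F₁ × F₂ => Φ z.1 (trunc δ z.2)) z y =
      fderiv ℝ Φ z.1 y.1 (trunc δ z.2) + Φ z.1 (mcDeriv (δ • z.2) y.2) := by
  rw [(hasFDerivAt_clm_apply_trunc hΦ hδ z).fderiv, add_comm]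
  rfl

lemma norm_fderiv_clm_apply_trunc_le (hΦ : Differentiable ℝ Φ) (hC : ∀ y, ‖Φ y‖ ≤ C)
    (hD : ∀ y, ‖fderiv ℝ Φ y‖ ≤ D) {δ : ℝ} (hδ : 0 < δ) (z : F₁ × F₂) :
    ‖fderiv ℝ (fun z : F₁ × F₂ => Φ z.1 (trunc δ z.2)) z‖ ≤ D * δ⁻¹ + C * 2 := by
  have hC0 : 0 ≤ C := (norm_nonneg _).trans (hC 0)
  have hD0 : 0 ≤ D := (norm_nonneg (fderiv ℝ Φ 0)).trans (hD 0)
  refine opNorm_le_bound _ (by positivity) fun y => ?_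
  rw [fderiv_clm_apply_trunc_apply hΦ hδ.ne', add_mul]
  refine norm_add_le_of_le ?_ ?_
  · calc ‖fderiv ℝ Φ z.1 y.1 (trunc δ z.2)‖ ≤ ‖fderiv ℝ Φ z.1 y.1‖ * ‖trunc δ z.2‖ :=
          le_opNorm _ _
      _ ≤ D * ‖y‖ * δ⁻¹ := by
        gcongr
        · exact (le_of_opNorm_le _ (hD _) _).trans
            (mul_le_mul_of_nonneg_left (norm_fst_le y) hD0)
        · exact norm_trunc_le_inv hδ _
      _ = D * δ⁻¹ * ‖y‖ := by ring
  · exact (norm_clm_apply_mcDeriv_le (hC _) _ _).trans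
      (mul_le_mul_of_nonneg_left (norm_snd_le y) (by positivity))

variable [CompleteSpace F₁] [CompleteSpace F₂]

lemma HasWeakDerivAlong.clm_apply_trunc (hU : HasWeakDerivAlong e U W)
    (hQ : HasWeakDerivAlong e Q Z) (hΦ : ContDiff ℝ 1 Φ) (hC : ∀ y, ‖Φ y‖ ≤ C)
    (hD : ∀ y, ‖fderiv ℝ Φ y‖ ≤ D) {δ : ℝ} (hδ : 0 < δ) :
    HasWeakDerivAlong e (fun x => Φ (U x) (trunc δ (Q x)))
      (fun x => fderiv ℝ Φ (U x) (W x) (trunc δ (Q x)) + Φ (U x) (mcDeriv (δ • Q x) (Z x))) := by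
  have hdiff := hΦ.differentiable (by simp)
  have hcontDiff : ContDiff ℝ 1 (fun z : F₁ × F₂ => Φ z.1 (trunc δ z.2)) :=
    (hΦ.comp contDiff_fst).clm_apply (((contDiff_trunc δ).of_le (by simp)).comp contDiff_snd)
  simpa only [fderiv_clm_apply_trunc_apply hdiff hδ.ne'] using
    (hU.prodMk hQ).comp_of_norm_fderiv_le hcontDiff
      (norm_fderiv_clm_apply_trunc_le hdiff hC hD hδ)

lemma HasWeakDerivAlong.clm_apply_of_norm_le [CompleteSpace F₃] (hU : HasWeakDerivAlong e U W)
    (hQ : HasWeakDerivAlong e Q Z) (hΦ : ContDiff ℝ 1 Φ) (hC : ∀ y, ‖Φ y‖ ≤ C)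
    (hD : ∀ y, ‖fderiv ℝ Φ y‖ ≤ D) {b : E → ℝ} (hb : LocallyIntegrable b volume)
    (hle : ∀ᵐ x, ‖fderiv ℝ Φ (U x) (W x)‖ * ‖Q x‖ ≤ b x) :
    HasWeakDerivAlong e (fun x => Φ (U x) (Q x))
      (fun x => fderiv ℝ Φ (U x) (W x) (Q x) + Φ (U x) (Z x)) := by
  have hC0 : 0 ≤ C := (norm_nonneg _).trans (hC 0)
  have hδ := tendsto_one_div_add_atTop_nhds_zero_nat (𝕜 := ℝ)
  refine .of_tendsto_ae (b := fun x => C * ‖Q x‖) (c := fun x => b x + C * 2 * ‖Z x‖)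
    (fun k => hU.clm_apply_trunc hQ hΦ hC hD (Nat.one_div_pos_of_nat (n := k)))
    ((locallyIntegrable_norm hQ.locallyIntegrable).smul C)
    (hb.add ((locallyIntegrable_norm hQ.locallyIntegrable_deriv).smul (C * 2)))
    (fun k => Eventually.of_forall fun x => ?_) (fun k => ?_)
    (Eventually.of_forall fun x => ?_) (Eventually.of_forall fun x => ?_)
  · exact (le_of_opNorm_le _ (hC _) _).trans
      (mul_le_mul_of_nonneg_left (norm_trunc_le _ _) hC0)
  · filter_upwards [hle] with x hx
    refine norm_add_le_of_le ?_ (norm_clm_apply_mcDeriv_le (hC _) _ _)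
    exact ((le_opNorm _ _).trans
      (mul_le_mul_of_nonneg_left (norm_trunc_le _ _) (norm_nonneg _))).trans hx
  · exact ((Φ (U x)).continuous.tendsto _).comp (tendsto_trunc hδ (Q x))
  · exact (((fderiv ℝ Φ (U x) (W x)).continuous.tendsto _).comp (tendsto_trunc hδ (Q x))).add
      (((Φ (U x)).continuous.tendsto _).comp (tendsto_mcDeriv_smul hδ (Q x) (Z x)))

end Product

section Monotone

variable {E : Type*} [NormedAddCommGroup E] [InnerProductSpace ℝ E] [FiniteDimensional ℝ E]
  [MeasurableSpace E] [BorelSpace E]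

lemma locallyIntegrable_of_tendsto_of_integral_mul_le {J : E → ℝ} {Js : ℕ → E → ℝ}
    (hJs : ∀ k, LocallyIntegrable (Js k) volume) (hnonneg : ∀ k x, 0 ≤ Js k x)
    (hlim : ∀ x, Tendsto (fun k => Js k x) atTop (𝓝 (J x)))
    (hbdd : ∀ φ : E → ℝ, ContDiff ℝ ∞ φ → HasCompactSupport φ → (∀ x, 0 ≤ φ x) →
      ∃ M, ∀ k, ∫ x, φ x * Js k x ≤ M) :
    LocallyIntegrable J volume := by
  intro x
  let φ : ContDiffBump x := ⟨1, 2, one_pos, one_lt_two⟩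
  obtain ⟨M, hM⟩ := hbdd φ φ.contDiff φ.hasCompactSupport fun _ => φ.nonneg
  have hbound (k : ℕ) : ∫⁻ y in ball x 1, ‖Js k y‖ₑ ≤ ENNReal.ofReal M :=
    calc ∫⁻ y in ball x 1, ‖Js k y‖ₑ ≤ ∫⁻ y, ENNReal.ofReal (φ y * Js k y) := by
          rw [← lintegral_indicator measurableSet_ball]
          refine lintegral_mono (Set.indicator_le fun y hy => ?_)
          rw [φ.one_of_mem_closedBall (ball_subset_closedBall hy), one_mul,
            Real.enorm_of_nonneg (hnonneg k y)]
      _ = ENNReal.ofReal (∫ y, φ y * Js k y) :=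
          (ofReal_integral_eq_lintegral_ofReal
            ((hJs k).integrable_smul_left_of_hasCompactSupport φ.continuous φ.hasCompactSupport)
            (Eventually.of_forall fun y => mul_nonneg φ.nonneg (hnonneg k y))).symm
      _ ≤ ENNReal.ofReal M := ENNReal.ofReal_le_ofReal (hM k)
  refine ⟨ball x 1, ball_mem_nhds x one_pos, ?_⟩
  have hmeas := fun k => (hJs k).aestronglyMeasurable.restrict (s := ball x 1)
  have hlim' : ∀ᵐ y ∂volume.restrict (ball x 1), Tendsto (fun k => Js k y) atTop (𝓝 (J y)) :=
    Eventually.of_forall hlim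
  refine ⟨aestronglyMeasurable_of_tendsto_ae atTop hmeas hlim', ?_⟩
  calc ∫⁻ y in ball x 1, ‖J y‖ₑ
      = ∫⁻ y in ball x 1, liminf (fun k => ‖Js k y‖ₑ) atTop :=
        lintegral_congr fun y => (hlim y).enorm.liminf_eq.symm
    _ ≤ liminf (fun k => ∫⁻ y in ball x 1, ‖Js k y‖ₑ) atTop :=
        lintegral_liminf_le' fun k => (hmeas k).enorm
    _ ≤ liminf (fun _ : ℕ => ENNReal.ofReal M) atTop :=
        liminf_le_liminf (Eventually.of_forall hbound)
    _ = ENNReal.ofReal M := liminf_const _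
    _ < ⊤ := ENNReal.ofReal_lt_top

variable {F : Type*} [NormedAddCommGroup F] [InnerProductSpace ℝ F]
  {e : E} {Q W Z : E → F} {H : F → F} {C D : ℝ}

lemma norm_inner_mcDeriv_le {p : F} (hp : ‖p‖ ≤ C) (q z : F) :
    ‖⟪p, mcDeriv q z⟫_ℝ‖ ≤ C * 2 * ‖z‖ := by
  rw [mul_assoc]
  exact (norm_inner_le_norm _ _).trans
    (mul_le_mul hp (norm_mcDeriv_apply_le _ _) (norm_nonneg _) ((norm_nonneg _).trans hp))

lemma HasWeakDerivAlong.locallyIntegrable_inner_mcDeriv (hW : HasWeakDerivAlong e W Z)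
    (hQ : AEStronglyMeasurable Q volume) (hH : Continuous H) (hC : ∀ y, ‖H y‖ ≤ C) (δ : ℝ) :
    LocallyIntegrable (fun x => ⟪H (Q x), mcDeriv (δ • W x) (Z x)⟫_ℝ) volume := by
  refine ((locallyIntegrable_norm hW.locallyIntegrable_deriv).smul (C * 2)).mono ?_
    (Eventually.of_forall fun x => (norm_inner_mcDeriv_le (hC _) _ _).trans (le_abs_self _))
  exact (hH.comp_aestronglyMeasurable hQ).inner
    (aestronglyMeasurable_mcDeriv_apply (hW.locallyIntegrable.aestronglyMeasurable.const_smul δ)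
      hW.locallyIntegrable_deriv.aestronglyMeasurable)

variable [CompleteSpace F]

lemma HasWeakDerivAlong.inner_trunc (hQ : HasWeakDerivAlong e Q W)
    (hW : HasWeakDerivAlong e W Z) (hH : ContDiff ℝ 1 H) (hC : ∀ y, ‖H y‖ ≤ C)
    (hD : ∀ y, ‖fderiv ℝ H y‖ ≤ D) {δ : ℝ} (hδ : 0 < δ) :
    HasWeakDerivAlong e (fun x => ⟪H (Q x), trunc δ (W x)⟫_ℝ)
      (fun x => mcFactor (δ • W x) * ⟪fderiv ℝ H (Q x) (W x), W x⟫_ℝ +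
        ⟪H (Q x), mcDeriv (δ • W x) (Z x)⟫_ℝ) := by
  have hfderiv (y : F) : fderiv ℝ (fun y => innerSL ℝ (H y)) y =
      (innerSL ℝ).comp (fderiv ℝ H y) :=
    ((innerSL ℝ).hasFDerivAt.comp y (hH.differentiable (by simp) y).hasFDerivAt).fderiv
  have h := hQ.clm_apply_trunc hW ((innerSL ℝ).contDiff.comp hH) (C := C) (D := D)
    (fun y => (innerSL_apply_norm ℝ (H y)).trans_le (hC y)) (fun y => ?_) hδ
  · refine h.congr EventuallyEq.rfl (Eventually.of_forall fun x => ?_)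
    simp only [Function.comp_def, hfderiv, trunc, map_smul]
    rfl
  · refine opNorm_le_bound _ ((norm_nonneg _).trans (hD y)) fun z => ?_
    rw [show innerSL ℝ ∘ H = fun y => innerSL ℝ (H y) from rfl, hfderiv,
      ContinuousLinearMap.comp_apply, innerSL_apply_norm]
    exact le_of_opNorm_le _ (hD y) z

lemma HasWeakDerivAlong.locallyIntegrable_mcFactor_mul_inner_fderiv
    (hQ : HasWeakDerivAlong e Q W) (hW : HasWeakDerivAlong e W Z) (hH : ContDiff ℝ 1 H)
    (hC : ∀ y, ‖H y‖ ≤ C) (hD : ∀ y, ‖fderiv ℝ H y‖ ≤ D) {δ : ℝ} (hδ : 0 < δ) :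
    LocallyIntegrable
      (fun x => mcFactor (δ • W x) * ⟪fderiv ℝ H (Q x) (W x), W x⟫_ℝ) volume := by
  simpa only [Pi.sub_def, add_sub_cancel_right] using
    (hQ.inner_trunc hW hH hC hD hδ).locallyIntegrable_deriv.sub
      (hW.locallyIntegrable_inner_mcDeriv hQ.locallyIntegrable.aestronglyMeasurable
        hH.continuous hC δ)

lemma HasWeakDerivAlong.integral_mul_mcFactor_mul_inner_fderiv_le (hQ : HasWeakDerivAlong e Q W)
    (hW : HasWeakDerivAlong e W Z) (hH : ContDiff ℝ 1 H) (hC : ∀ y, ‖H y‖ ≤ C)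
    (hD : ∀ y, ‖fderiv ℝ H y‖ ≤ D) {δ : ℝ} (hδ : 0 < δ) {φ : E → ℝ} (hφ : ContDiff ℝ ∞ φ)
    (hs : HasCompactSupport φ) :
    ∫ x, φ x * (mcFactor (δ • W x) * ⟪fderiv ℝ H (Q x) (W x), W x⟫_ℝ) ≤
      (∫ x, ‖fderiv ℝ φ x e‖ * (C * ‖W x‖)) + ∫ x, ‖φ x‖ * (C * 2 * ‖Z x‖) := by
  have hparts := (hQ.inner_trunc hW hH hC hD hδ).integral_fderiv_smul φ hφ hs
  simp only [smul_eq_mul, mul_add] at hparts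
  have hadd := integral_add
    ((hQ.locallyIntegrable_mcFactor_mul_inner_fderiv hW hH hC hD
      hδ).integrable_smul_left_of_hasCompactSupport hφ.continuous hs)
    ((hW.locallyIntegrable_inner_mcDeriv hQ.locallyIntegrable.aestronglyMeasurable
      hH.continuous hC δ).integrable_smul_left_of_hasCompactSupport hφ.continuous hs)
  simp only [smul_eq_mul] at hadd
  have hboundary : ‖∫ x, fderiv ℝ φ x e * ⟪H (Q x), trunc δ (W x)⟫_ℝ‖ ≤
      ∫ x, ‖fderiv ℝ φ x e‖ * (C * ‖W x‖) := by
    refine norm_integral_le_of_norm_le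
      (((locallyIntegrable_norm hW.locallyIntegrable).smul C
        ).integrable_smul_left_of_hasCompactSupport (contDiff_fderiv_apply hφ e).continuous.norm
          (hs.fderiv_apply (𝕜 := ℝ) e).norm) (Eventually.of_forall fun x => ?_)
    rw [norm_mul]
    gcongr
    exact (norm_inner_le_norm _ _).trans (mul_le_mul (hC _) (norm_trunc_le _ _) (norm_nonneg _)
      ((norm_nonneg _).trans (hC 0)))
  have hinterior : ‖∫ x, φ x * ⟪H (Q x), mcDeriv (δ • W x) (Z x)⟫_ℝ‖ ≤
      ∫ x, ‖φ x‖ * (C * 2 * ‖Z x‖) := by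
    refine norm_integral_le_of_norm_le
      (((locallyIntegrable_norm hW.locallyIntegrable_deriv).smul
        (C * 2)).integrable_smul_left_of_hasCompactSupport hφ.continuous.norm hs.norm)
      (Eventually.of_forall fun x => ?_)
    rw [norm_mul]
    exact mul_le_mul_of_nonneg_left (norm_inner_mcDeriv_le (hC _) _ _) (norm_nonneg _)
  rw [Real.norm_eq_abs] at hboundary hinterior
  linarith [(abs_le.1 hboundary).1, (abs_le.1 hinterior).1]

lemma HasWeakDerivAlong.locallyIntegrable_inner_fderiv (hQ : HasWeakDerivAlong e Q W)
    (hW : HasWeakDerivAlong e W Z) (hH : ContDiff ℝ 1 H) (hC : ∀ y, ‖H y‖ ≤ C)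
    (hD : ∀ y, ‖fderiv ℝ H y‖ ≤ D) (hmono : ∀ y z, 0 ≤ ⟪fderiv ℝ H y z, z⟫_ℝ) :
    LocallyIntegrable (fun x => ⟪fderiv ℝ H (Q x) (W x), W x⟫_ℝ) volume := by
  have hδ (k : ℕ) : 0 < 1 / ((k : ℝ) + 1) := Nat.one_div_pos_of_nat
  refine locallyIntegrable_of_tendsto_of_integral_mul_le
    (fun k => hQ.locallyIntegrable_mcFactor_mul_inner_fderiv hW hH hC hD (hδ k))
    (fun k x => mul_nonneg (mcFactor_pos _).le (hmono _ _)) (fun x => ?_) fun φ hφ hs _ =>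
      ⟨_, fun k => hQ.integral_mul_mcFactor_mul_inner_fderiv_le hW hH hC hD (hδ k) hφ hs⟩
  simpa using (tendsto_mcFactor_smul tendsto_one_div_add_atTop_nhds_zero_nat (W x)).mul_const
    ⟪fderiv ℝ H (Q x) (W x), W x⟫_ℝ

end Monotone

section ScalarTools

variable {E : Type*} [NormedAddCommGroup E] [InnerProductSpace ℝ E] [FiniteDimensional ℝ E]
  [MeasurableSpace E] [BorelSpace E] {e : E}

lemma HasWeakDerivAlong.comp_smul_of_abs_le {F : Type*} [NormedAddCommGroup F]
    [InnerProductSpace ℝ F] [CompleteSpace F] {v v' : E → ℝ} {Q Z : E → F}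
    (hv : HasWeakDerivAlong e v v') (hQ : HasWeakDerivAlong e Q Z) {θ : ℝ → ℝ}
    (hθ : ContDiff ℝ 1 θ) {C D : ℝ} (hC : ∀ y, |θ y| ≤ C) (hD : ∀ y, |deriv θ y| ≤ D)
    {b : E → ℝ} (hb : LocallyIntegrable b volume)
    (hle : ∀ᵐ x, |deriv θ (v x)| * |v' x| * ‖Q x‖ ≤ b x) :
    HasWeakDerivAlong e (fun x => θ (v x) • Q x)
      (fun x => (deriv θ (v x) * v' x) • Q x + θ (v x) • Z x) := by
  have hfderiv (y z : ℝ) : fderiv ℝ (fun y => θ y • ContinuousLinearMap.id ℝ F) y z =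
      (deriv θ y * z) • ContinuousLinearMap.id ℝ F := by
    rw [((hθ.differentiable (by simp) y).hasFDerivAt.smul_const
      (ContinuousLinearMap.id ℝ F)).fderiv, smulRight_apply, fderiv_eq_smul_deriv, smul_eq_mul,
      mul_comm]
  have hnorm (c : ℝ) : ‖c • ContinuousLinearMap.id ℝ F‖ ≤ |c| := by
    have hid : ‖ContinuousLinearMap.id ℝ F‖ ≤ 1 := norm_id_le
    rw [norm_smul, Real.norm_eq_abs]
    exact mul_le_of_le_one_right (abs_nonneg c) hid
  refine (hv.clm_apply_of_norm_le hQ (Φ := fun y => θ y • ContinuousLinearMap.id ℝ F)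
    (hθ.smul contDiff_const) (C := C) (D := D) (fun y => (hnorm _).trans (hC y)) (fun y => ?_)
    hb ?_).congr EventuallyEq.rfl (Eventually.of_forall fun x => ?_)
  · refine opNorm_le_bound _ ((abs_nonneg _).trans (hD 0)) fun z => ?_
    rw [hfderiv]
    refine (hnorm _).trans ?_
    rw [abs_mul]
    exact mul_le_mul_of_nonneg_right (hD y) (abs_nonneg z)
  · filter_upwards [hle] with x hx
    refine le_trans ?_ hx
    rw [hfderiv, ← abs_mul]
    exact mul_le_mul_of_nonneg_right (hnorm _) (norm_nonneg _)
  · simp only [hfderiv, smul_apply, ContinuousLinearMap.id_apply]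

lemma HasWeakDerivAlong.ae_eq_deriv_mul_of_abs_le {v v' g : E → ℝ} {f : ℝ → ℝ}
    (hv : HasWeakDerivAlong e v v') (hf : ContDiff ℝ 1 f)
    (hg : HasWeakDerivAlong e (fun x => f (v x)) g) {m : ℝ} (hm : 0 < m) :
    ∀ᵐ x, |v x| ≤ m → g x = deriv f (v x) * v' x := by
  let θ : ContDiffBump (0 : ℝ) := ⟨m, m + 1, hm, lt_add_one m⟩
  have hθ : ContDiff ℝ 1 θ := θ.contDiff
  have hs : HasCompactSupport θ := θ.hasCompactSupport
  have hθf : ContDiff ℝ 1 fun y => θ y * f y := hθ.mul hf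
  have hcontDeriv : Continuous (deriv θ) := hθ.continuous_deriv (by simp)
  obtain ⟨C₁, hC₁⟩ := (hθf.continuous_fderiv (by simp)).bounded_above_of_compact_support
    (hs.mul_right.fderiv (𝕜 := ℝ))
  obtain ⟨C₂, hC₂⟩ := hcontDeriv.bounded_above_of_compact_support hs.deriv
  obtain ⟨C₃, hC₃⟩ := (hcontDeriv.mul hf.continuous).bounded_above_of_compact_support
    hs.deriv.mul_right
  have hchain := hv.comp_of_norm_fderiv_le hθf hC₁
  have hproduct := hv.comp_smul_of_abs_le hg hθ (C := 1) (D := C₂)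
    (fun y => (abs_of_nonneg θ.nonneg).trans_le θ.le_one) hC₂
    ((locallyIntegrable_norm hv.locallyIntegrable_deriv).smul C₃)
    (Eventually.of_forall fun x => by
      have hx := mul_le_mul_of_nonneg_right (hC₃ (v x)) (norm_nonneg (v' x))
      rw [Pi.mul_apply, norm_mul] at hx
      simp only [Real.norm_eq_abs] at hx ⊢
      exact (mul_right_comm _ _ _).trans_le hx)
  filter_upwards [hchain.ae_eq hproduct] with x hx hvx
  have hθx : θ (v x) = 1 := θ.one_of_mem_closedBall (by simpa using hvx)
  rw [fderiv_eq_smul_deriv, deriv_fun_mul (hθ.differentiable (by simp) _)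
    (hf.differentiable (by simp) _), hθx] at hx
  simp only [smul_eq_mul] at hx
  linarith

lemma HasWeakDerivAlong.ae_eq_deriv_mul {v v' g : E → ℝ} {f : ℝ → ℝ}
    (hv : HasWeakDerivAlong e v v') (hf : ContDiff ℝ 1 f)
    (hg : HasWeakDerivAlong e (fun x => f (v x)) g) :
    ∀ᵐ x, g x = deriv f (v x) * v' x := by
  filter_upwards [ae_all_iff.2 fun m : ℕ =>
    hv.ae_eq_deriv_mul_of_abs_le hf hg m.cast_add_one_pos] with x hx
  obtain ⟨m, hm⟩ := exists_nat_ge |v x|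
  exact hx m (hm.trans (le_add_of_nonneg_right zero_le_one))

lemma HasWeakDerivAlong.locallyIntegrable_sq_div {v v' v'' : E → ℝ}
    (hv : HasWeakDerivAlong e v v') (hv' : HasWeakDerivAlong e v' v'') :
    LocallyIntegrable (fun x => v' x ^ 2 / (1 + v x ^ 2)) volume := by
  have hfderiv (y z : ℝ) : fderiv ℝ Real.arctan y z = z / (1 + y ^ 2) := by
    rw [fderiv_eq_smul_deriv, Real.deriv_arctan, smul_eq_mul, mul_one_div]
  have hinner (y z : ℝ) : ⟪fderiv ℝ Real.arctan y z, z⟫_ℝ = z ^ 2 / (1 + y ^ 2) := by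
    rw [hfderiv, RCLike.inner_apply, conj_trivial]
    ring
  refine (hv.locallyIntegrable_inner_fderiv hv' (H := Real.arctan) Real.contDiff_arctan
    (C := Real.pi / 2) (D := 1) (fun y => ?_) (fun y => ?_) (fun y z => ?_)).congr
    (Eventually.of_forall fun x => hinner _ _)
  · exact abs_le.2 ⟨(Real.neg_pi_div_two_lt_arctan y).le, (Real.arctan_lt_pi_div_two y).le⟩
  · refine opNorm_le_bound _ zero_le_one fun z => ?_
    rw [hfderiv, norm_div, one_mul, Real.norm_of_nonneg (by positivity : 0 ≤ 1 + y ^ 2)]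
    exact div_le_self (norm_nonneg z) (le_add_of_nonneg_right (sq_nonneg y))
  · rw [hinner]
    positivity

end ScalarTools

section Coordinates

variable {n : ℕ}

/-- The standard basis vectors of `ℝⁿ`, spelled as in `HasWeakPartialDeriv`. -/
noncomputable abbrev stdVec (i : Fin n) : EuclideanSpace ℝ (Fin n) :=
  EuclideanSpace.single i 1

lemma hasWeakDerivAlong_of_coord {e : EuclideanSpace ℝ (Fin n)}
    {U W : EuclideanSpace ℝ (Fin n) → EuclideanSpace ℝ (Fin n)}
    (h : ∀ i, HasWeakDerivAlong e (fun x => U x i) (fun x => W x i)) :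
    HasWeakDerivAlong e U W := by
  have hdecomp (z : EuclideanSpace ℝ (Fin n)) : ∑ i, z i • stdVec i = z := by
    ext j
    simp [Pi.single_apply]
  simpa [hdecomp] using HasWeakDerivAlong.sum Finset.univ fun i _ =>
    (h i).clm ((ContinuousLinearMap.id ℝ ℝ).smulRight (stdVec i))

lemma HasWeakDerivAlong.coord {e : EuclideanSpace ℝ (Fin n)}
    {U W : EuclideanSpace ℝ (Fin n) → EuclideanSpace ℝ (Fin n)}
    (h : HasWeakDerivAlong e U W) (i : Fin n) :
    HasWeakDerivAlong e (fun x => U x i) (fun x => W x i) :=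
  h.clm (EuclideanSpace.proj i)

lemma hasWeakPartialDeriv_iff {i : Fin n} {u g : EuclideanSpace ℝ (Fin n) → ℝ} :
    HasWeakPartialDeriv i u g ↔ HasWeakDerivAlong (stdVec i) u g := by
  simp only [HasWeakPartialDeriv, IsTestFunction, and_imp, mul_comm (u _), mul_comm (g _)]
  exact ⟨fun ⟨hu, hg, h⟩ => ⟨hu, hg, h⟩,
    fun h => ⟨h.locallyIntegrable, h.locallyIntegrable_deriv, h.integral_fderiv_smul⟩⟩

lemma fderiv_coord (i : Fin n) (x e : EuclideanSpace ℝ (Fin n)) :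
    fderiv ℝ (fun x : EuclideanSpace ℝ (Fin n) => x i) x e = e i :=
  congrArg (· e) (EuclideanSpace.proj (𝕜 := ℝ) i).fderiv

lemma contDiff_coord (i : Fin n) : ContDiff ℝ ∞ (fun x : EuclideanSpace ℝ (Fin n) => x i) :=
  (EuclideanSpace.proj (𝕜 := ℝ) i : EuclideanSpace ℝ (Fin n) →L[ℝ] ℝ).contDiff

lemma HasWeakDerivAlong.sum_coord_smul {F : Type*} [NormedAddCommGroup F] [NormedSpace ℝ F]
    {k : Fin n} {U W : Fin n → EuclideanSpace ℝ (Fin n) → F}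
    (h : ∀ i, HasWeakDerivAlong (stdVec k) (U i) (W i)) :
    HasWeakDerivAlong (stdVec k) (fun x => ∑ i, x i • U i x)
      (fun x => U k x + ∑ i, x i • W i x) := by
  refine (HasWeakDerivAlong.sum Finset.univ fun i _ =>
    (h i).smooth_smul (contDiff_coord i)).congr EventuallyEq.rfl (Eventually.of_forall fun x => ?_)
  simp [fderiv_coord, Finset.sum_add_distrib]

lemma real_inner_gradient (φ : EuclideanSpace ℝ (Fin n) → ℝ)
    (x v : EuclideanSpace ℝ (Fin n)) : ⟪v, ∇ φ x⟫_ℝ = fderiv ℝ φ x v :=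
  inner_gradient_right

lemma gradient_coord (φ : EuclideanSpace ℝ (Fin n) → ℝ) (x : EuclideanSpace ℝ (Fin n))
    (i : Fin n) : (∇ φ x) i = fderiv ℝ φ x (stdVec i) := by
  rw [← real_inner_gradient φ, EuclideanSpace.inner_single_left]
  simp

lemma euclidean_inner_eq_sum (x y : EuclideanSpace ℝ (Fin n)) : ⟪x, y⟫_ℝ = ∑ i, x i * y i := by
  simp [PiLp.inner_apply, mul_comm]

lemma integrable_inner_gradient {V : EuclideanSpace ℝ (Fin n) → EuclideanSpace ℝ (Fin n)}
    (hV : ∀ i, LocallyIntegrable (fun x => V x i) volume) {φ : EuclideanSpace ℝ (Fin n) → ℝ}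
    (hφ : ContDiff ℝ ∞ φ) (hs : HasCompactSupport φ) :
    Integrable (fun x => ⟪V x, ∇ φ x⟫_ℝ) volume := by
  simp only [euclidean_inner_eq_sum, gradient_coord, mul_comm (V _ _)]
  exact integrable_finsetSum _ fun i _ =>
    (hV i).integrable_smul_left_of_hasCompactSupport (contDiff_fderiv_apply hφ _).continuous
      (hs.fderiv_apply (𝕜 := ℝ) _)

lemma integral_inner_gradient {V : EuclideanSpace ℝ (Fin n) → EuclideanSpace ℝ (Fin n)}
    {D : Fin n → EuclideanSpace ℝ (Fin n) → ℝ}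
    (hV : ∀ i, HasWeakDerivAlong (stdVec i) (fun x => V x i) (D i))
    {φ : EuclideanSpace ℝ (Fin n) → ℝ} (hφ : ContDiff ℝ ∞ φ) (hs : HasCompactSupport φ) :
    ∫ x, ⟪V x, ∇ φ x⟫_ℝ = -∫ x, φ x * ∑ i, D i x := by
  have hderiv (i : Fin n) : Integrable (fun x => φ x * D i x) volume :=
    (hV i).integrable_smul_deriv hφ.continuous hs
  have hgradient (i : Fin n) : Integrable (fun x => fderiv ℝ φ x (stdVec i) * V x i) volume :=
    (hV i).integrable_fderiv_smul hφ hs (stdVec i)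
  simp only [euclidean_inner_eq_sum, gradient_coord, mul_comm (V _ _), Finset.mul_sum]
  rw [integral_finsetSum _ fun i _ => hderiv i, integral_finsetSum _ fun i _ => hgradient i,
    ← Finset.sum_neg_distrib]
  exact Finset.sum_congr rfl fun i _ => (hV i).integral_fderiv_smul φ hφ hs

lemma continuous_gradient {φ : EuclideanSpace ℝ (Fin n) → ℝ} (hφ : ContDiff ℝ ∞ φ) :
    Continuous (∇ φ) :=
  (InnerProductSpace.toDual ℝ _).symm.continuous.comp (hφ.continuous_fderiv (by simp))

lemma hasCompactSupport_gradient {φ : EuclideanSpace ℝ (Fin n) → ℝ} (hs : HasCompactSupport φ) :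
    HasCompactSupport (∇ φ) :=
  (hs.fderiv (𝕜 := ℝ)).comp_left (map_zero (InnerProductSpace.toDual ℝ _).symm)

lemma HasWeakGradient.hasWeakDerivAlong {u : EuclideanSpace ℝ (Fin n) → ℝ}
    {G : EuclideanSpace ℝ (Fin n) → EuclideanSpace ℝ (Fin n)} (hG : HasWeakGradient u G)
    (i : Fin n) : HasWeakDerivAlong (stdVec i) u (fun x => G x i) :=
  hasWeakPartialDeriv_iff.1 (hG i)

lemma HasWeakGradient.ae_eq {u : EuclideanSpace ℝ (Fin n) → ℝ}
    {G G' : EuclideanSpace ℝ (Fin n) → EuclideanSpace ℝ (Fin n)} (hG : HasWeakGradient u G)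
    (hG' : HasWeakGradient u G') : G =ᵐ[volume] G' := by
  filter_upwards [ae_all_iff.2 fun i =>
    (hG.hasWeakDerivAlong i).ae_eq (hG'.hasWeakDerivAlong i)] with x hx
  exact PiLp.ext hx

lemma MemSobolevLoc.congr_ae {k : ℕ} {u v : EuclideanSpace ℝ (Fin n) → ℝ}
    (hu : MemSobolevLoc k u) (huv : u =ᵐ[volume] v) : MemSobolevLoc k v := by
  cases k with
  | zero => exact LocallyIntegrable.congr hu huv
  | succ k =>
    refine ⟨hu.1.congr huv, fun i => ?_⟩
    obtain ⟨g, hg, hgs⟩ := hu.2 i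
    exact ⟨g, hasWeakPartialDeriv_iff.2 ((hasWeakPartialDeriv_iff.1 hg).congr huv
      EventuallyEq.rfl), hgs⟩

lemma HasWeakGradient.memSobolevLoc {k : ℕ} {u : EuclideanSpace ℝ (Fin n) → ℝ}
    {G : EuclideanSpace ℝ (Fin n) → EuclideanSpace ℝ (Fin n)} (hG : HasWeakGradient u G)
    (hu : MemSobolevLoc (k + 1) u) (j : Fin n) : MemSobolevLoc k (fun x => G x j) := by
  obtain ⟨g, hg, hgs⟩ := hu.2 j
  exact hgs.congr_ae ((hasWeakPartialDeriv_iff.1 hg).ae_eq (hG.hasWeakDerivAlong j))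

lemma MemSobolevLoc.exists_hasWeakDerivAlong {k : ℕ}
    {U : EuclideanSpace ℝ (Fin n) → EuclideanSpace ℝ (Fin n)}
    (hU : ∀ j, MemSobolevLoc (k + 1) (fun x => U x j)) (i : Fin n) :
    ∃ W, HasWeakDerivAlong (stdVec i) U W ∧ ∀ j, MemSobolevLoc k (fun x => W x j) := by
  choose g hg hgs using fun j => (hU j).2 i
  exact ⟨fun x => WithLp.toLp 2 fun j => g j x,
    hasWeakDerivAlong_of_coord fun j => hasWeakPartialDeriv_iff.1 (hg j), hgs⟩

end Coordinates

section StableSolutions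

lemma inner_mcMap {V : Type*} [NormedAddCommGroup V] [InnerProductSpace ℝ V] (p q : V) :
    ⟪mcMap p, q⟫_ℝ = ⟪p, q⟫_ℝ / √(1 + ‖p‖ ^ 2) := by
  rw [mcMap, real_inner_smul_left, mcFactor, div_eq_inv_mul]

lemma inner_mcDeriv_self_eq_div {V : Type*} [NormedAddCommGroup V] [InnerProductSpace ℝ V]
    (p q : V) : ⟪mcDeriv p q, q⟫_ℝ =
      ‖q‖ ^ 2 / √(1 + ‖p‖ ^ 2) - ⟪p, q⟫_ℝ ^ 2 / (1 + ‖p‖ ^ 2) ^ (3 / 2 : ℝ) := by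
  have hpow : (1 + ‖p‖ ^ 2) ^ (3 / 2 : ℝ) = √(1 + ‖p‖ ^ 2) ^ 3 := by
    rw [Real.sqrt_eq_rpow, ← Real.rpow_natCast _ 3, ← Real.rpow_mul (by positivity)]
    norm_num
  rw [inner_mcDeriv_self, hpow, mcFactor, inv_pow, div_eq_inv_mul, div_eq_inv_mul]

lemma inner_mcDeriv_self_self_le {V : Type*} [NormedAddCommGroup V] [InnerProductSpace ℝ V]
    (p : V) : ⟪mcDeriv p p, p⟫_ℝ ≤ ‖p‖ :=
  calc ⟪mcDeriv p p, p⟫_ℝ ≤ mcFactor p * ‖p‖ ^ 2 := inner_mcDeriv_self_le p p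
    _ = mcFactor p * ‖p‖ * ‖p‖ := by ring
    _ ≤ ‖p‖ := mul_le_of_le_one_left (norm_nonneg p) (mcFactor_mul_norm_le_one p)

lemma inner_mcDeriv_sum_le {ι V : Type*} [NormedAddCommGroup V] [InnerProductSpace ℝ V]
    (s : Finset ι) (p : V) (q : ι → V) :
    ⟪mcDeriv p (∑ i ∈ s, q i), ∑ i ∈ s, q i⟫_ℝ ≤
      2 ^ s.card * ∑ i ∈ s, ⟪mcDeriv p (q i), q i⟫_ℝ := by
  classical
  induction s using Finset.induction_on with
  | empty => simp
  | insert a s ha ih =>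
    rw [Finset.sum_insert ha, Finset.sum_insert ha, Finset.card_insert_of_notMem ha, pow_succ]
    have hadd := inner_mcDeriv_add_le p (q a) (∑ i ∈ s, q i)
    have hnonneg := inner_mcDeriv_self_nonneg p (q a)
    have hone : (1 : ℝ) ≤ 2 ^ s.card := one_le_pow₀ one_le_two
    linarith [mul_nonneg (sub_nonneg.2 hone) hnonneg]

/-- A stable solution `u` in the form used in the proof: `G`, `W` and `W₂` are the weak
derivatives of `u` of orders one, two and three (`W i = ∂ᵢ∇u` and `W₂ i k = ∂ₖ∂ᵢ∇u`), and the
equation and the stability inequality are written with the map `mcMap p = p / √(1 + |p|²)` and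
its derivative `mcDeriv`. -/
structure StableData {n : ℕ} (f : ℝ → ℝ) (u : EuclideanSpace ℝ (Fin n) → ℝ)
    (G : EuclideanSpace ℝ (Fin n) → EuclideanSpace ℝ (Fin n))
    (W : Fin n → EuclideanSpace ℝ (Fin n) → EuclideanSpace ℝ (Fin n))
    (W₂ : Fin n → Fin n → EuclideanSpace ℝ (Fin n) → EuclideanSpace ℝ (Fin n)) : Prop where
  weak_u : ∀ i, HasWeakDerivAlong (stdVec i) u (fun x => G x i)
  weak_G : ∀ i, HasWeakDerivAlong (stdVec i) G (W i)
  weak_W : ∀ i k, HasWeakDerivAlong (stdVec k) (W i) (W₂ i k)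
  contDiff_f : ContDiff ℝ 1 f
  locallyIntegrable_f : LocallyIntegrable (fun x => f (u x)) volume
  locallyIntegrable_deriv : LocallyIntegrable (fun x => deriv f (u x)) volume
  equation : ∀ φ : EuclideanSpace ℝ (Fin n) → ℝ, ContDiff ℝ ∞ φ → HasCompactSupport φ →
    ∫ x, ⟪mcMap (G x), ∇ φ x⟫_ℝ = ∫ x, f (u x) * φ x
  stability : ∀ ξ : EuclideanSpace ℝ (Fin n) → ℝ, ContDiff ℝ ∞ ξ → HasCompactSupport ξ →
    ∫ x, deriv f (u x) * ξ x ^ 2 ≤ ∫ x, ⟪mcDeriv (G x) (∇ ξ x), ∇ ξ x⟫_ℝ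

lemma IsStableSolution.exists_stableData {n : ℕ} {f : ℝ → ℝ}
    {u : EuclideanSpace ℝ (Fin n) → ℝ} (hstable : IsStableSolution f u) (hf : ContDiff ℝ 1 f)
    (hu : MemSobolevLoc 3 u) {G : EuclideanSpace ℝ (Fin n) → EuclideanSpace ℝ (Fin n)}
    (hG : HasWeakGradient u G) : ∃ W W₂, StableData f u G W W₂ := by
  choose W hW hWmem using
    fun i => MemSobolevLoc.exists_hasWeakDerivAlong (hG.memSobolevLoc hu) i
  choose W₂ hW₂ _ using fun i k => MemSobolevLoc.exists_hasWeakDerivAlong (hWmem i) k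
  obtain ⟨-, hfu, hfu', G', hG', hequation, hstability⟩ := hstable
  refine ⟨W, W₂, hG.hasWeakDerivAlong, hW, hW₂, hf, hfu, hfu', fun φ hφ hs => ?_,
    fun ξ hξ hs => ?_⟩
  · refine (integral_congr_ae ?_).trans (hequation φ ⟨hφ, hs⟩)
    filter_upwards [hG.ae_eq hG'] with x hx
    rw [hx, inner_mcMap]
  · refine (hstability ξ ⟨hξ, hs⟩).trans_eq (integral_congr_ae ?_)
    filter_upwards [hG.ae_eq hG'] with x hx
    rw [hx, inner_mcDeriv_self_eq_div]

namespace StableData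

variable {n : ℕ} {f : ℝ → ℝ} {u : EuclideanSpace ℝ (Fin n) → ℝ}
  {G : EuclideanSpace ℝ (Fin n) → EuclideanSpace ℝ (Fin n)}
  {W : Fin n → EuclideanSpace ℝ (Fin n) → EuclideanSpace ℝ (Fin n)}
  {W₂ : Fin n → Fin n → EuclideanSpace ℝ (Fin n) → EuclideanSpace ℝ (Fin n)}

lemma locallyIntegrable_G [NeZero n] (h : StableData f u G W W₂) : LocallyIntegrable G volume :=
  (h.weak_G 0).locallyIntegrable

lemma hessian_symm (h : StableData f u G W W₂) : ∀ᵐ x, ∀ i j, W i x j = W j x i :=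
  ae_all_iff.2 fun i => ae_all_iff.2 fun j =>
    (h.weak_u j).comm (h.weak_u i) ((h.weak_G i).coord j) ((h.weak_G j).coord i)

lemma weak_mcMap (h : StableData f u G W W₂) (i : Fin n) :
    HasWeakDerivAlong (stdVec i) (fun x => mcMap (G x)) (fun x => mcDeriv (G x) (W i x)) := by
  have hchain := (h.weak_G i).comp_of_norm_fderiv_le (Φ := mcMap) (contDiff_mcMap.of_le (by simp))
    (C := 2) (fun y => (congrArg norm (fderiv_mcMap y)).trans_le (norm_mcDeriv_le y))
  simpa only [fderiv_mcMap] using hchain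

lemma equation_ae (h : StableData f u G W W₂) :
    (fun x => f (u x)) =ᵐ[volume] fun x => -∑ i, mcDeriv (G x) (W i x) i := by
  have hdiv : LocallyIntegrable (fun x => ∑ i, mcDeriv (G x) (W i x) i) volume :=
    locallyIntegrable_finsetSum _ fun i _ => ((h.weak_mcMap i).coord i).locallyIntegrable_deriv
  refine ae_eq_of_integral_contDiff_smul_eq h.locallyIntegrable_f hdiv.neg fun φ hφ hs => ?_
  simp only [smul_eq_mul, mul_neg, integral_neg]
  rw [← integral_inner_gradient (fun i => (h.weak_mcMap i).coord i) hφ hs,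
    h.equation φ hφ hs]
  simp only [mul_comm]

lemma locallyIntegrable_sq_hessian (h : StableData f u G W W₂) (i : Fin n) :
    LocallyIntegrable (fun x => mcFactor (G x) ^ 2 * ‖W i x‖ ^ 2) volume := by
  have hsum : LocallyIntegrable (fun x => ∑ j, W i x j ^ 2 / (1 + G x j ^ 2)) volume :=
    locallyIntegrable_finsetSum _ fun j _ =>
      ((h.weak_G i).coord j).locallyIntegrable_sq_div ((h.weak_W i i).coord j)
  refine hsum.mono ?_ (Eventually.of_forall fun x => ?_)
  · exact ((contDiff_mcFactor.continuous.comp_aestronglyMeasurable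
      (h.weak_G i).locallyIntegrable.aestronglyMeasurable).pow 2).mul
        ((h.weak_G i).locallyIntegrable_deriv.aestronglyMeasurable.norm.pow 2)
  · rw [Real.norm_of_nonneg (by positivity), EuclideanSpace.real_norm_sq_eq, Finset.mul_sum]
    refine (Finset.sum_le_sum fun j _ => ?_).trans (le_abs_self _)
    have hcoord : G x j ^ 2 ≤ ‖G x‖ ^ 2 := by
      simpa using pow_le_pow_left₀ (norm_nonneg _) (PiLp.norm_apply_le (G x) j) 2
    rw [le_div_iff₀ (by positivity), mul_right_comm]
    refine mul_le_of_le_one_left (sq_nonneg _) (le_trans ?_ (mcFactor_sq (G x)).le)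
    gcongr

/-- The second weak derivatives of the flux `mcMap (G x)`. -/
noncomputable def fluxHessian (G : EuclideanSpace ℝ (Fin n) → EuclideanSpace ℝ (Fin n))
    (W : Fin n → EuclideanSpace ℝ (Fin n) → EuclideanSpace ℝ (Fin n))
    (W₂ : Fin n → Fin n → EuclideanSpace ℝ (Fin n) → EuclideanSpace ℝ (Fin n))
    (i k : Fin n) (x : EuclideanSpace ℝ (Fin n)) : EuclideanSpace ℝ (Fin n) :=
  fderiv ℝ mcDeriv (G x) (W k x) (W i x) + mcDeriv (G x) (W₂ i k x)

lemma weak_mcDeriv (h : StableData f u G W W₂) (i k : Fin n) :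
    HasWeakDerivAlong (stdVec k) (fun x => mcDeriv (G x) (W i x)) (fluxHessian G W W₂ i k) := by
  have hbound : LocallyIntegrable (fun x => 3 * (mcFactor (G x) ^ 2 * ‖W k x‖ ^ 2) +
      3 * (mcFactor (G x) ^ 2 * ‖W i x‖ ^ 2)) volume :=
    ((h.locallyIntegrable_sq_hessian k).smul (3 : ℝ)).add
      ((h.locallyIntegrable_sq_hessian i).smul (3 : ℝ))
  have hnorm (p e : EuclideanSpace ℝ (Fin n)) :
      ‖fderiv ℝ (mcDeriv : EuclideanSpace ℝ (Fin n) → _) p e‖ ≤ 6 * mcFactor p ^ 2 * ‖e‖ :=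
    opNorm_le_bound _ (by positivity) fun q =>
      (norm_fderiv_mcDeriv_apply_le p e q).trans_eq (mul_assoc _ _ _).symm
  refine (h.weak_G k).clm_apply_of_norm_le (h.weak_W i k) (contDiff_mcDeriv.of_le (by simp))
    (C := 2) (D := 6) norm_mcDeriv_le (fun p => ?_) hbound (Eventually.of_forall fun x => ?_)
  · refine opNorm_le_bound _ (by norm_num) fun e => (hnorm p e).trans ?_
    have hle : mcFactor p ^ 2 ≤ 1 := pow_le_one₀ (mcFactor_pos p).le (mcFactor_le_one p)
    gcongr
    linarith
  · have hyoung := mul_nonneg (sq_nonneg (mcFactor (G x))) (sq_nonneg (‖W k x‖ - ‖W i x‖))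
    refine (mul_le_mul_of_nonneg_right (hnorm _ _) (norm_nonneg _)).trans ?_
    linarith

lemma fluxHessian_symm (h : StableData f u G W W₂) :
    ∀ᵐ x, ∀ i k, fluxHessian G W W₂ i k x = fluxHessian G W W₂ k i x :=
  ae_all_iff.2 fun i => ae_all_iff.2 fun k =>
    (h.weak_mcMap i).comm (h.weak_mcMap k) (h.weak_mcDeriv i k) (h.weak_mcDeriv k i)

lemma deriv_equation_ae (h : StableData f u G W W₂) (k : Fin n) :
    ∀ᵐ x, deriv f (u x) * G x k = -∑ i, fluxHessian G W W₂ i k x i := by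
  have hdiv : HasWeakDerivAlong (stdVec k) (fun x => f (u x))
      (fun x => -∑ i, fluxHessian G W W₂ i k x i) :=
    (HasWeakDerivAlong.sum Finset.univ fun i _ => (h.weak_mcDeriv i k).coord i).neg.congr
      h.equation_ae.symm EventuallyEq.rfl
  filter_upwards [(h.weak_u k).ae_eq_deriv_mul h.contDiff_f hdiv] with x hx using hx.symm

/-- The radial derivative `x · ∇u`. -/
noncomputable def radial (G : EuclideanSpace ℝ (Fin n) → EuclideanSpace ℝ (Fin n))
    (x : EuclideanSpace ℝ (Fin n)) : ℝ := ⟪x, G x⟫_ℝ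

/-- The derivative of the gradient along the dilation field `x`. -/
noncomputable def dilationDeriv (W : Fin n → EuclideanSpace ℝ (Fin n) → EuclideanSpace ℝ (Fin n))
    (x : EuclideanSpace ℝ (Fin n)) : EuclideanSpace ℝ (Fin n) := ∑ i, x i • W i x

/-- The weak gradient of the radial derivative `x · ∇u`. -/
noncomputable def radialGrad (G : EuclideanSpace ℝ (Fin n) → EuclideanSpace ℝ (Fin n))
    (W : Fin n → EuclideanSpace ℝ (Fin n) → EuclideanSpace ℝ (Fin n))
    (x : EuclideanSpace ℝ (Fin n)) : EuclideanSpace ℝ (Fin n) := G x + dilationDeriv W x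

/-- The field whose divergence is `-f'(u) (x · ∇u)`. -/
noncomputable def dilationFlux (G : EuclideanSpace ℝ (Fin n) → EuclideanSpace ℝ (Fin n))
    (W : Fin n → EuclideanSpace ℝ (Fin n) → EuclideanSpace ℝ (Fin n))
    (x : EuclideanSpace ℝ (Fin n)) : EuclideanSpace ℝ (Fin n) :=
  (∑ i, x i • mcDeriv (G x) (W i x)) - mcMap (G x)

lemma dilationFlux_eq (x : EuclideanSpace ℝ (Fin n)) :
    dilationFlux G W x = mcDeriv (G x) (radialGrad G W x) - fluxFactor (G x) • G x := by
  simp only [dilationFlux, radialGrad, dilationDeriv, map_add, map_sum, map_smul, mcDeriv_self,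
    mcMap, fluxFactor, add_smul]
  abel

lemma weak_dilationFlux (h : StableData f u G W W₂) (k : Fin n) :
    HasWeakDerivAlong (stdVec k) (dilationFlux G W)
      (fun x => ∑ i, x i • fluxHessian G W W₂ i k x) :=
  ((HasWeakDerivAlong.sum_coord_smul fun i => h.weak_mcDeriv i k).sub (h.weak_mcMap k)).congr
    EventuallyEq.rfl (Eventually.of_forall fun _ => add_sub_cancel_left _ _)

lemma weak_radial (h : StableData f u G W W₂) (k : Fin n) :
    HasWeakDerivAlong (stdVec k) (radial G) (fun x => radialGrad G W x k) := by
  refine (HasWeakDerivAlong.sum_coord_smul fun i => (h.weak_G k).coord i).congr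
    (Eventually.of_forall fun x => (euclidean_inner_eq_sum x (G x)).symm) ?_
  filter_upwards [h.hessian_symm] with x hx
  simp only [radialGrad, dilationDeriv, smul_eq_mul, PiLp.add_apply, WithLp.ofLp_sum,
    Finset.sum_apply, PiLp.smul_apply, hx k]

lemma weak_radialGrad (h : StableData f u G W W₂) (k : Fin n) :
    ∃ Z, HasWeakDerivAlong (stdVec k) (radialGrad G W) Z :=
  ⟨_, (h.weak_G k).add (HasWeakDerivAlong.sum_coord_smul fun i => h.weak_W i k)⟩

lemma locallyIntegrable_radialGrad [NeZero n] (h : StableData f u G W W₂) :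
    LocallyIntegrable (radialGrad G W) volume :=
  (h.weak_radialGrad 0).choose_spec.locallyIntegrable

lemma locallyIntegrable_radial [NeZero n] (h : StableData f u G W W₂) :
    LocallyIntegrable (radial G) volume := (h.weak_radial 0).locallyIntegrable

lemma locallyIntegrable_radialGrad_sq_div (h : StableData f u G W W₂) :
    LocallyIntegrable (fun x => ‖radialGrad G W x‖ ^ 2 / (1 + radial G x ^ 2)) volume := by
  simp only [EuclideanSpace.real_norm_sq_eq, Finset.sum_div]
  refine locallyIntegrable_finsetSum _ fun k _ => ?_
  obtain ⟨Z, hZ⟩ := h.weak_radialGrad k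
  exact (h.weak_radial k).locallyIntegrable_sq_div (hZ.coord k)

lemma locallyIntegrable_inner_mcDeriv_hessian (h : StableData f u G W W₂) (i : Fin n) :
    LocallyIntegrable (fun x => ⟪mcDeriv (G x) (W i x), W i x⟫_ℝ) volume := by
  have hmono := (h.weak_G i).locallyIntegrable_inner_fderiv (h.weak_W i i) (H := mcMap)
    (contDiff_mcMap.of_le (by simp)) (C := 1) (D := 2) norm_mcMap_le_one
    (fun y => (congrArg norm (fderiv_mcMap y)).trans_le (norm_mcDeriv_le y))
    (fun y z => by rw [fderiv_mcMap]; exact inner_mcDeriv_self_nonneg y z)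
  simpa only [fderiv_mcMap] using hmono

lemma inner_mcDeriv_dilationDeriv_le (x : EuclideanSpace ℝ (Fin n)) :
    ⟪mcDeriv (G x) (dilationDeriv W x), dilationDeriv W x⟫_ℝ ≤
      2 ^ n * ∑ i, x i ^ 2 * ⟪mcDeriv (G x) (W i x), W i x⟫_ℝ := by
  refine (inner_mcDeriv_sum_le Finset.univ (G x) fun i => x i • W i x).trans_eq ?_
  simp only [map_smul, real_inner_smul_left, real_inner_smul_right, Finset.card_univ,
    Fintype.card_fin, sq, mul_assoc]

lemma locallyIntegrable_inner_radialGrad [NeZero n] (h : StableData f u G W W₂) :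
    LocallyIntegrable (fun x => ⟪mcDeriv (G x) (radialGrad G W x), radialGrad G W x⟫_ℝ)
      volume := by
  have hbound : LocallyIntegrable (fun x => 2 * (‖G x‖ +
      2 ^ n * ∑ i, x i ^ 2 * ⟪mcDeriv (G x) (W i x), W i x⟫_ℝ)) volume :=
    ((locallyIntegrable_norm h.locallyIntegrable_G).add ((locallyIntegrable_finsetSum _ fun i _ =>
      (h.locallyIntegrable_inner_mcDeriv_hessian i).continuous_smul
        ((contDiff_coord i).continuous.pow 2)).smul ((2 : ℝ) ^ n))).smul (2 : ℝ)
  have hmeas := h.locallyIntegrable_radialGrad.aestronglyMeasurable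
  refine hbound.mono ((aestronglyMeasurable_mcDeriv_apply
    h.locallyIntegrable_G.aestronglyMeasurable hmeas).inner hmeas)
    (Eventually.of_forall fun x => ?_)
  rw [Real.norm_of_nonneg (inner_mcDeriv_self_nonneg _ _)]
  refine ((inner_mcDeriv_add_le (G x) (G x) (dilationDeriv W x)).trans ?_).trans (le_abs_self _)
  gcongr
  exacts [inner_mcDeriv_self_self_le (G x), inner_mcDeriv_dilationDeriv_le x]

end StableData

end StableSolutions

section RealTruncation

/-- The function `w / (1 + δ²w²)`, that is, `(trunc δ w)² / w`. -/
noncomputable def truncSq (δ w : ℝ) : ℝ := mcFactor (δ • w) ^ 2 * w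

lemma mcFactor_smul_sq (δ w : ℝ) : mcFactor (δ • w) ^ 2 * (1 + δ ^ 2 * w ^ 2) = 1 := by
  simpa [norm_smul, mul_pow] using mcFactor_sq (δ • w)

lemma trunc_eq_mul (δ w : ℝ) : trunc δ w = mcFactor (δ • w) * w := rfl

lemma mul_truncSq (δ w : ℝ) : w * truncSq δ w = trunc δ w ^ 2 := by
  rw [truncSq, trunc_eq_mul]
  ring

lemma fderiv_trunc_apply {δ : ℝ} (hδ : δ ≠ 0) (w z : ℝ) :
    fderiv ℝ (trunc δ : ℝ → ℝ) w z = mcFactor (δ • w) ^ 3 * z := by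
  rw [(hasFDerivAt_trunc hδ w).fderiv, mcDeriv_apply]
  have hsq := mcFactor_smul_sq δ w
  simp only [smul_eq_mul, RCLike.inner_apply, conj_trivial] at hsq ⊢
  linear_combination (- mcFactor (δ * w) * z) * hsq

lemma contDiff_truncSq (δ : ℝ) : ContDiff ℝ ∞ (truncSq δ) :=
  ((contDiff_mcFactor.comp (contDiff_const_smul δ)).pow 2).mul contDiff_id

lemma hasDerivAt_mcFactor_smul (δ w : ℝ) :
    HasDerivAt (fun w : ℝ => mcFactor (δ • w)) (-(mcFactor (δ • w) ^ 3 * (δ ^ 2 * w))) w := by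
  have hcomp := (hasFDerivAt_mcFactor (δ • w)).comp w ((hasFDerivAt_id w).const_smul δ)
  refine hcomp.hasDerivAt.congr_deriv ?_
  simp only [ContinuousLinearMap.comp_apply, smul_apply, ContinuousLinearMap.id_apply,
    innerSL_apply_apply, RCLike.inner_apply, conj_trivial, smul_eq_mul]
  ring

lemma deriv_truncSq (δ w : ℝ) :
    deriv (truncSq δ) w = 2 * mcFactor (δ • w) ^ 4 - mcFactor (δ • w) ^ 2 := by
  have hderiv : HasDerivAt (truncSq δ) _ w :=
    ((hasDerivAt_mcFactor_smul δ w).pow 2).mul (hasDerivAt_id w)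
  rw [hderiv.deriv]
  simp only [Pi.pow_apply, Nat.cast_ofNat]
  linear_combination (-2 * mcFactor (δ • w) ^ 2) * mcFactor_smul_sq δ w

lemma abs_deriv_truncSq_le (δ w : ℝ) : |deriv (truncSq δ) w| ≤ mcFactor (δ • w) ^ 2 := by
  have hle := mul_le_mul_of_nonneg_left (mcFactor_sq_le_one (δ • w))
    (sq_nonneg (mcFactor (δ • w)))
  have hnonneg := pow_nonneg (mcFactor_pos (δ • w)).le 4
  rw [deriv_truncSq, abs_le]
  constructor <;> linarith

lemma mcFactor_smul_sq_le {δ : ℝ} (hδ : 0 < δ) (hδ1 : δ ≤ 1) (w : ℝ) :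
    mcFactor (δ • w) ^ 2 ≤ (δ ^ 2)⁻¹ * (1 + w ^ 2)⁻¹ := by
  have hδsq : δ ^ 2 * (1 + w ^ 2) ≤ 1 + δ ^ 2 * w ^ 2 := by
    linarith [pow_le_one₀ (n := 2) hδ.le hδ1]
  rw [← mul_inv, ← one_div, le_div_iff₀ (by positivity)]
  exact (mul_le_mul_of_nonneg_left hδsq (sq_nonneg _)).trans (mcFactor_smul_sq δ w).le

lemma abs_truncSq_le_inv {δ : ℝ} (hδ : 0 < δ) (w : ℝ) : |truncSq δ w| ≤ δ⁻¹ := by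
  have htrunc : truncSq δ w = mcFactor (δ • w) * trunc δ w := by
    rw [truncSq, trunc_eq_mul, sq, mul_assoc]
  rw [htrunc, abs_mul, abs_of_pos (mcFactor_pos _)]
  exact (mul_le_of_le_one_left (abs_nonneg _) (mcFactor_le_one _)).trans (norm_trunc_le_inv hδ w)

end RealTruncation

namespace StableData

variable {n : ℕ} {f : ℝ → ℝ} {u : EuclideanSpace ℝ (Fin n) → ℝ}
  {G : EuclideanSpace ℝ (Fin n) → EuclideanSpace ℝ (Fin n)}
  {W : Fin n → EuclideanSpace ℝ (Fin n) → EuclideanSpace ℝ (Fin n)}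
  {W₂ : Fin n → Fin n → EuclideanSpace ℝ (Fin n) → EuclideanSpace ℝ (Fin n)} {δ : ℝ}

lemma norm_dilationFlux_le (x : EuclideanSpace ℝ (Fin n)) :
    ‖dilationFlux G W x‖ ≤ 2 * ‖radialGrad G W x‖ + 2 := by
  rw [dilationFlux_eq]
  exact (norm_sub_le _ _).trans
    (add_le_add (norm_mcDeriv_apply_le _ _) (norm_fluxFactor_smul_le _))

lemma abs_deriv_truncSq_mul_dilationFlux_le (hδ : 0 < δ) (hδ1 : δ ≤ 1)
    (x : EuclideanSpace ℝ (Fin n)) (k : Fin n) :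
    |deriv (truncSq δ) (radial G x)| * |radialGrad G W x k| * ‖dilationFlux G W x‖ ≤
      2 * (δ ^ 2)⁻¹ * (‖radialGrad G W x‖ ^ 2 / (1 + radial G x ^ 2)) +
        2 * ‖radialGrad G W x‖ := by
  have hcoord : |radialGrad G W x k| ≤ ‖radialGrad G W x‖ :=
    (Real.norm_eq_abs _).symm.trans_le (PiLp.norm_apply_le (radialGrad G W x) k)
  calc _ ≤ mcFactor (δ • radial G x) ^ 2 * ‖radialGrad G W x‖ * (2 * ‖radialGrad G W x‖ + 2) := by
        gcongr
        exacts [abs_deriv_truncSq_le δ _, norm_dilationFlux_le x]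
    _ = 2 * (mcFactor (δ • radial G x) ^ 2 * ‖radialGrad G W x‖ ^ 2) +
        2 * (mcFactor (δ • radial G x) ^ 2 * ‖radialGrad G W x‖) := by ring
    _ ≤ 2 * ((δ ^ 2)⁻¹ * (1 + radial G x ^ 2)⁻¹ * ‖radialGrad G W x‖ ^ 2) +
        2 * (1 * ‖radialGrad G W x‖) := by
      gcongr
      exacts [mcFactor_smul_sq_le hδ hδ1 _, mcFactor_sq_le_one _]
    _ = _ := by ring

/-- The weak `k`-th partial derivative of the vector field `truncSq δ (x · ∇u) • dilationFlux`. -/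
noncomputable def truncFluxDeriv (G : EuclideanSpace ℝ (Fin n) → EuclideanSpace ℝ (Fin n))
    (W : Fin n → EuclideanSpace ℝ (Fin n) → EuclideanSpace ℝ (Fin n))
    (W₂ : Fin n → Fin n → EuclideanSpace ℝ (Fin n) → EuclideanSpace ℝ (Fin n)) (δ : ℝ)
    (k : Fin n) (x : EuclideanSpace ℝ (Fin n)) : EuclideanSpace ℝ (Fin n) :=
  (deriv (truncSq δ) (radial G x) * radialGrad G W x k) • dilationFlux G W x +
    truncSq δ (radial G x) • ∑ i, x i • fluxHessian G W W₂ i k x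

lemma weak_truncSq_smul_dilationFlux [NeZero n] (h : StableData f u G W W₂) (hδ : 0 < δ)
    (hδ1 : δ ≤ 1) (k : Fin n) :
    HasWeakDerivAlong (stdVec k) (fun x => truncSq δ (radial G x) • dilationFlux G W x)
      (truncFluxDeriv G W W₂ δ k) :=
  (h.weak_radial k).comp_smul_of_abs_le (h.weak_dilationFlux k)
    ((contDiff_truncSq δ).of_le (by simp)) (C := δ⁻¹) (D := 1) (abs_truncSq_le_inv hδ)
    (fun y => (abs_deriv_truncSq_le δ y).trans (mcFactor_sq_le_one _))
    ((h.locallyIntegrable_radialGrad_sq_div.smul (2 * (δ ^ 2)⁻¹)).add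
      ((locallyIntegrable_norm h.locallyIntegrable_radialGrad).smul (2 : ℝ)))
    (Eventually.of_forall fun x => abs_deriv_truncSq_mul_dilationFlux_le hδ hδ1 x k)

lemma divergence_dilationFlux_ae (h : StableData f u G W W₂) :
    ∀ᵐ x, ∑ k, (∑ i, x i • fluxHessian G W W₂ i k x) k = -(deriv f (u x) * radial G x) := by
  filter_upwards [h.fluxHessian_symm, ae_all_iff.2 h.deriv_equation_ae] with x hsymm hequation
  have hdiv (i : Fin n) : ∑ k, fluxHessian G W W₂ i k x k = -(deriv f (u x) * G x i) := by
    simp only [hsymm i, hequation i, neg_neg]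
  simp only [WithLp.ofLp_sum, Finset.sum_apply, PiLp.smul_apply, smul_eq_mul]
  rw [Finset.sum_comm, radial, euclidean_inner_eq_sum, Finset.mul_sum, ← Finset.sum_neg_distrib]
  refine Finset.sum_congr rfl fun i _ => ?_
  rw [← Finset.mul_sum, hdiv i]
  ring

lemma sum_truncFluxDeriv_ae (h : StableData f u G W W₂) (δ : ℝ) :
    ∀ᵐ x, ∑ k, truncFluxDeriv G W W₂ δ k x k =
      deriv (truncSq δ) (radial G x) * ⟪dilationFlux G W x, radialGrad G W x⟫_ℝ -
        deriv f (u x) * trunc δ (radial G x) ^ 2 := by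
  filter_upwards [h.divergence_dilationFlux_ae] with x hx
  calc ∑ k, truncFluxDeriv G W W₂ δ k x k
      = ∑ k, (deriv (truncSq δ) (radial G x) * (dilationFlux G W x k * radialGrad G W x k) +
          truncSq δ (radial G x) * (∑ i, x i • fluxHessian G W W₂ i k x) k) := by
        refine Finset.sum_congr rfl fun k _ => ?_
        rw [truncFluxDeriv, PiLp.add_apply, PiLp.smul_apply, PiLp.smul_apply, smul_eq_mul,
          smul_eq_mul]
        ring
    _ = deriv (truncSq δ) (radial G x) * ⟪dilationFlux G W x, radialGrad G W x⟫_ℝ +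
          truncSq δ (radial G x) * -(deriv f (u x) * radial G x) := by
        rw [Finset.sum_add_distrib, ← Finset.mul_sum, ← Finset.mul_sum, hx,
          euclidean_inner_eq_sum]
    _ = _ := by
        rw [← mul_truncSq]
        ring

lemma locallyIntegrable_deriv_mul_trunc_radial_sq [NeZero n] (h : StableData f u G W W₂)
    (hδ : 0 < δ) :
    LocallyIntegrable (fun x => deriv f (u x) * trunc δ (radial G x) ^ 2) volume := by
  have hmeas : AEStronglyMeasurable (fun x => trunc δ (radial G x)) volume :=
    (contDiff_trunc δ).continuous.comp_aestronglyMeasurable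
      h.locallyIntegrable_radial.aestronglyMeasurable
  refine (h.locallyIntegrable_deriv.smul (δ⁻¹ ^ 2)).mono
    (h.locallyIntegrable_deriv.aestronglyMeasurable.mul (hmeas.pow 2))
    (Eventually.of_forall fun x => ?_)
  calc ‖deriv f (u x) * trunc δ (radial G x) ^ 2‖
      = ‖trunc δ (radial G x)‖ ^ 2 * ‖deriv f (u x)‖ := by rw [norm_mul, norm_pow, mul_comm]
    _ ≤ δ⁻¹ ^ 2 * ‖deriv f (u x)‖ := by
      gcongr
      exact norm_trunc_le_inv hδ _
    _ = ‖δ⁻¹ ^ 2 * deriv f (u x)‖ := by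
      rw [norm_mul, norm_pow, Real.norm_of_nonneg (inv_nonneg.2 hδ.le)]

lemma integrable_deriv_mul_trunc_radial_sq [NeZero n] (h : StableData f u G W W₂) (hδ : 0 < δ)
    {η : EuclideanSpace ℝ (Fin n) → ℝ} (hη : Continuous η) (hs : HasCompactSupport η) :
    Integrable (fun x => deriv f (u x) * (trunc δ (radial G x) * η x) ^ 2) volume := by
  have hs2 : HasCompactSupport fun x => η x ^ 2 :=
    hs.comp_left (g := (· ^ 2)) (zero_pow two_ne_zero)
  have hintegrable : Integrable fun x => η x ^ 2 • (deriv f (u x) * trunc δ (radial G x) ^ 2) :=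
    (h.locallyIntegrable_deriv_mul_trunc_radial_sq
      hδ).integrable_smul_left_of_hasCompactSupport (hη.pow 2) hs2
  refine hintegrable.congr (Eventually.of_forall fun x => ?_)
  simp only [smul_eq_mul]
  ring

/-- The integrand obtained by testing the linearized equation for the radial derivative `x · ∇u`
with `truncSq δ (x · ∇u) η²`. -/
noncomputable def linearizedIntegrand (G : EuclideanSpace ℝ (Fin n) → EuclideanSpace ℝ (Fin n))
    (W : Fin n → EuclideanSpace ℝ (Fin n) → EuclideanSpace ℝ (Fin n)) (δ : ℝ)
    (η : EuclideanSpace ℝ (Fin n) → ℝ) (x : EuclideanSpace ℝ (Fin n)) : ℝ :=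
  η x ^ 2 * (deriv (truncSq δ) (radial G x) * ⟪dilationFlux G W x, radialGrad G W x⟫_ℝ) +
    2 * η x * truncSq δ (radial G x) * ⟪dilationFlux G W x, ∇ η x⟫_ℝ

lemma gradient_sq {η : EuclideanSpace ℝ (Fin n) → ℝ} {x : EuclideanSpace ℝ (Fin n)}
    (hη : DifferentiableAt ℝ η x) : ∇ (fun y => η y ^ 2) x = (2 * η x) • ∇ η x := by
  refine PiLp.ext fun i => ?_
  rw [PiLp.smul_apply, gradient_coord, gradient_coord, fderiv_fun_pow 2 hη]
  simp

lemma linearizedIntegrand_ae_eq (h : StableData f u G W W₂) (δ : ℝ)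
    {η : EuclideanSpace ℝ (Fin n) → ℝ} (hη : Differentiable ℝ η) :
    linearizedIntegrand G W δ η =ᵐ[volume] fun x =>
      ⟪truncSq δ (radial G x) • dilationFlux G W x, ∇ (fun y => η y ^ 2) x⟫_ℝ +
      (η x ^ 2 * ∑ k, truncFluxDeriv G W W₂ δ k x k +
        deriv f (u x) * (trunc δ (radial G x) * η x) ^ 2) := by
  filter_upwards [h.sum_truncFluxDeriv_ae δ] with x hx
  rw [hx, gradient_sq (hη x), real_inner_smul_left, real_inner_smul_right, linearizedIntegrand]
  ring

lemma integrable_linearizedIntegrand_and_integral_eq [NeZero n] (h : StableData f u G W W₂)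
    (hδ : 0 < δ) (hδ1 : δ ≤ 1) {η : EuclideanSpace ℝ (Fin n) → ℝ} (hη : ContDiff ℝ ∞ η)
    (hs : HasCompactSupport η) :
    Integrable (linearizedIntegrand G W δ η) volume ∧
      ∫ x, deriv f (u x) * (trunc δ (radial G x) * η x) ^ 2 =
        ∫ x, linearizedIntegrand G W δ η x := by
  have hflux := h.weak_truncSq_smul_dilationFlux hδ hδ1
  have hη2 : ContDiff ℝ ∞ fun x => η x ^ 2 := hη.pow 2
  have hs2 : HasCompactSupport fun x => η x ^ 2 :=
    hs.comp_left (g := (· ^ 2)) (zero_pow two_ne_zero)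
  have hsplit := h.linearizedIntegrand_ae_eq δ (hη.differentiable (by simp))
  have hgradient := integrable_inner_gradient
    (fun i => ((hflux 0).coord i).locallyIntegrable) hη2 hs2
  have hdivergence : Integrable (fun x => η x ^ 2 * ∑ k, truncFluxDeriv G W W₂ δ k x k) :=
    (locallyIntegrable_finsetSum Finset.univ fun k _ =>
    ((hflux k).coord k).locallyIntegrable_deriv).integrable_smul_left_of_hasCompactSupport
      hη2.continuous hs2
  have hpotential := h.integrable_deriv_mul_trunc_radial_sq hδ hη.continuous hs
  refine ⟨(hgradient.fun_add (hdivergence.fun_add hpotential)).congr hsplit.symm, ?_⟩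
  rw [integral_congr_ae hsplit, integral_add hgradient (hdivergence.fun_add hpotential),
    integral_add hdivergence hpotential, integral_inner_gradient (fun k => (hflux k).coord k)
    hη2 hs2]
  exact (neg_add_cancel_left _ _).symm

end StableData

section MollifySquare

variable {E : Type*} [NormedAddCommGroup E] [InnerProductSpace ℝ E] [FiniteDimensional ℝ E]
  [MeasurableSpace E] [BorelSpace E] {F : Type*} [NormedAddCommGroup F] [NormedSpace ℝ F]

lemma mollify_clm [CompleteSpace F] {F' : Type*} [NormedAddCommGroup F'] [NormedSpace ℝ F']
    [CompleteSpace F'] (L : F →L[ℝ] F') (k : ℕ) {g : E → F} (hg : LocallyIntegrable g volume)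
    (x : E) :
    mollify k (fun y => L (g y)) x = L (mollify k g x) := by
  have hintegrable : Integrable fun t => (mollifierBump E k).normed volume t • g (x - t) :=
    ((mollifierBump E k).hasCompactSupport_normed.convolutionExists_left (lsmul ℝ ℝ)
      (mollifierBump E k).continuous_normed hg x).integrable
  rw [mollify_apply, mollify_apply, ← L.integral_comp_comm hintegrable]
  simp only [map_smul]

lemma memLp_mollify (k : ℕ) {g : E → F} (hg : MemLp g 2 volume) :
    MemLp (mollify k g) 2 volume :=
  ⟨(contDiff_mollify k (hg.locallyIntegrable (by norm_num))).continuous.aestronglyMeasurable,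
    (eLpNorm_mollify_le k hg.1 (by norm_num) (by norm_num)).trans_lt hg.2⟩

lemma tendsto_integral_sq_mollify_sub [CompleteSpace F] {g : E → F} (hg : MemLp g 2 volume) :
    Tendsto (fun k => ∫ x, ‖mollify k g x - g x‖ ^ 2) atTop (𝓝 0) := by
  have hnorm := (ENNReal.tendsto_toReal ENNReal.zero_ne_top).comp
    (tendsto_eLpNorm_mollify_sub (by norm_num) (by norm_num) hg)
  rw [← zero_pow (M₀ := ℝ) two_ne_zero]
  refine (hnorm.pow 2).congr fun k => ?_
  have hmem : MemLp (mollify k g - g) 2 volume := (memLp_mollify k hg).sub hg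
  rw [Function.comp_apply, hmem.eLpNorm_eq_integral_rpow_norm (by norm_num) (by norm_num),
    ENNReal.toReal_ofReal (by positivity), ← Real.rpow_natCast,
    ← Real.rpow_mul (integral_nonneg fun x => by positivity)]
  simp

lemma tendsto_integral_mul_sq_mollify {g ξ : E → ℝ} (hg : LocallyIntegrable g volume)
    (hξ : LocallyIntegrable ξ volume) {C : ℝ} (hC : ∀ x, |ξ x| ≤ C) (hs : HasCompactSupport ξ) :
    Tendsto (fun k => ∫ x, g x * mollify k ξ x ^ 2) atTop (𝓝 (∫ x, g x * ξ x ^ 2)) := by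
  set K := cthickening 1 (tsupport ξ)
  have hK : IsCompact K := hs.isCompact.cthickening
  have hdominated : Integrable (K.indicator fun x => ‖g x‖ * C ^ 2) volume :=
    (integrable_indicator_iff hK.measurableSet).2
      ((hg.integrableOn_isCompact hK).norm.mul_const _)
  refine tendsto_integral_of_dominated_convergence _ (fun k => ?_) hdominated
    (fun k => Eventually.of_forall fun x => ?_) ?_
  · exact hg.aestronglyMeasurable.mul
      ((contDiff_mollify k hξ).continuous.pow 2).aestronglyMeasurable
  · by_cases hx : x ∈ K
    · rw [Set.indicator_of_mem hx, norm_mul, norm_pow]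
      gcongr
      exact norm_mollify_le_of_norm_le k hC x
    · have hzero : mollify k ξ x = 0 :=
        Function.notMem_support.1 fun hne => hx (support_mollify_subset k hne)
      rw [Set.indicator_of_notMem hx, hzero, zero_pow two_ne_zero, mul_zero, norm_zero]
  · filter_upwards [ae_tendsto_mollify hξ] with x hx
    exact (hx.pow 2).const_mul _

end MollifySquare

section QuadraticForm

variable {V : Type*} [NormedAddCommGroup V] [InnerProductSpace ℝ V]

lemma inner_mcDeriv_add_le_of_pos {ε : ℝ} (hε : 0 < ε) (p q r : V) :
    ⟪mcDeriv p (q + r), q + r⟫_ℝ ≤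
      (1 + ε) * ⟪mcDeriv p q, q⟫_ℝ + (1 + ε⁻¹) * ⟪mcDeriv p r, r⟫_ℝ := by
  have hnonneg := mul_nonneg (inv_nonneg.2 hε.le) (inner_mcDeriv_self_nonneg p (ε • q - r))
  have hsymm : ⟪mcDeriv p r, q⟫_ℝ = ⟪mcDeriv p q, r⟫_ℝ := by
    rw [inner_mcDeriv_comm, real_inner_comm]
  have hexpand : ε⁻¹ * ⟪mcDeriv p (ε • q - r), ε • q - r⟫_ℝ =
      ε * ⟪mcDeriv p q, q⟫_ℝ - 2 * ⟪mcDeriv p q, r⟫_ℝ + ε⁻¹ * ⟪mcDeriv p r, r⟫_ℝ := by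
    simp only [map_sub, map_smul, inner_sub_left, inner_sub_right, real_inner_smul_left,
      real_inner_smul_right, hsymm]
    field_simp
    ring
  simp only [map_add, inner_add_left, inner_add_right, hsymm]
  linarith

lemma integrable_inner_mcDeriv {α : Type*} [MeasurableSpace α] {μ : Measure α} {P N : α → V}
    (hP : AEStronglyMeasurable P μ) (hN : MemLp N 2 μ) :
    Integrable (fun x => ⟪mcDeriv (P x) (N x), N x⟫_ℝ) μ := by
  refine ((memLp_two_iff_integrable_sq_norm hN.1).1 hN).mono'
    ((aestronglyMeasurable_mcDeriv_apply hP hN.1).inner hN.1) (Eventually.of_forall fun x => ?_)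
  rw [Real.norm_of_nonneg (inner_mcDeriv_self_nonneg _ _)]
  exact inner_mcDeriv_self_le_sq _ _

end QuadraticForm

namespace StableData

variable {n : ℕ} {f : ℝ → ℝ} {u : EuclideanSpace ℝ (Fin n) → ℝ}
  {G : EuclideanSpace ℝ (Fin n) → EuclideanSpace ℝ (Fin n)}
  {W : Fin n → EuclideanSpace ℝ (Fin n) → EuclideanSpace ℝ (Fin n)}
  {W₂ : Fin n → Fin n → EuclideanSpace ℝ (Fin n) → EuclideanSpace ℝ (Fin n)}
  {ξ : EuclideanSpace ℝ (Fin n) → ℝ} {N : EuclideanSpace ℝ (Fin n) → EuclideanSpace ℝ (Fin n)}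

lemma stability_mollify_le [NeZero n] (h : StableData f u G W W₂)
    (hξ : ∀ i, HasWeakDerivAlong (stdVec i) ξ (fun x => N x i)) (hs : HasCompactSupport ξ)
    (hN : MemLp N 2 volume) {ε : ℝ} (hε : 0 < ε) (k : ℕ) :
    ∫ x, deriv f (u x) * mollify k ξ x ^ 2 ≤
      (1 + ε) * (∫ x, ⟪mcDeriv (G x) (N x), N x⟫_ℝ) +
        (1 + ε⁻¹) * ∫ x, ‖mollify k N x - N x‖ ^ 2 := by
  have hG := h.locallyIntegrable_G.aestronglyMeasurable
  have hgradient (x : EuclideanSpace ℝ (Fin n)) : ∇ (mollify k ξ) x = mollify k N x := by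
    refine PiLp.ext fun i => ?_
    rw [gradient_coord, (hξ i).fderiv_mollify]
    exact mollify_clm (EuclideanSpace.proj i) k (hN.locallyIntegrable (by norm_num)) x
  have herror : Integrable fun x => ‖mollify k N x - N x‖ ^ 2 :=
    (memLp_two_iff_integrable_sq_norm ((memLp_mollify k hN).sub hN).1).1
      ((memLp_mollify k hN).sub hN)
  have hform := integrable_inner_mcDeriv hG hN
  refine (h.stability _ (contDiff_mollify k (hξ 0).locallyIntegrable)
    (hasCompactSupport_mollify k hs)).trans ?_
  simp only [hgradient]
  rw [← integral_const_mul, ← integral_const_mul,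
    ← integral_add (hform.const_mul _) (herror.const_mul _)]
  refine integral_mono (integrable_inner_mcDeriv hG (memLp_mollify k hN))
    ((hform.const_mul _).fun_add (herror.const_mul _)) fun x => ?_
  calc ⟪mcDeriv (G x) (mollify k N x), mollify k N x⟫_ℝ
      ≤ (1 + ε) * ⟪mcDeriv (G x) (N x), N x⟫_ℝ + (1 + ε⁻¹) *
          ⟪mcDeriv (G x) (mollify k N x - N x), mollify k N x - N x⟫_ℝ := by
        simpa only [add_sub_cancel] using
          inner_mcDeriv_add_le_of_pos hε (G x) (N x) (mollify k N x - N x)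
    _ ≤ _ := by
        gcongr
        exact inner_mcDeriv_self_le_sq _ _

lemma stability_of_memLp [NeZero n] (h : StableData f u G W W₂)
    (hξ : ∀ i, HasWeakDerivAlong (stdVec i) ξ (fun x => N x i)) {C : ℝ} (hC : ∀ x, |ξ x| ≤ C)
    (hs : HasCompactSupport ξ) (hN : MemLp N 2 volume) :
    ∫ x, deriv f (u x) * ξ x ^ 2 ≤ ∫ x, ⟪mcDeriv (G x) (N x), N x⟫_ℝ := by
  set Q := ∫ x, ⟪mcDeriv (G x) (N x), N x⟫_ℝ
  have hle (ε : ℝ) (hε : 0 < ε) : ∫ x, deriv f (u x) * ξ x ^ 2 ≤ (1 + ε) * Q := by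
    have hright := ((tendsto_integral_sq_mollify_sub hN).const_mul (1 + ε⁻¹)).const_add
      ((1 + ε) * Q)
    rw [mul_zero, add_zero] at hright
    exact le_of_tendsto_of_tendsto'
      (tendsto_integral_mul_sq_mollify h.locallyIntegrable_deriv (hξ 0).locallyIntegrable hC hs)
      hright fun k => h.stability_mollify_le hξ hs hN hε k
  have hlim : Tendsto (fun ε : ℝ => (1 + ε) * Q) (𝓝[>] 0) (𝓝 Q) := by
    have hcont : Continuous fun ε : ℝ => (1 + ε) * Q := by fun_prop
    simpa using hcont.continuousWithinAt.tendsto (x := 0) (s := Set.Ioi 0)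
  exact ge_of_tendsto hlim (eventually_mem_nhdsWithin.mono hle)

/-- The weak gradient of `trunc δ (x · ∇u) η`. -/
noncomputable def truncRadialGrad (G : EuclideanSpace ℝ (Fin n) → EuclideanSpace ℝ (Fin n))
    (W : Fin n → EuclideanSpace ℝ (Fin n) → EuclideanSpace ℝ (Fin n)) (δ : ℝ)
    (η : EuclideanSpace ℝ (Fin n) → ℝ) (x : EuclideanSpace ℝ (Fin n)) :
    EuclideanSpace ℝ (Fin n) :=
  (mcFactor (δ • radial G x) ^ 3 * η x) • radialGrad G W x + trunc δ (radial G x) • ∇ η x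

variable {δ : ℝ} {η : EuclideanSpace ℝ (Fin n) → ℝ}

lemma weak_trunc_radial_mul (h : StableData f u G W W₂) (hδ : δ ≠ 0) (hη : ContDiff ℝ ∞ η)
    (i : Fin n) :
    HasWeakDerivAlong (stdVec i) (fun x => trunc δ (radial G x) * η x)
      (fun x => truncRadialGrad G W δ η x i) := by
  have htrunc := (h.weak_radial i).comp_of_norm_fderiv_le (Φ := trunc δ)
    ((contDiff_trunc δ).of_le (by simp)) (C := 2)
    (fun y => by rw [(hasFDerivAt_trunc hδ y).fderiv]; exact norm_mcDeriv_le _)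
  refine (htrunc.smooth_smul hη).congr (Eventually.of_forall fun x => mul_comm _ _)
    (Eventually.of_forall fun x => ?_)
  simp only [truncRadialGrad, PiLp.add_apply, PiLp.smul_apply, smul_eq_mul, gradient_coord,
    fderiv_trunc_apply hδ]
  ring

lemma norm_truncRadialGrad_sq_le (hδ : 0 < δ) (hδ1 : δ ≤ 1) (x : EuclideanSpace ℝ (Fin n)) :
    ‖truncRadialGrad G W δ η x‖ ^ 2 ≤
      η x ^ 2 * (2 * (δ ^ 2)⁻¹ * (‖radialGrad G W x‖ ^ 2 / (1 + radial G x ^ 2))) +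
        2 * (δ ^ 2)⁻¹ * ‖∇ η x‖ ^ 2 := by
  have hradial : ‖(mcFactor (δ • radial G x) ^ 3 * η x) • radialGrad G W x‖ ^ 2 ≤
      η x ^ 2 * ((δ ^ 2)⁻¹ * (‖radialGrad G W x‖ ^ 2 / (1 + radial G x ^ 2))) :=
    calc _ = mcFactor (δ • radial G x) ^ 6 * η x ^ 2 * ‖radialGrad G W x‖ ^ 2 := by
          rw [norm_smul, mul_pow, Real.norm_eq_abs, sq_abs]
          ring
      _ ≤ (δ ^ 2)⁻¹ * (1 + radial G x ^ 2)⁻¹ * η x ^ 2 * ‖radialGrad G W x‖ ^ 2 := by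
          gcongr
          exact (pow_le_pow_of_le_one (mcFactor_pos _).le (mcFactor_le_one _)
            (by norm_num)).trans (mcFactor_smul_sq_le hδ hδ1 _)
      _ = _ := by ring
  have hcutoff : ‖trunc δ (radial G x) • ∇ η x‖ ^ 2 ≤ (δ ^ 2)⁻¹ * ‖∇ η x‖ ^ 2 := by
    rw [norm_smul, mul_pow, ← inv_pow]
    gcongr
    exact norm_trunc_le_inv hδ _
  calc ‖truncRadialGrad G W δ η x‖ ^ 2
      ≤ (‖(mcFactor (δ • radial G x) ^ 3 * η x) • radialGrad G W x‖ +
          ‖trunc δ (radial G x) • ∇ η x‖) ^ 2 := by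
        gcongr
        exact norm_add_le _ _
    _ ≤ 2 * (‖(mcFactor (δ • radial G x) ^ 3 * η x) • radialGrad G W x‖ ^ 2 +
          ‖trunc δ (radial G x) • ∇ η x‖ ^ 2) := add_sq_le
    _ ≤ _ := by linarith

lemma aestronglyMeasurable_truncRadialGrad [NeZero n] (h : StableData f u G W W₂)
    (hη : ContDiff ℝ ∞ η) : AEStronglyMeasurable (truncRadialGrad G W δ η) volume := by
  have hradial : AEStronglyMeasurable (radial G) volume :=
    h.locallyIntegrable_radial.aestronglyMeasurable
  have hfactor : AEStronglyMeasurable (fun x => mcFactor (δ • radial G x) ^ 3) volume :=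
    (contDiff_mcFactor.continuous.comp_aestronglyMeasurable (hradial.const_smul δ)).pow 3
  have htrunc : AEStronglyMeasurable (fun x => trunc δ (radial G x)) volume :=
    (contDiff_trunc δ).continuous.comp_aestronglyMeasurable hradial
  exact ((hfactor.mul hη.continuous.aestronglyMeasurable).smul
    h.locallyIntegrable_radialGrad.aestronglyMeasurable).add
    (htrunc.smul (continuous_gradient hη).aestronglyMeasurable)

lemma memLp_truncRadialGrad [NeZero n] (h : StableData f u G W W₂) (hδ : 0 < δ) (hδ1 : δ ≤ 1)
    (hη : ContDiff ℝ ∞ η) (hs : HasCompactSupport η) :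
    MemLp (truncRadialGrad G W δ η) 2 volume := by
  have hmeas := h.aestronglyMeasurable_truncRadialGrad (δ := δ) hη
  have hs2 : HasCompactSupport fun x => η x ^ 2 :=
    hs.comp_left (g := (· ^ 2)) (zero_pow two_ne_zero)
  have hgs2 : HasCompactSupport fun x => ‖∇ η x‖ ^ 2 :=
    (hasCompactSupport_gradient hs).comp_left (g := fun v => ‖v‖ ^ 2) (by simp)
  have hgradient : Integrable (fun x => ‖∇ η x‖ ^ 2) volume :=
    ((continuous_gradient hη).norm.pow 2).integrable_of_hasCompactSupport hgs2
  have hradialGrad : Integrable (fun x => η x ^ 2 *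
      (2 * (δ ^ 2)⁻¹ * (‖radialGrad G W x‖ ^ 2 / (1 + radial G x ^ 2)))) volume :=
    (h.locallyIntegrable_radialGrad_sq_div.smul
      (2 * (δ ^ 2)⁻¹)).integrable_smul_left_of_hasCompactSupport (hη.continuous.pow 2) hs2
  rw [memLp_two_iff_integrable_sq_norm hmeas]
  refine (hradialGrad.add (hgradient.const_mul (2 * (δ ^ 2)⁻¹))).mono' (hmeas.norm.pow 2)
    (Eventually.of_forall fun x => ?_)
  rw [norm_pow, norm_norm]
  exact norm_truncRadialGrad_sq_le hδ hδ1 x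

lemma stability_trunc_radial [NeZero n] (h : StableData f u G W W₂) (hδ : 0 < δ) (hδ1 : δ ≤ 1)
    (hη : ContDiff ℝ ∞ η) (hs : HasCompactSupport η) :
    ∫ x, deriv f (u x) * (trunc δ (radial G x) * η x) ^ 2 ≤
      ∫ x, ⟪mcDeriv (G x) (truncRadialGrad G W δ η x), truncRadialGrad G W δ η x⟫_ℝ := by
  obtain ⟨C, hC⟩ := hη.continuous.bounded_above_of_compact_support hs
  refine h.stability_of_memLp (h.weak_trunc_radial_mul hδ.ne' hη) (C := δ⁻¹ * C) (fun x => ?_)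
    hs.mul_left (h.memLp_truncRadialGrad hδ hδ1 hη hs)
  rw [← Real.norm_eq_abs, norm_mul]
  exact mul_le_mul (norm_trunc_le_inv hδ _) (hC x) (norm_nonneg _) (inv_nonneg.2 hδ.le)

end StableData

lemma abs_truncation_polynomial_le {a b c d e t : ℝ} (ha : 0 ≤ a) (hc : 0 ≤ c)
    (hb : 2 * |b| ≤ a + c) (ht : 0 ≤ t) (ht1 : t ≤ 1) :
    |t * (1 - t) ^ 2 * a + 2 * (t ^ 2 - t) * b + t * c + (2 * t ^ 2 - t) * d + t * e| ≤
      2 * (a + c) + |d| + |e| := by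
  have hta : |t * (1 - t) ^ 2 * a| ≤ a := by
    rw [abs_of_nonneg (by positivity)]
    exact mul_le_of_le_one_left ha
      (mul_le_one₀ ht1 (sq_nonneg _) (pow_le_one₀ (sub_nonneg.2 ht1) (sub_le_self 1 ht)))
  have htb : |2 * (t ^ 2 - t) * b| ≤ a + c := by
    have hcoeff : |t ^ 2 - t| ≤ 1 := by
      rw [abs_le]
      constructor <;> nlinarith
    rw [abs_mul, abs_mul, abs_two]
    nlinarith [mul_le_mul_of_nonneg_right hcoeff (abs_nonneg b)]
  have htc : |t * c| ≤ c := by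
    rw [abs_of_nonneg (by positivity)]
    exact mul_le_of_le_one_left hc ht1
  have htd : |(2 * t ^ 2 - t) * d| ≤ |d| := by
    have hcoeff : |2 * t ^ 2 - t| ≤ 1 := by
      rw [abs_le]
      constructor <;> nlinarith
    rw [abs_mul]
    exact mul_le_of_le_one_left (abs_nonneg d) hcoeff
  have hte : |t * e| ≤ |e| := by
    rw [abs_mul, abs_of_nonneg ht]
    exact mul_le_of_le_one_left (abs_nonneg e) ht1
  calc _ ≤ |t * (1 - t) ^ 2 * a| + |2 * (t ^ 2 - t) * b| + |t * c| + |(2 * t ^ 2 - t) * d| +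
        |t * e| := by
        refine (abs_add_le _ _).trans (add_le_add_left ?_ _)
        refine (abs_add_le _ _).trans (add_le_add_left ?_ _)
        exact abs_add_three _ _ _
    _ ≤ _ := by linarith

namespace StableData

variable {n : ℕ} {f : ℝ → ℝ} {u : EuclideanSpace ℝ (Fin n) → ℝ}
  {G : EuclideanSpace ℝ (Fin n) → EuclideanSpace ℝ (Fin n)}
  {W : Fin n → EuclideanSpace ℝ (Fin n) → EuclideanSpace ℝ (Fin n)}
  {W₂ : Fin n → Fin n → EuclideanSpace ℝ (Fin n) → EuclideanSpace ℝ (Fin n)}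
  {η : EuclideanSpace ℝ (Fin n) → ℝ}

lemma radial_sq_le (G : EuclideanSpace ℝ (Fin n) → EuclideanSpace ℝ (Fin n))
    (x : EuclideanSpace ℝ (Fin n)) : radial G x ^ 2 ≤ ‖x‖ ^ 2 * ‖G x‖ ^ 2 := by
  rw [← mul_pow]
  exact sq_le_sq.2 ((abs_real_inner_le_norm x (G x)).trans (le_abs_self _))

lemma radial_sq_mul_inner_le (x v : EuclideanSpace ℝ (Fin n)) :
    radial G x ^ 2 * ⟪mcDeriv (G x) v, v⟫_ℝ ≤ ‖x‖ ^ 2 * ‖v‖ ^ 2 * ‖G x‖ :=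
  calc _ ≤ ‖x‖ ^ 2 * ‖G x‖ ^ 2 * (mcFactor (G x) * ‖v‖ ^ 2) :=
        mul_le_mul (radial_sq_le G x) (inner_mcDeriv_self_le (G x) v)
          (inner_mcDeriv_self_nonneg _ _) (by positivity)
    _ = ‖x‖ ^ 2 * ‖v‖ ^ 2 * ‖G x‖ * (mcFactor (G x) * ‖G x‖) := by ring
    _ ≤ ‖x‖ ^ 2 * ‖v‖ ^ 2 * ‖G x‖ * 1 :=
        mul_le_mul_of_nonneg_left (mcFactor_mul_norm_le_one _) (by positivity)
    _ = _ := mul_one _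

/-- The integrand of the stability inequality tested with `trunc δ (x · ∇u) η`, after subtraction
of the linearized equation. The truncation enters only through `t = 1 / (1 + δ² (x · ∇u)²)`, and
`t = 1` is the case without truncation. -/
noncomputable def truncatedIntegrand (G : EuclideanSpace ℝ (Fin n) → EuclideanSpace ℝ (Fin n))
    (W : Fin n → EuclideanSpace ℝ (Fin n) → EuclideanSpace ℝ (Fin n))
    (η : EuclideanSpace ℝ (Fin n) → ℝ) (t : ℝ) (x : EuclideanSpace ℝ (Fin n)) : ℝ :=
  t * (1 - t) ^ 2 * (η x ^ 2 * ⟪mcDeriv (G x) (radialGrad G W x), radialGrad G W x⟫_ℝ) +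
    2 * (t ^ 2 - t) * (η x * radial G x * ⟪mcDeriv (G x) (radialGrad G W x), ∇ η x⟫_ℝ) +
    t * (radial G x ^ 2 * ⟪mcDeriv (G x) (∇ η x), ∇ η x⟫_ℝ) +
    (2 * t ^ 2 - t) * (η x ^ 2 * (fluxFactor (G x) * ⟪G x, radialGrad G W x⟫_ℝ)) +
    t * (2 * η x * radial G x * (fluxFactor (G x) * ⟪G x, ∇ η x⟫_ℝ))

lemma truncatedIntegrand_mcFactor_sq (δ : ℝ) (x : EuclideanSpace ℝ (Fin n)) :
    truncatedIntegrand G W η (mcFactor (δ • radial G x) ^ 2) x =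
      ⟪mcDeriv (G x) (truncRadialGrad G W δ η x), truncRadialGrad G W δ η x⟫_ℝ -
        linearizedIntegrand G W δ η x := by
  have hsymm : ⟪mcDeriv (G x) (∇ η x), radialGrad G W x⟫_ℝ =
      ⟪mcDeriv (G x) (radialGrad G W x), ∇ η x⟫_ℝ := by
    rw [inner_mcDeriv_comm, real_inner_comm]
  simp only [truncatedIntegrand, linearizedIntegrand, truncRadialGrad, deriv_truncSq,
    dilationFlux_eq, truncSq, trunc_eq_mul, map_add, map_smul, inner_add_left, inner_add_right,
    inner_sub_left, real_inner_smul_left, real_inner_smul_right, hsymm]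
  ring

lemma integral_truncatedIntegrand_nonneg [NeZero n] (h : StableData f u G W W₂) {δ : ℝ}
    (hδ : 0 < δ) (hδ1 : δ ≤ 1) (hη : ContDiff ℝ ∞ η) (hs : HasCompactSupport η) :
    Integrable (fun x => truncatedIntegrand G W η (mcFactor (δ • radial G x) ^ 2) x) volume ∧
      0 ≤ ∫ x, truncatedIntegrand G W η (mcFactor (δ • radial G x) ^ 2) x := by
  obtain ⟨hlinearized, hequation⟩ :=
    h.integrable_linearizedIntegrand_and_integral_eq hδ hδ1 hη hs
  have hform := integrable_inner_mcDeriv h.locallyIntegrable_G.aestronglyMeasurable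
    (h.memLp_truncRadialGrad hδ hδ1 hη hs)
  simp only [truncatedIntegrand_mcFactor_sq]
  refine ⟨hform.sub hlinearized, ?_⟩
  rw [integral_sub hform hlinearized, sub_nonneg, ← hequation]
  exact h.stability_trunc_radial hδ hδ1 hη hs

lemma abs_truncatedIntegrand_le {t : ℝ} (ht : 0 ≤ t) (ht1 : t ≤ 1)
    (x : EuclideanSpace ℝ (Fin n)) :
    |truncatedIntegrand G W η t x| ≤
      η x ^ 2 * (2 * ⟪mcDeriv (G x) (radialGrad G W x), radialGrad G W x⟫_ℝ +
        2 * ‖radialGrad G W x‖) +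
      (2 * ‖x‖ ^ 2 * ‖∇ η x‖ ^ 2 + 4 * |η x| * ‖x‖ * ‖∇ η x‖) * ‖G x‖ := by
  have hmixed := two_mul_abs_inner_mcDeriv_le (G x) (η x • radialGrad G W x) (radial G x • ∇ η x)
  simp only [map_smul, real_inner_smul_left, real_inner_smul_right] at hmixed
  have hradialGrad :
      |η x ^ 2 * (fluxFactor (G x) * ⟪G x, radialGrad G W x⟫_ℝ)| ≤
        η x ^ 2 * (2 * ‖radialGrad G W x‖) := by
    rw [abs_mul, abs_of_nonneg (sq_nonneg (η x))]
    gcongr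
    exact abs_fluxFactor_mul_inner_le _ _
  have hcutoff : |2 * η x * radial G x * (fluxFactor (G x) * ⟪G x, ∇ η x⟫_ℝ)| ≤
      2 * |η x| * (‖x‖ * ‖G x‖) * (2 * ‖∇ η x‖) := by
    rw [abs_mul, abs_mul, abs_mul 2, abs_two]
    gcongr
    exacts [abs_real_inner_le_norm x (G x), abs_fluxFactor_mul_inner_le _ _]
  refine (abs_truncation_polynomial_le
    (mul_nonneg (sq_nonneg (η x)) (inner_mcDeriv_self_nonneg (G x) (radialGrad G W x)))
    (mul_nonneg (sq_nonneg (radial G x)) (inner_mcDeriv_self_nonneg (G x) (∇ η x)))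
    ?_ ht ht1).trans ?_
  · rw [mul_comm (η x), mul_assoc]
    exact hmixed.trans_eq (by ring)
  · linarith [radial_sq_mul_inner_le (G := G) x (∇ η x)]

lemma exists_integrable_bound_truncatedIntegrand [NeZero n] (h : StableData f u G W W₂)
    (hη : ContDiff ℝ ∞ η) (hs : HasCompactSupport η) :
    ∃ B, Integrable B volume ∧
      ∀ t, 0 ≤ t → t ≤ 1 → ∀ x, ‖truncatedIntegrand G W η t x‖ ≤ B x := by
  have hηc := hη.continuous
  have hgradient := continuous_gradient hη
  have hs2 : HasCompactSupport fun x => η x ^ 2 :=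
    hs.comp_left (g := (· ^ 2)) (zero_pow two_ne_zero)
  have hcutoff : HasCompactSupport
      fun x => 2 * ‖x‖ ^ 2 * ‖∇ η x‖ ^ 2 + 4 * |η x| * ‖x‖ * ‖∇ η x‖ :=
    (hasCompactSupport_gradient hs).mono fun x hx => by
      contrapose! hx
      simp [Function.notMem_support.1 hx]
  have hradialGrad : Integrable (fun x => η x ^ 2 *
      (2 * ⟪mcDeriv (G x) (radialGrad G W x), radialGrad G W x⟫_ℝ + 2 * ‖radialGrad G W x‖))
      volume :=
    ((h.locallyIntegrable_inner_radialGrad.smul (2 : ℝ)).add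
      ((locallyIntegrable_norm h.locallyIntegrable_radialGrad).smul
        (2 : ℝ))).integrable_smul_left_of_hasCompactSupport (hηc.pow 2) hs2
  have hG : Integrable (fun x =>
      (2 * ‖x‖ ^ 2 * ‖∇ η x‖ ^ 2 + 4 * |η x| * ‖x‖ * ‖∇ η x‖) * ‖G x‖) volume :=
    (locallyIntegrable_norm h.locallyIntegrable_G).integrable_smul_left_of_hasCompactSupport
      (by fun_prop) hcutoff
  exact ⟨_, hradialGrad.add hG, fun t ht ht1 x => abs_truncatedIntegrand_le ht ht1 x⟩

lemma integral_truncatedIntegrand_one_nonneg [NeZero n] (h : StableData f u G W W₂)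
    (hη : ContDiff ℝ ∞ η) (hs : HasCompactSupport η) :
    Integrable (truncatedIntegrand G W η 1) volume ∧
      0 ≤ ∫ x, truncatedIntegrand G W η 1 x := by
  set δ : ℕ → ℝ := fun k => 1 / ((k : ℝ) + 1)
  set t : ℕ → EuclideanSpace ℝ (Fin n) → ℝ := fun k x => mcFactor (δ k • radial G x) ^ 2
  have hδ1 (k : ℕ) : δ k ≤ 1 := by
    rw [div_le_one (by positivity)]
    exact le_add_of_nonneg_left k.cast_nonneg
  have htrunc (k : ℕ) :=
    h.integral_truncatedIntegrand_nonneg (Nat.one_div_pos_of_nat (n := k)) (hδ1 k) hη hs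
  obtain ⟨B, hB, hle⟩ := h.exists_integrable_bound_truncatedIntegrand hη hs
  have hbound (k : ℕ) (x : EuclideanSpace ℝ (Fin n)) :
      ‖truncatedIntegrand G W η (t k x) x‖ ≤ B x :=
    hle _ (sq_nonneg _) (mcFactor_sq_le_one _) x
  have hpointwise (x : EuclideanSpace ℝ (Fin n)) :
      Tendsto (fun k => truncatedIntegrand G W η (t k x) x) atTop
        (𝓝 (truncatedIntegrand G W η 1 x)) := by
    have hcont : Continuous fun t => truncatedIntegrand G W η t x := by
      unfold truncatedIntegrand
      fun_prop
    have ht : Tendsto (fun k => t k x) atTop (𝓝 1) := by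
      have hfactor :=
        (tendsto_mcFactor_smul tendsto_one_div_add_atTop_nhds_zero_nat (radial G x)).pow 2
      rwa [one_pow] at hfactor
    exact (hcont.tendsto 1).comp ht
  have hmeas (k : ℕ) := (htrunc k).1.aestronglyMeasurable
  have hlim := tendsto_integral_of_dominated_convergence B hmeas hB
    (fun k => Eventually.of_forall (hbound k)) (Eventually.of_forall hpointwise)
  exact ⟨hB.mono' (aestronglyMeasurable_of_tendsto_ae atTop hmeas (Eventually.of_forall hpointwise))
    (Eventually.of_forall fun x => hle 1 zero_le_one le_rfl x),
    ge_of_tendsto' hlim fun k => (htrunc k).2⟩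

lemma weak_pohozaev (h : StableData f u G W W₂) (i : Fin n) :
    HasWeakDerivAlong (stdVec i) (fun x => pohozaev (G x))
      (fun x => fluxFactor (G x) * ⟪G x, W i x⟫_ℝ) := by
  have hsmooth : ContDiff ℝ 1 (pohozaev : EuclideanSpace ℝ (Fin n) → ℝ) :=
    (contDiff_mcFactor.mul (contDiff_norm_sq ℝ)).of_le (by simp)
  simpa only [fderiv_pohozaev] using
    (h.weak_G i).comp_of_norm_fderiv_le hsmooth norm_fderiv_pohozaev_le

lemma weak_pohozaev_smul (h : StableData f u G W W₂) (i : Fin n) :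
    HasWeakDerivAlong (stdVec i) (fun x => (pohozaev (G x) • x) i)
      (fun x => pohozaev (G x) + x i * (fluxFactor (G x) * ⟪G x, W i x⟫_ℝ)) := by
  refine ((h.weak_pohozaev i).smooth_smul (contDiff_coord i)).congr
    (Eventually.of_forall fun x => mul_comm _ _) (Eventually.of_forall fun x => ?_)
  simp [fderiv_coord]

lemma sum_pohozaev_divergence (x : EuclideanSpace ℝ (Fin n)) :
    ∑ i, (pohozaev (G x) + x i * (fluxFactor (G x) * ⟪G x, W i x⟫_ℝ)) =
      n * pohozaev (G x) + fluxFactor (G x) * ⟪G x, dilationDeriv W x⟫_ℝ := by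
  rw [Finset.sum_add_distrib, dilationDeriv, inner_sum, Finset.mul_sum, Finset.sum_const,
    Finset.card_univ, Fintype.card_fin, nsmul_eq_mul]
  congr 1
  refine Finset.sum_congr rfl fun i _ => ?_
  rw [real_inner_smul_right]
  ring

/-- The integrand of the inequality that results from the stability of `u` under the dilations of
`ℝⁿ`; it only involves first derivatives of `u`. -/
noncomputable def stabilityDensity (G : EuclideanSpace ℝ (Fin n) → EuclideanSpace ℝ (Fin n))
    (η : EuclideanSpace ℝ (Fin n) → ℝ) (x : EuclideanSpace ℝ (Fin n)) : ℝ :=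
  radial G x ^ 2 * ⟪mcDeriv (G x) (∇ η x), ∇ η x⟫_ℝ + η x ^ 2 * (fluxFactor (G x) * ‖G x‖ ^ 2) +
    2 * η x * radial G x * (fluxFactor (G x) * ⟪G x, ∇ η x⟫_ℝ) -
    pohozaev (G x) * (n * η x ^ 2 + 2 * η x * ⟪x, ∇ η x⟫_ℝ)

lemma stabilityDensity_eq {x : EuclideanSpace ℝ (Fin n)} (hη : DifferentiableAt ℝ η x) :
    stabilityDensity G η x = truncatedIntegrand G W η 1 x -
      (⟪pohozaev (G x) • x, ∇ (fun y => η y ^ 2) x⟫_ℝ +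
        η x ^ 2 * ∑ i, (pohozaev (G x) + x i * (fluxFactor (G x) * ⟪G x, W i x⟫_ℝ))) := by
  have hradialGrad : ⟪G x, radialGrad G W x⟫_ℝ = ‖G x‖ ^ 2 + ⟪G x, dilationDeriv W x⟫_ℝ := by
    rw [radialGrad, inner_add_right, real_inner_self_eq_norm_sq]
  rw [stabilityDensity, truncatedIntegrand, sum_pohozaev_divergence, gradient_sq hη, hradialGrad,
    real_inner_smul_left, real_inner_smul_right]
  ring

lemma integral_stabilityDensity_nonneg [NeZero n] (h : StableData f u G W W₂)
    (hη : ContDiff ℝ ∞ η) (hs : HasCompactSupport η) :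
    Integrable (stabilityDensity G η) volume ∧ 0 ≤ ∫ x, stabilityDensity G η x := by
  have hη2 : ContDiff ℝ ∞ fun x => η x ^ 2 := hη.pow 2
  have hs2 : HasCompactSupport fun x => η x ^ 2 :=
    hs.comp_left (g := (· ^ 2)) (zero_pow two_ne_zero)
  obtain ⟨hstability, hnonneg⟩ := h.integral_truncatedIntegrand_one_nonneg hη hs
  have hgradient := integrable_inner_gradient
    (fun i => (h.weak_pohozaev_smul i).locallyIntegrable) hη2 hs2
  have hdivergence : Integrable (fun x => η x ^ 2 *
      ∑ i, (pohozaev (G x) + x i * (fluxFactor (G x) * ⟪G x, W i x⟫_ℝ))) volume :=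
    (locallyIntegrable_finsetSum Finset.univ fun i _ =>
      (h.weak_pohozaev_smul i).locallyIntegrable_deriv).integrable_smul_left_of_hasCompactSupport
        hη2.continuous hs2
  have hpohozaev := hgradient.fun_add hdivergence
  have hsplit : stabilityDensity G η = fun x => truncatedIntegrand G W η 1 x - _ :=
    funext fun x => stabilityDensity_eq (W := W) (hη.differentiable (by simp) x)
  rw [hsplit]
  refine ⟨hstability.sub hpohozaev, ?_⟩
  rwa [integral_sub hstability hpohozaev, integral_add hgradient hdivergence,
    integral_inner_gradient h.weak_pohozaev_smul hη2 hs2, neg_add_cancel, sub_zero]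

end StableData

/-- The exponent `b` for which `(1 + |x|²)^(-b/2)`, multiplied by a cutoff function, is the
optimal test function `η` in dimension `n`. -/
noncomputable def testDecay (n : ℕ) : ℝ := if n ≤ 10 then ((n : ℝ) - 2) / 2 else 1 + √((n : ℝ) - 1)

lemma testDecay_nonneg {n : ℕ} (hn : 2 ≤ n) : 0 ≤ testDecay n := by
  have hn' : (2 : ℝ) ≤ n := by exact_mod_cast hn
  unfold testDecay
  split_ifs
  · linarith
  · positivity

lemma two_mul_liouvilleExponent (n : ℕ) : 2 * liouvilleExponent n = 2 * testDecay n - n := by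
  unfold liouvilleExponent testDecay
  split_ifs <;> ring

lemma liouvilleExponent_nonpos (n : ℕ) : liouvilleExponent n ≤ 0 := by
  unfold liouvilleExponent
  split_ifs with h
  · norm_num
  · have hn : (11 : ℝ) ≤ n := by exact_mod_cast not_le.1 h
    have hsqrt : √((n : ℝ) - 1) ≤ (n : ℝ) / 2 - 1 := by
      rw [Real.sqrt_le_left (by linarith)]
      nlinarith
    linarith

/-- The leading coefficient of minus the stability density at infinity, for a test function that
decays like `|x|^(-b)` in dimension `m`; here `θ` is the squared cosine of the angle between `x`
and `∇u(x)`, and `t = 1 / (1 + |∇u|²)`. -/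
def decayBracket (m b θ t : ℝ) : ℝ :=
  (m - 1 - t) - 2 * b + 2 * b * (1 + t) * θ - b ^ 2 * θ * (1 - θ * (1 - t))

section DecayBracket

variable {b θ t : ℝ}

lemma decayBracket_eq (m b θ t : ℝ) :
    decayBracket m b θ t = t * ((m - 2 - 2 * b) + θ * (4 * b - b ^ 2)) +
      (1 - t) * ((m - 1 - 2 * b) + (2 * b - b ^ 2) * θ + b ^ 2 * θ ^ 2) := by
  unfold decayBracket
  ring

lemma decayBracket_nonneg_of_le_four (hb0 : 0 ≤ b) (hb4 : b ≤ 4) (hθ : 0 ≤ θ) (ht0 : 0 ≤ t)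
    (ht1 : t ≤ 1) : 0 ≤ decayBracket (2 * b + 2) b θ t := by
  have hform : decayBracket (2 * b + 2) b θ t = t * (θ * (b * (4 - b))) +
      (1 - t) * ((b * θ + (2 - b) / 2) ^ 2 + b * (4 - b) / 4) := by
    rw [decayBracket_eq]
    ring
  rw [← sub_nonneg] at hb4 ht1
  rw [hform]
  positivity

lemma decayBracket_nonneg_of_four_le (hb4 : 4 ≤ b) (hθ1 : θ ≤ 1) (ht0 : 0 ≤ t)
    (ht1 : t ≤ 1) : 0 ≤ decayBracket ((b - 1) ^ 2 + 1) b θ t := by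
  have hform : decayBracket ((b - 1) ^ 2 + 1) b θ t = t * ((1 - θ) * (b * (b - 4))) +
      (1 - t) * ((b * θ + (2 - b) / 2) ^ 2 + 3 / 4 * (b * (b - 4))) := by
    rw [decayBracket_eq]
    ring
  have hb0 : 0 ≤ b := by linarith
  rw [← sub_nonneg] at hb4 hθ1 ht1
  rw [hform]
  positivity

lemma decayBracket_testDecay_nonneg {n : ℕ} (hn : 2 ≤ n) (hθ0 : 0 ≤ θ) (hθ1 : θ ≤ 1)
    (ht0 : 0 ≤ t) (ht1 : t ≤ 1) : 0 ≤ decayBracket n (testDecay n) θ t := by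
  by_cases h : n ≤ 10
  · have hdim : (n : ℝ) = 2 * testDecay n + 2 := by
      rw [testDecay, if_pos h]
      ring
    have hn10 : (n : ℝ) ≤ 10 := by exact_mod_cast h
    nth_rw 1 [hdim]
    exact decayBracket_nonneg_of_le_four (testDecay_nonneg hn) (by linarith) hθ0 ht0 ht1
  · have hn11 : (11 : ℝ) ≤ n := by exact_mod_cast not_le.1 h
    have hdim : (n : ℝ) = (testDecay n - 1) ^ 2 + 1 := by
      rw [testDecay, if_neg h, add_sub_cancel_left, Real.sq_sqrt (by linarith)]
      ring
    have hsqrt : (3 : ℝ) ≤ √((n : ℝ) - 1) := Real.le_sqrt_of_sq_le (by linarith)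
    nth_rw 1 [hdim]
    exact decayBracket_nonneg_of_four_le (by rw [testDecay, if_neg h]; linarith) hθ1 ht0 ht1

lemma le_decayBracket_mul {m s : ℝ} (hs0 : 0 ≤ s) (hs1 : s ≤ 1) (hθ0 : 0 ≤ θ) (hθ1 : θ ≤ 1)
    (ht0 : 0 ≤ t) (ht1 : t ≤ 1) (h : 0 ≤ decayBracket m b θ t) :
    (1 - s) * (m - 1 - t) ≤ decayBracket m (b * s) θ t := by
  have hcos : 0 ≤ 1 - θ * (1 - t) :=
    sub_nonneg.2 (mul_le_one₀ hθ1 (sub_nonneg.2 ht1) (sub_le_self 1 ht0))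
  rw [← sub_nonneg] at hs1
  have hconvex : decayBracket m (b * s) θ t = (1 - s) * (m - 1 - t) + s * decayBracket m b θ t +
      b ^ 2 * (s * (1 - s)) * (θ * (1 - θ * (1 - t))) := by
    unfold decayBracket
    ring
  rw [hconvex, add_assoc]
  exact le_add_of_nonneg_right (by positivity)

end DecayBracket

lemma testDecay_form_le {n : ℕ} (hn : 2 ≤ n) {r p w t : ℝ} (hr : 0 ≤ r) (hp : 0 ≤ p)
    (hw : w ^ 2 ≤ r * p) (ht0 : 0 ≤ t) (ht : t * (1 + p) = 1) :
    (n - 1 - t) * p / (1 + r) ≤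
      (n - 1 - t) * p - 2 * (testDecay n / (1 + r)) * r * p +
      2 * (testDecay n / (1 + r)) * (1 + t) * w ^ 2 -
      (testDecay n / (1 + r)) ^ 2 * w ^ 2 * (r - t * w ^ 2) := by
  have ht1 : t ≤ 1 := by nlinarith
  obtain ⟨θ, hθ0, hθ1, hwθ⟩ : ∃ θ, 0 ≤ θ ∧ θ ≤ 1 ∧ w ^ 2 = θ * (r * p) :=
    ⟨w ^ 2 / (r * p), by positivity, div_le_one_of_le₀ hw (by positivity),
      (div_mul_cancel_of_imp fun h => le_antisymm (h ▸ hw) (sq_nonneg w)).symm⟩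
  set s := r / (1 + r) with hs
  have hs0 : 0 ≤ s := by positivity
  have hs1 : s ≤ 1 := div_le_one_of_le₀ (by linarith) (by linarith)
  have hbracket := le_decayBracket_mul hs0 hs1 hθ0 hθ1 ht0 ht1
    (decayBracket_testDecay_nonneg hn hθ0 hθ1 ht0 ht1)
  calc _ = p * ((1 - s) * (n - 1 - t)) := by
        rw [hs]
        field_simp
        ring
    _ ≤ p * decayBracket n (testDecay n * s) θ t := mul_le_mul_of_nonneg_left hbracket hp
    _ = _ := by
        rw [decayBracket, hwθ, show testDecay n * s = testDecay n / (1 + r) * r by rw [hs]; ring]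
        linear_combination -(testDecay n / (1 + r) * r) ^ 2 * θ ^ 2 * p * ht

namespace StableData

variable {n : ℕ} {G : EuclideanSpace ℝ (Fin n) → EuclideanSpace ℝ (Fin n)}
  {η : EuclideanSpace ℝ (Fin n) → ℝ} {κ N : ℝ} {x : EuclideanSpace ℝ (Fin n)}

lemma stabilityDensity_of_gradient_eq (hκ : ∇ η x = κ • x) :
    stabilityDensity G η x = mcFactor (G x) * (radial G x ^ 2 * κ ^ 2 *
        (‖x‖ ^ 2 - mcFactor (G x) ^ 2 * radial G x ^ 2) +
      η x ^ 2 * (1 + mcFactor (G x) ^ 2) * ‖G x‖ ^ 2 +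
      2 * η x * κ * radial G x ^ 2 * (1 + mcFactor (G x) ^ 2) -
      ‖G x‖ ^ 2 * (n * η x ^ 2 + 2 * η x * κ * ‖x‖ ^ 2)) := by
  have hx : ⟪G x, x⟫_ℝ = radial G x := real_inner_comm _ _
  rw [stabilityDensity, inner_mcDeriv_self, hκ, norm_smul, real_inner_smul_right,
    real_inner_smul_right, hx, real_inner_self_eq_norm_sq, mul_pow, Real.norm_eq_abs, sq_abs,
    fluxFactor, pohozaev]
  ring

lemma stabilityDensity_le_of_gradient_eq (hn : 2 ≤ n) (hκ : ∇ η x = κ • x)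
    (h : κ * (1 + ‖x‖ ^ 2) = -testDecay n * η x) :
    stabilityDensity G η x ≤ -(η x ^ 2 * (mcFactor (G x) *
      ((n - 1 - mcFactor (G x) ^ 2) * ‖G x‖ ^ 2 / (1 + ‖x‖ ^ 2)))) := by
  have hκη : κ = -(testDecay n / (1 + ‖x‖ ^ 2)) * η x := by
    field_simp
    linarith
  have hform := testDecay_form_le hn (sq_nonneg ‖x‖) (sq_nonneg ‖G x‖) (radial_sq_le G x)
    (sq_nonneg (mcFactor (G x))) (mcFactor_sq (G x))
  have hscaled := mul_le_mul_of_nonneg_left hform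
    (mul_nonneg (sq_nonneg (η x)) (mcFactor_pos (G x)).le)
  rw [stabilityDensity_of_gradient_eq hκ, hκη]
  linarith

lemma radial_sq_mul_sq_mul_sub_le (hN : |κ| * ‖x‖ ^ 2 ≤ N) :
    radial G x ^ 2 * κ ^ 2 * (‖x‖ ^ 2 - mcFactor (G x) ^ 2 * radial G x ^ 2) ≤
      N ^ 2 * ‖G x‖ ^ 2 :=
  calc _ ≤ radial G x ^ 2 * κ ^ 2 * ‖x‖ ^ 2 := by
        gcongr
        exact sub_le_self _ (by positivity)
    _ ≤ (‖x‖ ^ 2 * ‖G x‖ ^ 2) * κ ^ 2 * ‖x‖ ^ 2 := by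
        gcongr
        exact radial_sq_le G x
    _ = (|κ| * ‖x‖ ^ 2) ^ 2 * ‖G x‖ ^ 2 := by
        rw [mul_pow, sq_abs]
        ring
    _ ≤ _ := by gcongr

lemma mixed_radial_term_le (hcross : |2 * η x * κ| * ‖x‖ ^ 2 ≤ 2 * N ^ 2) :
    2 * η x * κ * radial G x ^ 2 * (1 + mcFactor (G x) ^ 2) ≤ 4 * (N ^ 2 * ‖G x‖ ^ 2) :=
  calc _ ≤ |2 * η x * κ| * radial G x ^ 2 * (1 + mcFactor (G x) ^ 2) := by
        gcongr
        exact le_abs_self _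
    _ ≤ |2 * η x * κ| * (‖x‖ ^ 2 * ‖G x‖ ^ 2) * (1 + 1) := by
        gcongr
        exacts [radial_sq_le G x, mcFactor_sq_le_one _]
    _ = 2 * (|2 * η x * κ| * ‖x‖ ^ 2) * ‖G x‖ ^ 2 := by ring
    _ ≤ 2 * (2 * N ^ 2) * ‖G x‖ ^ 2 := by gcongr
    _ = _ := by ring

lemma stabilityDensity_le_of_abs_le (hκ : ∇ η x = κ • x) (hη : |η x| ≤ N)
    (hN : |κ| * ‖x‖ ^ 2 ≤ N) : stabilityDensity G η x ≤ 9 * N ^ 2 * ‖G x‖ ^ 2 := by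
  have hN0 : 0 ≤ N := (abs_nonneg _).trans hη
  have hηN : η x ^ 2 ≤ N ^ 2 := sq_le_sq' (neg_le_of_abs_le hη) (le_of_abs_le hη)
  have hcross : |2 * η x * κ| * ‖x‖ ^ 2 ≤ 2 * N ^ 2 :=
    calc _ = 2 * |η x| * (|κ| * ‖x‖ ^ 2) := by
          rw [abs_mul, abs_mul, abs_two]
          ring
      _ ≤ 2 * N * N := by gcongr
      _ = _ := by ring
  have hquadratic : η x ^ 2 * (1 + mcFactor (G x) ^ 2) * ‖G x‖ ^ 2 ≤
      2 * (N ^ 2 * ‖G x‖ ^ 2) :=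
    calc _ ≤ N ^ 2 * (1 + 1) * ‖G x‖ ^ 2 := by
          gcongr
          exact mcFactor_sq_le_one _
      _ = _ := by ring
  have hdivergence : -(‖G x‖ ^ 2 * (n * η x ^ 2 + 2 * η x * κ * ‖x‖ ^ 2)) ≤
      2 * (N ^ 2 * ‖G x‖ ^ 2) := by
    have hsq : 0 ≤ n * η x ^ 2 := by positivity
    have hsign := mul_le_mul_of_nonneg_right (neg_abs_le (2 * η x * κ)) (sq_nonneg ‖x‖)
    have hfactor : -(n * η x ^ 2 + 2 * η x * κ * ‖x‖ ^ 2) ≤ 2 * N ^ 2 := by linarith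
    linarith [mul_le_mul_of_nonneg_left hfactor (sq_nonneg ‖G x‖)]
  rw [stabilityDensity_of_gradient_eq hκ]
  calc _ ≤ mcFactor (G x) * (9 * N ^ 2 * ‖G x‖ ^ 2) :=
        mul_le_mul_of_nonneg_left (by
          linarith [radial_sq_mul_sq_mul_sub_le (G := G) hN, mixed_radial_term_le (G := G) hcross])
          (mcFactor_pos _).le
    _ ≤ _ := mul_le_of_le_one_left (by positivity) (mcFactor_le_one _)

end StableData

lemma deriv_smoothTransition_of_neg {y : ℝ} (hy : y < 0) : deriv Real.smoothTransition y = 0 := by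
  have hzero : Real.smoothTransition =ᶠ[𝓝 y] fun _ => 0 := by
    filter_upwards [Iio_mem_nhds hy] with z hz
    exact Real.smoothTransition.zero_of_nonpos hz.le
  rw [hzero.deriv_eq, deriv_const]

lemma deriv_smoothTransition_of_one_lt {y : ℝ} (hy : 1 < y) :
    deriv Real.smoothTransition y = 0 := by
  have hone : Real.smoothTransition =ᶠ[𝓝 y] fun _ => 1 := by
    filter_upwards [Ioi_mem_nhds hy] with z hz
    exact Real.smoothTransition.one_of_one_le hz.le
  rw [hone.deriv_eq, deriv_const]

lemma exists_abs_deriv_smoothTransition_le :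
    ∃ C, 0 ≤ C ∧ ∀ y, |deriv Real.smoothTransition y| ≤ C := by
  have hcont : Continuous (deriv Real.smoothTransition) :=
    (Real.smoothTransition.contDiff (n := 1)).continuous_deriv le_rfl
  obtain ⟨C, hC⟩ := (isCompact_Icc (a := (0 : ℝ)) (b := 1)).exists_bound_of_continuousOn
    hcont.continuousOn
  have hC0 : 0 ≤ C := (norm_nonneg _).trans (hC 0 ⟨le_rfl, zero_le_one⟩)
  refine ⟨C, hC0, fun y => ?_⟩
  rcases lt_or_ge y 0 with hneg | hnonneg
  · rwa [deriv_smoothTransition_of_neg hneg, abs_zero]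
  rcases lt_or_ge 1 y with hgt | hle
  · rwa [deriv_smoothTransition_of_one_lt hgt, abs_zero]
  · exact hC y ⟨hnonneg, hle⟩

section RadialCutoff

variable {n : ℕ} {b R : ℝ} {x : EuclideanSpace ℝ (Fin n)}

lemma gradient_comp_norm_sq {g : ℝ → ℝ} {g' : ℝ} (hg : HasDerivAt g g' (‖x‖ ^ 2)) :
    ∇ (fun y => g (‖y‖ ^ 2)) x = (2 * g') • x := by
  have h : HasFDerivAt (fun y : EuclideanSpace ℝ (Fin n) => g (‖y‖ ^ 2)) _ x :=
    hg.comp_hasFDerivAt x (hasStrictFDerivAt_norm_sq x).hasFDerivAt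
  refine ext_inner_left ℝ fun v => ?_
  rw [real_inner_gradient, h.fderiv, real_inner_smul_right, real_inner_comm]
  simp only [smul_apply, innerSL_apply_apply, smul_eq_mul, nsmul_eq_mul, Nat.cast_ofNat]
  ring

/-- The function `(1 + |x|²)^(-b/2)`, cut off smoothly between `B_R` and `B_{2R}`. -/
noncomputable def radialCutoff (b R : ℝ) (x : EuclideanSpace ℝ (Fin n)) : ℝ :=
  (1 + ‖x‖ ^ 2) ^ (-b / 2) * Real.smoothTransition (3 - ‖x‖ ^ 2 / R ^ 2)

/-- The factor `κ` in `∇η = κ x`, for `η = radialCutoff b R`. -/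
noncomputable def radialCutoffSlope (b R : ℝ) (x : EuclideanSpace ℝ (Fin n)) : ℝ :=
  -b * radialCutoff b R x / (1 + ‖x‖ ^ 2) -
    2 * ((1 + ‖x‖ ^ 2) ^ (-b / 2) * deriv Real.smoothTransition (3 - ‖x‖ ^ 2 / R ^ 2) / R ^ 2)

lemma contDiff_radialCutoff :
    ContDiff ℝ ∞ (radialCutoff b R : EuclideanSpace ℝ (Fin n) → ℝ) := by
  have hsq : ContDiff ℝ ∞ fun x : EuclideanSpace ℝ (Fin n) => ‖x‖ ^ 2 := contDiff_norm_sq ℝ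
  exact ((contDiff_const.add hsq).rpow_const_of_ne fun x => by positivity).mul
    (Real.smoothTransition.contDiff.comp (contDiff_const.sub (hsq.div_const _)))

lemma gradient_radialCutoff (x : EuclideanSpace ℝ (Fin n)) :
    ∇ (radialCutoff b R) x = radialCutoffSlope b R x • x := by
  have hpos : 0 < 1 + ‖x‖ ^ 2 := by positivity
  have hpower : HasDerivAt (fun τ : ℝ => (1 + τ) ^ (-b / 2))
      (1 * (-b / 2) * (1 + ‖x‖ ^ 2) ^ (-b / 2 - 1)) (‖x‖ ^ 2) :=
    ((hasDerivAt_id _).const_add 1).rpow_const (Or.inl hpos.ne')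
  have htransition : HasDerivAt (fun τ : ℝ => Real.smoothTransition (3 - τ / R ^ 2))
      (deriv Real.smoothTransition (3 - ‖x‖ ^ 2 / R ^ 2) * (-(1 / R ^ 2))) (‖x‖ ^ 2) :=
    ((Real.smoothTransition.contDiff (n := 1)).differentiable (by simp) _).hasDerivAt.comp _
      (((hasDerivAt_id _).div_const _).const_sub 3)
  refine (gradient_comp_norm_sq (hpower.mul htransition)).trans ?_
  rw [radialCutoffSlope, radialCutoff, Real.rpow_sub_one hpos.ne']
  congr 1
  ring

lemma three_sub_norm_sq_div_neg (hR : 0 < R) (hx : 2 * R ≤ ‖x‖) : 3 - ‖x‖ ^ 2 / R ^ 2 < 0 := by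
  rw [sub_neg, lt_div_iff₀ (by positivity)]
  nlinarith

lemma one_lt_three_sub_norm_sq_div (hx : ‖x‖ < R) : 1 < 3 - ‖x‖ ^ 2 / R ^ 2 := by
  have hratio : ‖x‖ ^ 2 / R ^ 2 ≤ 1 := div_le_one_of_le₀ (by gcongr) (sq_nonneg R)
  linarith

lemma radialCutoff_of_two_mul_le (hR : 0 < R) (hx : 2 * R ≤ ‖x‖) : radialCutoff b R x = 0 := by
  rw [radialCutoff, Real.smoothTransition.zero_of_nonpos (three_sub_norm_sq_div_neg hR hx).le,
    mul_zero]

lemma radialCutoffSlope_of_two_mul_le (hR : 0 < R) (hx : 2 * R ≤ ‖x‖) :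
    radialCutoffSlope b R x = 0 := by
  rw [radialCutoffSlope, radialCutoff_of_two_mul_le hR hx,
    deriv_smoothTransition_of_neg (three_sub_norm_sq_div_neg hR hx)]
  ring

lemma hasCompactSupport_radialCutoff (hR : 0 < R) :
    HasCompactSupport (radialCutoff b R : EuclideanSpace ℝ (Fin n) → ℝ) :=
  HasCompactSupport.intro (isCompact_closedBall 0 (2 * R)) fun _ hx =>
    radialCutoff_of_two_mul_le hR (not_le.1 (mt mem_closedBall_zero_iff.2 hx)).le

lemma radialCutoff_of_norm_lt (hx : ‖x‖ < R) :
    radialCutoff b R x = (1 + ‖x‖ ^ 2) ^ (-b / 2) := by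
  rw [radialCutoff, Real.smoothTransition.one_of_one_le (one_lt_three_sub_norm_sq_div hx).le,
    mul_one]

lemma radialCutoffSlope_mul_of_norm_lt (hx : ‖x‖ < R) :
    radialCutoffSlope b R x * (1 + ‖x‖ ^ 2) = -b * radialCutoff b R x := by
  have hpos : 1 + ‖x‖ ^ 2 ≠ 0 := by positivity
  rw [radialCutoffSlope, deriv_smoothTransition_of_one_lt (one_lt_three_sub_norm_sq_div hx),
    mul_zero, zero_div, mul_zero, sub_zero, div_mul_cancel₀ _ hpos]

lemma one_add_norm_sq_rpow_le (hb : 0 ≤ b) (hR : 0 < R) (hx : R ≤ ‖x‖) :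
    (1 + ‖x‖ ^ 2) ^ (-b / 2) ≤ R ^ (-b) :=
  calc _ ≤ (R ^ 2) ^ (-b / 2) :=
        Real.rpow_le_rpow_of_nonpos (by positivity) (by nlinarith) (by linarith)
    _ = R ^ (-b) := by
        rw [← Real.rpow_natCast_mul hR.le]
        congr 1
        push_cast
        ring

lemma abs_radialCutoff_le (hb : 0 ≤ b) (hR : 0 < R) (hx : R ≤ ‖x‖) :
    |radialCutoff b R x| ≤ R ^ (-b) := by
  rw [radialCutoff, abs_of_nonneg (mul_nonneg (by positivity) (Real.smoothTransition.nonneg _))]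
  exact (mul_le_of_le_one_right (by positivity) (Real.smoothTransition.le_one _)).trans
    (one_add_norm_sq_rpow_le hb hR hx)

lemma abs_radialCutoffSlope_mul_norm_sq_le {C : ℝ}
    (hC : ∀ y, |deriv Real.smoothTransition y| ≤ C) (hb : 0 ≤ b) (hR : 0 < R) (hx : R ≤ ‖x‖)
    (hx2 : ‖x‖ < 2 * R) : |radialCutoffSlope b R x| * ‖x‖ ^ 2 ≤ (b + 8 * C) * R ^ (-b) := by
  have hC0 : 0 ≤ C := (abs_nonneg _).trans (hC 0)
  have hratio : ‖x‖ ^ 2 / (1 + ‖x‖ ^ 2) ≤ 1 := div_le_one_of_le₀ (by linarith) (by positivity)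
  have hratioR : ‖x‖ ^ 2 / R ^ 2 ≤ 4 := by
    rw [div_le_iff₀ (by positivity)]
    nlinarith
  set S' := deriv Real.smoothTransition (3 - ‖x‖ ^ 2 / R ^ 2)
  have hslope : |radialCutoffSlope b R x| ≤ b * |radialCutoff b R x| / (1 + ‖x‖ ^ 2) +
      2 * ((1 + ‖x‖ ^ 2) ^ (-b / 2) * |S'| / R ^ 2) := by
    have hpower : 0 ≤ (1 + ‖x‖ ^ 2) ^ (-b / 2) := by positivity
    refine (abs_sub _ _).trans_eq ?_
    rw [abs_div, abs_mul, abs_neg, abs_of_nonneg hb,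
      abs_of_nonneg (by positivity : 0 ≤ 1 + ‖x‖ ^ 2), abs_mul 2, abs_two, abs_div, abs_mul,
      abs_of_nonneg hpower, abs_of_nonneg (sq_nonneg R)]
  calc _ ≤ (b * |radialCutoff b R x| / (1 + ‖x‖ ^ 2) +
        2 * ((1 + ‖x‖ ^ 2) ^ (-b / 2) * |S'| / R ^ 2)) * ‖x‖ ^ 2 := by gcongr
    _ = b * |radialCutoff b R x| * (‖x‖ ^ 2 / (1 + ‖x‖ ^ 2)) +
        2 * ((1 + ‖x‖ ^ 2) ^ (-b / 2) * |S'| * (‖x‖ ^ 2 / R ^ 2)) := by ring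
    _ ≤ b * R ^ (-b) * 1 + 2 * (R ^ (-b) * C * 4) := by
        gcongr
        exacts [abs_radialCutoff_le hb hR hx, one_add_norm_sq_rpow_le hb hR hx, hC _]
    _ = _ := by ring

lemma exists_abs_radialCutoff_le (n : ℕ) (hb : 0 ≤ b) :
    ∃ M : ℝ, 0 < M ∧ ∀ R : ℝ, 0 < R → ∀ x : EuclideanSpace ℝ (Fin n), R ≤ ‖x‖ → ‖x‖ < 2 * R →
      |radialCutoff b R x| ≤ M * R ^ (-b) ∧ |radialCutoffSlope b R x| * ‖x‖ ^ 2 ≤ M * R ^ (-b) := by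
  obtain ⟨C, hC0, hC⟩ := exists_abs_deriv_smoothTransition_le
  refine ⟨1 + (b + 8 * C), by positivity, fun R hR x hx hx2 => ⟨?_, ?_⟩⟩
  · exact (abs_radialCutoff_le hb hR hx).trans
      (le_mul_of_one_le_left (Real.rpow_nonneg hR.le _) (by linarith))
  · exact (abs_radialCutoffSlope_mul_norm_sq_le hC hb hR hx hx2).trans
      (mul_le_mul_of_nonneg_right (by linarith) (Real.rpow_nonneg hR.le _))

end RadialCutoff

lemma ae_const_of_hasWeakDerivAlong_stdVec_zero {n : ℕ} [NeZero n]
    {u : EuclideanSpace ℝ (Fin n) → ℝ}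
    (h : ∀ i : Fin n, HasWeakDerivAlong (stdVec i) u fun _ => 0) :
    ∃ b : ℝ, u =ᵐ[volume] fun _ => b := by
  refine ae_const_of_hasWeakDerivAlong_zero fun e =>
    ⟨(h 0).locallyIntegrable, (h 0).locallyIntegrable_deriv, fun φ hφ hs => ?_⟩
  have hcoord (x : EuclideanSpace ℝ (Fin n)) :
      fderiv ℝ φ x e • u x = ∑ i, e i * (fderiv ℝ φ x (stdVec i) • u x) := by
    rw [← real_inner_gradient, euclidean_inner_eq_sum, smul_eq_mul, Finset.sum_mul]
    simp only [gradient_coord, smul_eq_mul, mul_assoc]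
  have hpartial (i : Fin n) : ∫ x, fderiv ℝ φ x (stdVec i) • u x = 0 := by
    simpa using (h i).integral_fderiv_smul φ hφ hs
  have hintegrable (i : Fin n) :
      Integrable (fun x => e i * (fderiv ℝ φ x (stdVec i) • u x)) volume :=
    ((h i).locallyIntegrable.integrable_smul_left_of_hasCompactSupport
      (contDiff_fderiv_apply hφ (stdVec i)).continuous
      (hs.fderiv_apply (𝕜 := ℝ) (stdVec i))).const_mul (e i)
  simp only [hcoord]
  rw [integral_finsetSum _ fun i _ => hintegrable i]
  simp only [integral_const_mul, hpartial, mul_zero, Finset.sum_const_zero, smul_zero, neg_zero,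
    integral_zero]

namespace StableData

variable {n : ℕ} {f : ℝ → ℝ} {u : EuclideanSpace ℝ (Fin n) → ℝ}
  {G : EuclideanSpace ℝ (Fin n) → EuclideanSpace ℝ (Fin n)}
  {W : Fin n → EuclideanSpace ℝ (Fin n) → EuclideanSpace ℝ (Fin n)}
  {W₂ : Fin n → Fin n → EuclideanSpace ℝ (Fin n) → EuclideanSpace ℝ (Fin n)}

lemma ae_const_of_gradient_ae_zero [NeZero n] (h : StableData f u G W W₂)
    (hG : G =ᵐ[volume] fun _ => 0) : ∃ b : ℝ, u =ᵐ[volume] fun _ => b :=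
  ae_const_of_hasWeakDerivAlong_stdVec_zero fun i => (h.weak_u i).congr EventuallyEq.rfl
    (hG.mono fun _ hx => congrArg (· i) hx)

/-- The density that bounds minus the stability density from below inside `B_R`, for the test
function `radialCutoff (testDecay n) R`. -/
noncomputable def coreDensity (G : EuclideanSpace ℝ (Fin n) → EuclideanSpace ℝ (Fin n))
    (x : EuclideanSpace ℝ (Fin n)) : ℝ :=
  ((1 + ‖x‖ ^ 2) ^ (-testDecay n / 2)) ^ 2 * (mcFactor (G x) *
    ((n - 1 - mcFactor (G x) ^ 2) * ‖G x‖ ^ 2 / (1 + ‖x‖ ^ 2)))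

lemma sub_one_sub_mcFactor_sq_nonneg (hn : 2 ≤ n) (p : EuclideanSpace ℝ (Fin n)) :
    0 ≤ (n : ℝ) - 1 - mcFactor p ^ 2 := by
  have hn' : (2 : ℝ) ≤ n := by exact_mod_cast hn
  linarith [mcFactor_sq_le_one p]

lemma coreDensity_nonneg (hn : 2 ≤ n) (x : EuclideanSpace ℝ (Fin n)) : 0 ≤ coreDensity G x :=
  mul_nonneg (sq_nonneg _) (mul_nonneg (mcFactor_pos _).le (div_nonneg
    (mul_nonneg (sub_one_sub_mcFactor_sq_nonneg hn _) (sq_nonneg _)) (by positivity)))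

lemma eq_zero_of_coreDensity_eq_zero (hn : 2 ≤ n) {x : EuclideanSpace ℝ (Fin n)}
    (h : coreDensity G x = 0) : G x = 0 := by
  have hn' : (2 : ℝ) ≤ n := by exact_mod_cast hn
  have hfactor := mcFactor_pos (G x)
  have hweight : (1 + ‖x‖ ^ 2) ^ (-testDecay n / 2) ≠ 0 :=
    (Real.rpow_pos_of_pos (by positivity) _).ne'
  have hx : 1 + ‖x‖ ^ 2 ≠ 0 := by positivity
  have hproduct : ((n : ℝ) - 1 - mcFactor (G x) ^ 2) * ‖G x‖ ^ 2 = 0 := by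
    simpa [coreDensity, hweight, hx, hfactor.ne'] using h
  rcases mul_eq_zero.1 hproduct with hdim | hG
  · have hsq : mcFactor (G x) ^ 2 * ‖G x‖ ^ 2 = 0 :=
      le_antisymm (by linarith [mcFactor_sq (G x)]) (by positivity)
    simpa [hfactor.ne'] using hsq
  · simpa using hG

lemma coreDensity_le (hn : 2 ≤ n) (x : EuclideanSpace ℝ (Fin n)) :
    coreDensity G x ≤ n * ‖G x‖ := by
  have hdim := sub_one_sub_mcFactor_sq_nonneg hn (G x)
  have hfactor := (mcFactor_pos (G x)).le
  have hx : 1 ≤ 1 + ‖x‖ ^ 2 := le_add_of_nonneg_right (sq_nonneg _)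
  have hweight : (1 + ‖x‖ ^ 2) ^ (-testDecay n / 2) ≤ 1 :=
    Real.rpow_le_one_of_one_le_of_nonpos hx (by linarith [testDecay_nonneg hn])
  calc _ ≤ mcFactor (G x) * ((n - 1 - mcFactor (G x) ^ 2) * ‖G x‖ ^ 2 / (1 + ‖x‖ ^ 2)) :=
        mul_le_of_le_one_left (by positivity) (pow_le_one₀ (by positivity) hweight)
    _ ≤ mcFactor (G x) * ((n - 1 - mcFactor (G x) ^ 2) * ‖G x‖ ^ 2) := by
        gcongr
        exact div_le_self (by positivity) hx
    _ ≤ mcFactor (G x) * (n * ‖G x‖ ^ 2) := by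
        gcongr
        linarith [sq_nonneg (mcFactor (G x))]
    _ = n * ‖G x‖ * (mcFactor (G x) * ‖G x‖) := by ring
    _ ≤ n * ‖G x‖ := mul_le_of_le_one_right (by positivity) (mcFactor_mul_norm_le_one _)

lemma aestronglyMeasurable_coreDensity (hG : AEStronglyMeasurable G volume) :
    AEStronglyMeasurable (coreDensity G) volume := by
  have hpos (x : EuclideanSpace ℝ (Fin n)) : 1 + ‖x‖ ^ 2 ≠ 0 := by positivity
  have hbase : Continuous fun x : EuclideanSpace ℝ (Fin n) => 1 + ‖x‖ ^ 2 := by fun_prop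
  have hweight : Continuous fun x : EuclideanSpace ℝ (Fin n) =>
      ((1 + ‖x‖ ^ 2) ^ (-testDecay n / 2)) ^ 2 :=
    (hbase.rpow_const fun x => Or.inl (hpos x)).pow 2
  have hinv : Continuous fun x : EuclideanSpace ℝ (Fin n) => (1 + ‖x‖ ^ 2)⁻¹ := hbase.inv₀ hpos
  have hfactor : AEStronglyMeasurable (fun x => mcFactor (G x)) volume :=
    contDiff_mcFactor.continuous.comp_aestronglyMeasurable hG
  exact hweight.aestronglyMeasurable.mul (hfactor.mul
    (((aestronglyMeasurable_const.sub (hfactor.pow 2)).mul (hG.norm.pow 2)).mul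
      hinv.aestronglyMeasurable))

lemma locallyIntegrable_coreDensity [NeZero n] (hn : 2 ≤ n) (h : StableData f u G W W₂) :
    LocallyIntegrable (coreDensity G) volume := by
  refine ((locallyIntegrable_norm h.locallyIntegrable_G).smul (n : ℝ)).mono
    (aestronglyMeasurable_coreDensity h.locallyIntegrable_G.aestronglyMeasurable)
    (Eventually.of_forall fun x => ?_)
  rw [Real.norm_of_nonneg (coreDensity_nonneg hn x)]
  exact (coreDensity_le hn x).trans (le_abs_self _)

lemma integrableOn_coreDensity_ball [NeZero n] (hn : 2 ≤ n) (h : StableData f u G W W₂) (r : ℝ) :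
    IntegrableOn (coreDensity G) (ball 0 r) volume :=
  ((h.locallyIntegrable_coreDensity hn).integrableOn_isCompact
    (isCompact_closedBall 0 r)).mono_set ball_subset_closedBall

lemma exists_integral_coreDensity_pos [NeZero n] (hn : 2 ≤ n) (h : StableData f u G W W₂)
    (hu : ¬ ∃ b : ℝ, u =ᵐ[volume] fun _ => b) :
    ∃ k : ℕ, 0 < ∫ x in ball 0 (k : ℝ), coreDensity G x := by
  by_contra! hnonpos
  have hball (k : ℕ) : ∀ᵐ x, x ∈ ball (0 : EuclideanSpace ℝ (Fin n)) (k : ℝ) → G x = 0 := by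
    have hzero : ∫ x in ball 0 (k : ℝ), coreDensity G x = 0 :=
      le_antisymm (hnonpos k) (integral_nonneg fun x => coreDensity_nonneg hn x)
    rw [integral_eq_zero_iff_of_nonneg (fun x => coreDensity_nonneg hn x)
      (h.integrableOn_coreDensity_ball hn k), EventuallyEq,
      ae_restrict_iff' measurableSet_ball] at hzero
    filter_upwards [hzero] with x hx hxk
    exact eq_zero_of_coreDensity_eq_zero hn (hx hxk)
  refine hu (h.ae_const_of_gradient_ae_zero ?_)
  filter_upwards [ae_all_iff.2 hball] with x hx
  obtain ⟨k, hk⟩ := exists_nat_gt ‖x‖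
  exact hx k (mem_ball_zero_iff.2 hk)

lemma stabilityDensity_radialCutoff_le {M R r : ℝ} (hn : 2 ≤ n) (hR : 0 < R) (hrR : r ≤ R)
    (hM : ∀ x : EuclideanSpace ℝ (Fin n), R ≤ ‖x‖ → ‖x‖ < 2 * R →
      |radialCutoff (testDecay n) R x| ≤ M ∧
        |radialCutoffSlope (testDecay n) R x| * ‖x‖ ^ 2 ≤ M) (x : EuclideanSpace ℝ (Fin n)) :
    stabilityDensity G (radialCutoff (testDecay n) R) x ≤
      (ball 0 (2 * R) \ ball 0 R).indicator (fun x => 9 * M ^ 2 * ‖G x‖ ^ 2) x -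
        (ball 0 r).indicator (coreDensity G) x := by
  have hgradient := gradient_radialCutoff (b := testDecay n) (R := R) x
  rcases lt_or_ge ‖x‖ R with hx | hx
  · have hxA : x ∉ ball (0 : EuclideanSpace ℝ (Fin n)) (2 * R) \ ball 0 R :=
      fun hxA => hxA.2 (mem_ball_zero_iff.2 hx)
    have hcore := stabilityDensity_le_of_gradient_eq (G := G) hn hgradient
      (radialCutoffSlope_mul_of_norm_lt hx)
    rw [radialCutoff_of_norm_lt hx] at hcore
    rw [Set.indicator_of_notMem hxA, zero_sub]
    exact hcore.trans
      (neg_le_neg (Set.indicator_le_self' (fun _ _ => coreDensity_nonneg hn _) x))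
  have hxr : x ∉ ball (0 : EuclideanSpace ℝ (Fin n)) r :=
    mem_ball_zero_iff.not.2 (not_lt.2 (hrR.trans hx))
  rw [Set.indicator_of_notMem hxr, sub_zero]
  rcases lt_or_ge ‖x‖ (2 * R) with hx2 | hx2
  · rw [Set.indicator_of_mem (show x ∈ _ \ _ from
      ⟨mem_ball_zero_iff.2 hx2, mem_ball_zero_iff.not.2 (not_lt.2 hx)⟩)]
    exact stabilityDensity_le_of_abs_le hgradient (hM x hx hx2).1 (hM x hx hx2).2
  · rw [Set.indicator_of_notMem fun hxA => hx2.not_gt (mem_ball_zero_iff.1 hxA.1),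
      stabilityDensity_of_gradient_eq hgradient, radialCutoff_of_two_mul_le hR hx2,
      radialCutoffSlope_of_two_mul_le hR hx2]
    simp

lemma exists_integral_coreDensity_le [NeZero n] (hn : 2 ≤ n) (h : StableData f u G W W₂) :
    ∃ M : ℝ, 0 < M ∧ ∀ R : ℝ, 0 < R → ∀ r ≤ R,
      IntegrableOn (fun x => ‖G x‖ ^ 2) (ball 0 (2 * R) \ ball 0 R) volume →
      ∫ x in ball 0 r, coreDensity G x ≤
        9 * (M * R ^ (-testDecay n)) ^ 2 * ∫ x in ball 0 (2 * R) \ ball 0 R, ‖G x‖ ^ 2 := by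
  obtain ⟨M, hM, hcutoff⟩ := exists_abs_radialCutoff_le n (testDecay_nonneg hn)
  refine ⟨M, hM, fun R hR r hrR hannulus => ?_⟩
  obtain ⟨hstability, hnonneg⟩ := h.integral_stabilityDensity_nonneg
    (contDiff_radialCutoff (b := testDecay n) (R := R)) (hasCompactSupport_radialCutoff hR)
  have hA : MeasurableSet (ball (0 : EuclideanSpace ℝ (Fin n)) (2 * R) \ ball 0 R) :=
    measurableSet_ball.diff measurableSet_ball
  have hcore : Integrable ((ball 0 r).indicator (coreDensity G)) volume :=
    (h.integrableOn_coreDensity_ball hn r).integrable_indicator measurableSet_ball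
  have henergy : Integrable ((ball 0 (2 * R) \ ball 0 R).indicator fun x =>
      9 * (M * R ^ (-testDecay n)) ^ 2 * ‖G x‖ ^ 2) volume :=
    IntegrableOn.integrable_indicator (hannulus.const_mul _) hA
  have hle := hnonneg.trans (integral_mono hstability (henergy.sub hcore)
    (stabilityDensity_radialCutoff_le hn hR hrR (hcutoff R hR)))
  rw [integral_sub' henergy hcore, integral_indicator hA, integral_indicator measurableSet_ball,
    integral_const_mul] at hle
  exact sub_nonneg.1 hle

end StableData

section LAverage

variable {α F : Type*} [MeasurableSpace α] [NormedAddCommGroup F] {μ : Measure α} {g : α → F}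

lemma integrable_norm_sq_of_lintegral_ne_top (hg : AEStronglyMeasurable g μ)
    (h : ∫⁻ x, ‖g x‖ₑ ^ 2 ∂μ ≠ ⊤) : Integrable (fun x => ‖g x‖ ^ 2) μ := by
  refine ⟨hg.norm.pow 2, ?_⟩
  rw [hasFiniteIntegral_iff_enorm]
  simpa only [enorm_pow, enorm_norm] using h.lt_top

lemma ofReal_integral_norm_sq (h : Integrable (fun x => ‖g x‖ ^ 2) μ) :
    ENNReal.ofReal (∫ x, ‖g x‖ ^ 2 ∂μ) = ∫⁻ x, ‖g x‖ₑ ^ 2 ∂μ := by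
  rw [ofReal_integral_eq_lintegral_ofReal h (Eventually.of_forall fun x => sq_nonneg ‖g x‖)]
  simp only [ENNReal.ofReal_pow (norm_nonneg _), ofReal_norm]

lemma ofReal_le_setLAverage_norm_sq {A : Set α} {c v : ℝ}
    (hg : AEStronglyMeasurable g (μ.restrict A)) (hc : 0 < c) (hv : 0 < v)
    (hA : μ A ≤ ENNReal.ofReal v)
    (h : IntegrableOn (fun x => ‖g x‖ ^ 2) A μ → c * v ≤ ∫ x in A, ‖g x‖ ^ 2 ∂μ) :
    ENNReal.ofReal c ≤ ⨍⁻ x in A, ‖g x‖ₑ ^ 2 ∂μ := by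
  have hA0 : μ A ≠ 0 := fun hzero => by
    have hle := h (IntegrableOn.of_measure_zero hzero)
    rw [setIntegral_measure_zero _ hzero] at hle
    exact (mul_pos hc hv).not_ge hle
  rw [setLAverage_eq,
    ENNReal.le_div_iff_mul_le (Or.inl hA0) (Or.inl (hA.trans_lt ENNReal.ofReal_lt_top).ne)]
  rcases eq_or_ne (∫⁻ x in A, ‖g x‖ₑ ^ 2 ∂μ) ⊤ with htop | hfinite
  · exact htop ▸ le_top
  have hintegrable := integrable_norm_sq_of_lintegral_ne_top hg hfinite
  calc _ ≤ ENNReal.ofReal c * ENNReal.ofReal v := by gcongr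
    _ = ENNReal.ofReal (c * v) := (ENNReal.ofReal_mul hc.le).symm
    _ ≤ ENNReal.ofReal (∫ x in A, ‖g x‖ ^ 2 ∂μ) := ENNReal.ofReal_le_ofReal (h hintegrable)
    _ = _ := ofReal_integral_norm_sq hintegrable

lemma setLAverage_le_of_ae_le {A : Set α} {c : ℝ≥0∞} {g : α → ℝ≥0∞} (hA : MeasurableSet A)
    (h : ∀ᵐ x ∂μ, x ∈ A → g x ≤ c) : ⨍⁻ x in A, g x ∂μ ≤ c := by
  rw [setLAverage_eq]
  refine ENNReal.div_le_of_le_mul ?_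
  rw [← setLIntegral_const]
  exact setLIntegral_mono_ae' hA h

lemma eventually_setLAverage_annulus_le {E : Type*} [NormedAddCommGroup E] [MeasurableSpace E]
    [OpensMeasurableSpace E] {μ : Measure E} {g : E → F} {q ε : ℝ} (hq : q ≤ 0) (hε : 0 < ε)
    (hg : g =o[Bornology.cobounded E ⊓ ae μ] fun x => ‖x‖ ^ q) :
    ∀ᶠ R in atTop, ⨍⁻ x in ball (0 : E) (2 * R) \ ball 0 R, ‖g x‖ₑ ^ 2 ∂μ ≤
      ENNReal.ofReal (ε * R ^ (2 * q)) := by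
  obtain ⟨s, hs, t, ht, hst⟩ := eventually_inf.1 (hg.def (Real.sqrt_pos.2 hε))
  obtain ⟨r, -, hr⟩ := hasBasis_cobounded_norm.mem_iff.1 hs
  filter_upwards [eventually_gt_atTop 0, eventually_ge_atTop r] with R hR hrR
  refine setLAverage_le_of_ae_le (measurableSet_ball.diff measurableSet_ball) ?_
  filter_upwards [ht] with x hxt hxA
  have hxR : R ≤ ‖x‖ := not_lt.1 (mt mem_ball_zero_iff.2 hxA.2)
  have hx := hst x ⟨hr (hrR.trans hxR), hxt⟩
  rw [Real.norm_of_nonneg (Real.rpow_nonneg (norm_nonneg x) _)] at hx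
  rw [← ofReal_norm, ← ENNReal.ofReal_pow (norm_nonneg _)]
  refine ENNReal.ofReal_le_ofReal ?_
  calc ‖g x‖ ^ 2 ≤ (√ε * R ^ q) ^ 2 := by
        gcongr
        exact hx.trans (mul_le_mul_of_nonneg_left (Real.rpow_le_rpow_of_nonpos hR hxR hq)
          (Real.sqrt_nonneg ε))
    _ = ε * R ^ (2 * q) := by
        rw [mul_pow, Real.sq_sqrt hε.le, ← Real.rpow_mul_natCast hR.le, Nat.cast_two, mul_comm q]

end LAverage

lemma volume_annulus_le {n : ℕ} [NeZero n] {R : ℝ} (hR : 0 < R) :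
    volume (ball (0 : EuclideanSpace ℝ (Fin n)) (2 * R) \ ball 0 R) ≤
      ENNReal.ofReal ((2 * R) ^ n * volume.real (ball (0 : EuclideanSpace ℝ (Fin n)) 1)) := by
  refine (measure_mono Set.sdiff_subset).trans_eq ?_
  rw [Measure.addHaar_ball _ _ (by positivity), finrank_euclideanSpace_fin,
    ENNReal.ofReal_mul (by positivity), measureReal_def,
    ENNReal.ofReal_toReal measure_ball_lt_top.ne]

lemma rpow_two_mul_liouvilleExponent (n : ℕ) {R : ℝ} (hR : 0 < R) :
    R ^ (2 * liouvilleExponent n) = (R ^ testDecay n) ^ 2 / R ^ n := by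
  rw [two_mul_liouvilleExponent, Real.rpow_sub hR, Real.rpow_natCast, mul_comm (2 : ℝ),
    ← Nat.cast_two, Real.rpow_mul_natCast hR.le]

lemma StableData.exists_le_setLAverage_annulus {n : ℕ} [NeZero n] (hn : 2 ≤ n) {f : ℝ → ℝ}
    {u : EuclideanSpace ℝ (Fin n) → ℝ} {G : EuclideanSpace ℝ (Fin n) → EuclideanSpace ℝ (Fin n)}
    {W : Fin n → EuclideanSpace ℝ (Fin n) → EuclideanSpace ℝ (Fin n)}
    {W₂ : Fin n → Fin n → EuclideanSpace ℝ (Fin n) → EuclideanSpace ℝ (Fin n)}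
    (h : StableData f u G W W₂) (hu : ¬ ∃ b : ℝ, u =ᵐ[volume] fun _ => b) :
    ∃ c : ℝ, 0 < c ∧ ∃ R₀ : ℝ, 2 < R₀ ∧ ∀ R : ℝ, R₀ ≤ R →
      ENNReal.ofReal (c * R ^ (2 * liouvilleExponent n)) ≤
        ⨍⁻ x in ball (0 : EuclideanSpace ℝ (Fin n)) (2 * R) \ ball 0 R, ‖G x‖ₑ ^ 2 ∂volume := by
  obtain ⟨k, hk⟩ := h.exists_integral_coreDensity_pos hn hu
  obtain ⟨M, hM, henergy⟩ := h.exists_integral_coreDensity_le hn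
  set V := volume.real (ball (0 : EuclideanSpace ℝ (Fin n)) 1)
  have hV : 0 < V := ENNReal.toReal_pos (measure_ball_pos _ _ one_pos).ne' measure_ball_lt_top.ne
  set c₀ := ∫ x in ball 0 (k : ℝ), coreDensity G x
  refine ⟨c₀ / (9 * M ^ 2 * (2 ^ n * V)), by positivity, max 3 k,
    lt_max_of_lt_left (by norm_num), fun R hR => ?_⟩
  have hR0 : 0 < R := by linarith [(le_max_left (3 : ℝ) k).trans hR]
  have hvolume : volume (ball (0 : EuclideanSpace ℝ (Fin n)) (2 * R) \ ball 0 R) ≤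
      ENNReal.ofReal ((2 * R) ^ n * V) := volume_annulus_le hR0
  refine ofReal_le_setLAverage_norm_sq h.locallyIntegrable_G.aestronglyMeasurable.restrict
    (by positivity) (by positivity) hvolume fun hannulus => ?_
  have hlower := henergy R hR0 k ((le_max_right _ _).trans hR) hannulus
  set D := ∫ x in ball 0 (2 * R) \ ball 0 R, ‖G x‖ ^ 2
  have hRb : 0 < R ^ testDecay n := Real.rpow_pos_of_pos hR0 _
  rw [Real.rpow_neg hR0.le] at hlower
  rw [rpow_two_mul_liouvilleExponent n hR0, mul_pow]
  calc _ = c₀ * ((R ^ testDecay n) ^ 2 / (9 * M ^ 2)) := by field_simp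
    _ ≤ 9 * (M * (R ^ testDecay n)⁻¹) ^ 2 * D * ((R ^ testDecay n) ^ 2 / (9 * M ^ 2)) := by
        gcongr
    _ = D := by field_simp

/-- Functions in `W^{3,1}_loc` are identified up to null sets, so "constant" means constant almost
everywhere. The average of `|∇u|²` is taken in `[0, ∞]`, since `|∇u|²` need not be integrable.
The growth condition is understood for almost every `x`, as `|x| → ∞`. -/
theorem theorem1p6 (n : ℕ) (hn : 2 ≤ n) (f : ℝ → ℝ) (hf : ContDiff ℝ 1 f)
    (u : EuclideanSpace ℝ (Fin n) → ℝ) (hu : MemSobolevLoc 3 u) (hstable : IsStableSolution f u)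
    (G : EuclideanSpace ℝ (Fin n) → EuclideanSpace ℝ (Fin n)) (hG : HasWeakGradient u G) :
    ((¬ ∃ b : ℝ, u =ᵐ[volume] fun _ => b) →
      ∃ c : ℝ, 0 < c ∧ ∃ R₀ : ℝ, 2 < R₀ ∧ ∀ R : ℝ, R₀ ≤ R →
        ENNReal.ofReal (c * R ^ (2 * liouvilleExponent n)) ≤
          ⨍⁻ x in ball (0 : EuclideanSpace ℝ (Fin n)) (2 * R) \ ball 0 R,
            ‖G x‖ₑ ^ 2 ∂volume) ∧
    (G =o[Bornology.cobounded (EuclideanSpace ℝ (Fin n)) ⊓ ae volume]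
        (fun x => ‖x‖ ^ liouvilleExponent n) →
      ∃ b : ℝ, u =ᵐ[volume] fun _ => b) := by
  have : NeZero n := ⟨by omega⟩
  obtain ⟨W, W₂, h⟩ := hstable.exists_stableData hf hu hG
  refine ⟨h.exists_le_setLAverage_annulus hn, fun hdecay => ?_⟩
  by_contra hconst
  obtain ⟨c, hc, R₀, hR₀, hlower⟩ := h.exists_le_setLAverage_annulus hn hconst
  obtain ⟨R, hupper, hR⟩ := ((eventually_setLAverage_annulus_le (liouvilleExponent_nonpos n)
    (half_pos hc) hdecay).and (eventually_ge_atTop R₀)).exists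
  have hpower : 0 < R ^ (2 * liouvilleExponent n) := Real.rpow_pos_of_pos (by linarith) _
  have hle := (ENNReal.ofReal_le_ofReal_iff (by positivity)).1 ((hlower R hR).trans hupper)
  exact (half_lt_self hc).not_ge (le_of_mul_le_mul_right hle hpower)
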